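/- There is an absolute constant $c>0$ such that for all $M,L,m>0$ there is a constant $C=C(M,L,m)>0$ with the following property. Let $d,n\ge 1$ and let $V:\mathbb R^d\to\mathbb R$ be strictly convex and twice continuously differentiable with $\int_{\mathbb R^d}e^{-V(x)}\,dx=1$, $\sup_x\|V''(x)\|\le M$ and $\|V''(x)-V''(y)\|\le L\|x-y\|$ for all $x,y$ (operator norm). Let $\xi\sim e^{-V(x)}dx$ and suppose that the Fisher information $\mathcal I:=\mathbb E\,V'(\xi)\otimes V'(\xi)$ satisfies $\mathcal I\succeq m I_d$. Suppose also that $$d\le\gamma n,\qquad \gamma:=c\Bigl(\frac mM\wedge\frac{m^2}{L\sqrt M}\Bigr)^2 .$$ For $\theta\in\mathbb R^d$ let $X_1,\dots,X_n$ be i.i.d. with density $e^{-V(x-\theta)}$ under $\mathbb P_\theta$, and put $\xi_j:=X_j-\theta$. Then the maximum likelihood estimator $\hat\theta:=\operatorname{argmin}_{\theta'\in\mathbb R^d}n^{-1}\sum_{j=1}^nV(X_j-\theta')$ exists and is unique for every sample, and for every $\rho\in(0,1]$ and every $f\in C^s$, $s=1+\rho$, the variable $f(\hat\theta)$ is integrable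 under every $\mathbb P_\theta$ and $$\sup_{\theta\in\mathbb R^d}\Bigl\|f(\hat\theta)-\mathbb E_\theta f(\hat\theta)-n^{-1}\sum_{j=1}^n\langle V'(\xi_j),\mathcal I^{-1}f'(\theta)\rangle\Bigr\|_{L_{\psi_{2/3}}(\mathbb P_\theta)}\le C\,\sqrt{c(V)}\,\|f\|_{C^s}\,\frac1{\sqrt n}\Bigl(\frac dn\Bigr)^{\rho/2}.$$ Here $\|\eta\|_{\psi_\alpha}:=\sup_{p\ge1}p^{-1/\alpha}(\mathbb E|\eta|^p)^{1/p}$; $c(V)$ is the Poincaré constant of $\xi$, i.e. the smallest $K$ with $\operatorname{Var}g(\xi)\le K\,\mathbb E\|\nabla g(\xi)\|^2$ for all locally Lipschitz $g:\mathbb R^d\to\mathbb R$; and, for differentiable $f$, $$\|f\|_{C^{1+\rho}}:=\max\Bigl\{\sup_x|f(x)|,\ \sup_x\|f'(x)\|,\ \sup_{x\ne y}\frac{\|f'(x)-f'(y)\|}{\|x-y\|^\rho}\Bigr\},$$ with $f\in C^{1+\rho}$ meaning that this is finite. -/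

import Mathlib

open MeasureTheory ProbabilityTheory Set
open scoped ENNReal RealInnerProductSpace Gradient

noncomputable section

namespace LogConcaveLocation

/-- The law `P_θ(dx) = e^{-V(x - θ)} dx` on `ℝ^d`. -/
def law {d : ℕ} (V : EuclideanSpace ℝ (Fin d) → ℝ) (θ : EuclideanSpace ℝ (Fin d)) :
    Measure (EuclideanSpace ℝ (Fin d)) :=
  volume.withDensity fun x => ENNReal.ofReal (Real.exp (-V (x - θ)))

/-- The joint law of an i.i.d. sample `X_1, …, X_n` from `P_θ`. -/
def sampleLaw {d : ℕ} (V : EuclideanSpace ℝ (Fin d) → ℝ) (n : ℕ)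
    (θ : EuclideanSpace ℝ (Fin d)) : Measure (Fin n → EuclideanSpace ℝ (Fin d)) :=
  Measure.pi fun _ => law V θ

/-- The normalized negative log-likelihood `n⁻¹ ∑ V(x_j - θ)` of the parameter `θ`. -/
def empRisk {d n : ℕ} (V : EuclideanSpace ℝ (Fin d) → ℝ)
    (x : Fin n → EuclideanSpace ℝ (Fin d)) (θ : EuclideanSpace ℝ (Fin d)) : ℝ :=
  (n : ℝ)⁻¹ * ∑ j, V (x j - θ)

/-- The maximum likelihood estimator: a minimizer of the negative log-likelihood
(with an arbitrary value when there is none). -/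
def mle {d n : ℕ} (V : EuclideanSpace ℝ (Fin d) → ℝ)
    (x : Fin n → EuclideanSpace ℝ (Fin d)) : EuclideanSpace ℝ (Fin d) :=
  Classical.epsilon fun θ => IsMinOn (empRisk V x) univ θ

/-- The Hessian `V''(x)`, as a linear operator on `ℝ^d`. -/
def hessian {d : ℕ} (V : EuclideanSpace ℝ (Fin d) → ℝ) (x : EuclideanSpace ℝ (Fin d)) :
    EuclideanSpace ℝ (Fin d) →L[ℝ] EuclideanSpace ℝ (Fin d) :=
  fderiv ℝ (gradient V) x

/-- The Fisher information `𝓘 = 𝔼 V'(ξ) ⊗ V'(ξ)`, `ξ ∼ e^{-V(x)} dx`, as a linear operator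
(`rankOne ℝ v v` is the operator `u ↦ ⟪v, u⟫ v`). -/
def fisher {d : ℕ} (V : EuclideanSpace ℝ (Fin d) → ℝ) :
    EuclideanSpace ℝ (Fin d) →L[ℝ] EuclideanSpace ℝ (Fin d) :=
  ∫ x, InnerProductSpace.rankOne ℝ (gradient V x) (gradient V x) ∂(law V 0)

/-- The Poincaré constant of a measure on `ℝ^d`: the smallest `C` with
`Var g ≤ C 𝔼 ‖∇ g‖²` for all locally Lipschitz `g` (it is `∞` if there is none).
The variance is `∞` for `g` that is not square integrable, and `‖fderiv ℝ g x‖ = ‖∇ g(x)‖`. -/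
def poincareConst {d : ℕ} (μ : Measure (EuclideanSpace ℝ (Fin d))) : ℝ≥0∞ :=
  sInf {C | ∀ g : EuclideanSpace ℝ (Fin d) → ℝ, LocallyLipschitz g →
    evariance g μ ≤ C * ∫⁻ x, ‖fderiv ℝ g x‖ₑ ^ 2 ∂μ}

/-- The `ψ_α`-norm in its moment form, `sup_{p ≥ 1} p^{-1/α} (𝔼 |η|^p)^{1/p}`. -/
def psiNorm {Ω : Type*} [MeasurableSpace Ω] (α : ℝ) (η : Ω → ℝ) (P : Measure Ω) : ℝ≥0∞ :=
  ⨆ (p : ℝ) (_ : 1 ≤ p), ENNReal.ofReal (p ^ (-1 / α)) * eLpNorm η (ENNReal.ofReal p) P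

/-- The Hölder norm `‖f‖_{C^s}`, `s = l + ρ`, of an `l` times differentiable function. -/
def holderNorm {d : ℕ} (l : ℕ) (ρ : ℝ) (f : EuclideanSpace ℝ (Fin d) → ℝ) : ℝ≥0∞ :=
  (⨆ (j : ℕ) (_ : j ≤ l) (x : EuclideanSpace ℝ (Fin d)), ‖iteratedFDeriv ℝ j f x‖ₑ) ⊔
    ⨆ (x : EuclideanSpace ℝ (Fin d)) (y : EuclideanSpace ℝ (Fin d)) (_ : x ≠ y),
      ‖iteratedFDeriv ℝ l f x - iteratedFDeriv ℝ l f y‖ₑ / ENNReal.ofReal (‖x - y‖ ^ ρ)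

/-- Membership in the Hölder space `C^s`, `s = l + ρ`. -/
def MemHolderSpace {d : ℕ} (l : ℕ) (ρ : ℝ) (f : EuclideanSpace ℝ (Fin d) → ℝ) : Prop :=
  ContDiff ℝ l f ∧ holderNorm l ρ f < ∞

end LogConcaveLocation

end

/-!
By translation it suffices to treat `θ = 0`. Write `S = n⁻¹ ∑ V'(x_j)` for the empirical score
(`empScore`), `Δ = n⁻¹ ∑ V''(x_j) - 𝓘` for the deviation of the empirical Hessian from the Fisher
information (`hessianDev`), and `R = f(θ̂) - f(0) - ⟪S, 𝓘⁻¹ f'(0)⟫` for the remainder of the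
linearization (`linRemainder`). The variable to be bounded is `R - 𝔼 R`.

*Poincaré.* The Poincaré inequality tensorizes by the Efron-Stein inequality, and applied to signed
powers it gives `‖g - 𝔼 g‖_q ≤ q √K ‖∇ g‖_q` for bounded locally Lipschitz `g`
(`Poincare.eLpNorm_sub_integral_le`). Differentiability almost everywhere is Rademacher's theorem,
so slopes need only be bounded at points of differentiability.

*Gradient of the remainder.* Where `‖Δ‖` and `‖S‖` are below multiples of `m` and `m² / L`, the
empirical risk is strongly convex near `0`, so `‖θ̂‖ ≤ (2 / m) ‖S‖` and `θ̂` is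
`(2 M / m) n^{-1/2}`-Lipschitz in the sample. Linearizing the likelihood equation shows that
increments of `𝓘 θ̂` and of `S` agree to first order up to a factor controlled by `‖Δ‖ + ‖θ̂‖`
(`norm_fisher_mle_sub_sub_le`). Hence the truncation of `R` to such samples has gradient at most a
constant times `n^{-1/2} (‖S‖^ρ + ‖S‖ + ‖Δ‖)` (`abs_fderiv_truncRemainder_le`). The implicit
function theorem is not needed.

*Size of `S` and `Δ`.* Shifting the density shows that the score is sub-Gaussian
(`hasSubgaussianMGF_score`), and `V''` is bounded with mean `𝓘` (`integral_inner_hessian`). With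
`1/2`-nets this yields `‖S‖_q, ‖Δ‖_q ≲ √(q d / n)`, which turns the gradient bound into the rate
`q^{3/2} n^{-1/2} (d / n)^{ρ / 2}`.

*Truncation error.* The truncation is inactive outside an event of probability at most
`2 e^{-κ n}` (`measure_cutoffStat_ge_le`); the hypothesis `d ≤ γ n` is what makes the cardinality
`25 ^ d` of the nets harmless here. The resulting error is of order `q^{3/2} / n`, which is
dominated by the rate, since `c(V) ≥ m / M²` (`le_poincareConst`).
-/

noncomputable section

namespace LogConcaveLocation

/-! ### Tensorization of the Poincaré inequality -/

section Tensorization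

variable {α β : Type*} [MeasurableSpace α] [MeasurableSpace β]

theorem memLp_of_abs_le {μ : Measure α} [IsFiniteMeasure μ] {g : α → ℝ} (hg : Measurable g)
    {B : ℝ} (hB : ∀ x, |g x| ≤ B) (p : ℝ≥0∞) : MemLp g p μ :=
  MemLp.of_bound hg.aestronglyMeasurable B (Filter.Eventually.of_forall fun x => by simpa using hB x)

theorem sq_integral_le_integral_sq {μ : Measure α} [IsProbabilityMeasure μ] {h : α → ℝ}
    (hh : MemLp h 2 μ) : (∫ x, h x ∂μ) ^ 2 ≤ ∫ x, h x ^ 2 ∂μ := by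
  have := variance_nonneg h μ
  rw [variance_eq_sub hh] at this
  simpa using this

/-- Bias-variance decomposition around an arbitrary centre. -/
theorem lintegral_sub_sq_eq {ν : Measure β} [IsProbabilityMeasure ν] {h : β → ℝ}
    (hh : MemLp h 2 ν) (a : ℝ) :
    ∫⁻ y, ENNReal.ofReal ((h y - a) ^ 2) ∂ν
      = evariance h ν + ENNReal.ofReal ((∫ y, h y ∂ν - a) ^ 2) := by
  have h1 : MemLp (fun y => h y - a) 2 ν := hh.sub (memLp_const a)
  rw [← ofReal_integral_eq_lintegral_ofReal h1.integrable_sq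
    (Filter.Eventually.of_forall fun y => sq_nonneg _), ← ofReal_variance hh,
    ← ENNReal.ofReal_add (variance_nonneg _ _) (sq_nonneg _),
    ← variance_sub_const hh.aestronglyMeasurable a, variance_eq_sub h1]
  congr 1
  simp only [Pi.pow_apply]
  rw [integral_sub (hh.integrable one_le_two) (integrable_const _)]
  simp

/-- The Efron-Stein inequality for a product of two probability spaces. -/
theorem evariance_prod_le {μ : Measure α} {ν : Measure β} [IsProbabilityMeasure μ]
    [IsProbabilityMeasure ν] {g : α × β → ℝ} (hg : Measurable g) {B : ℝ}
    (hB : ∀ z, |g z| ≤ B) :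
    evariance g (μ.prod ν) ≤ ∫⁻ y, evariance (fun x => g (x, y)) μ ∂ν
      + ∫⁻ x, evariance (fun y => g (x, y)) ν ∂μ := by
  set m := ∫ z, g z ∂(μ.prod ν) with hm
  have hgi : Integrable g (μ.prod ν) := (memLp_of_abs_le hg hB 1).integrable le_rfl
  have hx : ∀ x, Measurable fun y => g (x, y) := fun x => hg.comp measurable_prodMk_left
  have hy : ∀ y, Measurable fun x => g (x, y) := fun y => hg.comp measurable_prodMk_right
  have hb : Measurable fun x => ∫ y, g (x, y) ∂ν :=
    (hg.stronglyMeasurable.integral_prod_right').measurable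
  have hc : Measurable fun y => ∫ x, g (x, y) ∂μ :=
    (hg.stronglyMeasurable.integral_prod_left').measurable
  have hcB : ∀ y, |∫ x, g (x, y) ∂μ| ≤ B := fun y => by
    have := norm_integral_le_of_norm_le_const (μ := μ) (f := fun x => g (x, y)) (C := B)
      (Filter.Eventually.of_forall fun x => hB (x, y))
    simpa using this
  have hm1 : m = ∫ x, ∫ y, g (x, y) ∂ν ∂μ := integral_prod _ hgi
  have hm2 : m = ∫ y, ∫ x, g (x, y) ∂μ ∂ν := integral_prod_symm _ hgi
  have key : ∀ x, ENNReal.ofReal ((∫ y, g (x, y) ∂ν - m) ^ 2)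
      ≤ ∫⁻ y, ENNReal.ofReal ((g (x, y) - ∫ x', g (x', y) ∂μ) ^ 2) ∂ν := fun x => by
    have h1 : MemLp (fun y => g (x, y) - ∫ x', g (x', y) ∂μ) 2 ν :=
      (memLp_of_abs_le (hx x) (fun y => hB _) 2).sub (memLp_of_abs_le hc hcB 2)
    rw [← ofReal_integral_eq_lintegral_ofReal h1.integrable_sq
      (Filter.Eventually.of_forall fun y => sq_nonneg _)]
    refine ENNReal.ofReal_le_ofReal (le_trans (le_of_eq ?_) (sq_integral_le_integral_sq h1))
    rw [integral_sub ((memLp_of_abs_le (hx x) (fun y => hB _) 1).integrable le_rfl)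
      ((memLp_of_abs_le hc hcB 1).integrable le_rfl), ← hm2]
  calc evariance g (μ.prod ν)
      = ∫⁻ x, ∫⁻ y, ENNReal.ofReal ((g (x, y) - m) ^ 2) ∂ν ∂μ := by
        rw [evariance_eq_lintegral_ofReal, lintegral_prod]
        exact ((hg.sub_const _).pow_const 2).ennreal_ofReal.aemeasurable
    _ = ∫⁻ x, (evariance (fun y => g (x, y)) ν
          + ENNReal.ofReal ((∫ y, g (x, y) ∂ν - m) ^ 2)) ∂μ := by
        refine lintegral_congr fun x => lintegral_sub_sq_eq (memLp_of_abs_le (hx x) (fun y => hB _) 2) m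
    _ = ∫⁻ x, ENNReal.ofReal ((∫ y, g (x, y) ∂ν - m) ^ 2) ∂μ
          + ∫⁻ x, evariance (fun y => g (x, y)) ν ∂μ := by
        rw [← lintegral_add_left ((hb.sub_const _).pow_const 2).ennreal_ofReal]
        simp_rw [add_comm]
    _ ≤ _ := by
        gcongr
        refine (lintegral_mono key).trans (le_of_eq ?_)
        rw [lintegral_lintegral_swap]
        · simp_rw [evariance_eq_lintegral_ofReal]
        · exact ((hg.sub (hc.comp measurable_snd)).pow_const 2).ennreal_ofReal.aemeasurable

end Tensorization

section ProductPoincare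

variable {E : Type*} [NormedAddCommGroup E] [InnerProductSpace ℝ E] [FiniteDimensional ℝ E]
  [MeasurableSpace E] [BorelSpace E]

/-- The Poincaré inequality with constant `K` for a measure on a Euclidean space. -/
def Poincare (μ : Measure E) (K : ℝ≥0∞) : Prop :=
  ∀ g : E → ℝ, LocallyLipschitz g → evariance g μ ≤ K * ∫⁻ x, ‖fderiv ℝ g x‖ₑ ^ 2 ∂μ

/-- Tensorization of the Poincaré inequality: `D j` bounds the partial derivative in the
`j`-th variable almost everywhere. -/
theorem Poincare.evariance_pi_le {μ : Measure E} [IsProbabilityMeasure μ] {K : ℝ≥0∞}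
    (hμ : Poincare μ K) {B : ℝ} (n : ℕ) (g : (Fin n → E) → ℝ) (hg : LocallyLipschitz g)
    (hB : ∀ x, |g x| ≤ B) (D : Fin n → (Fin n → E) → ℝ≥0∞) (hD : ∀ j, Measurable (D j))
    (hgD : ∀ᵐ x ∂(Measure.pi fun _ : Fin n => μ), ∀ j,
      ‖fderiv ℝ (fun t => g (Function.update x j t)) (x j)‖ₑ ^ 2 ≤ D j x) :
    evariance g (Measure.pi fun _ : Fin n => μ)
      ≤ K * ∑ j, ∫⁻ x, D j x ∂(Measure.pi fun _ : Fin n => μ) := by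
  induction n with
  | zero =>
    have : g = fun _ => g 0 := by ext x; rw [Subsingleton.elim x 0]
    rw [this]
    simp [evariance]
  | succ n ih =>
    set e := MeasurableEquiv.piFinSuccAbove (fun _ : Fin (n + 1) => E) 0 with he
    have hmp : MeasurePreserving e (Measure.pi fun _ => μ) (μ.prod (Measure.pi fun _ => μ)) :=
      measurePreserving_piFinSuccAbove (fun _ => μ) 0
    have hcons : ∀ z : E × (Fin n → E), e.symm z = (Fin.cons z.1 z.2 : Fin (n + 1) → E) := by
      intro z
      simp [he, MeasurableEquiv.piFinSuccAbove]
      rfl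
    set G : E × (Fin n → E) → ℝ := fun z => g (e.symm z) with hG
    have hgc : Continuous g := hg.continuous
    have hGm : Measurable G := hgc.measurable.comp e.symm.measurable
    have hLip : ∀ x0 : E, LipschitzWith 1 fun y : Fin n → E => (Fin.cons x0 y : Fin (n + 1) → E) := by
      intro x0
      refine LipschitzWith.of_dist_le_mul fun y y' => ?_
      simp only [NNReal.coe_one, one_mul]
      refine (dist_pi_le_iff dist_nonneg).2 fun i => ?_
      refine Fin.cases ?_ (fun i => ?_) i
      · simp
      · simpa using dist_le_pi_dist y y' i
    have hLip' : ∀ y : Fin n → E, LipschitzWith 1 fun x0 : E => (Fin.cons x0 y : Fin (n + 1) → E) := by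
      intro y
      refine LipschitzWith.of_dist_le_mul fun x0 x0' => ?_
      simp only [NNReal.coe_one, one_mul]
      refine (dist_pi_le_iff dist_nonneg).2 fun i => ?_
      refine Fin.cases ?_ (fun i => ?_) i
      · simp
      · simp
    have h1 : evariance g (Measure.pi fun _ => μ) = evariance G (μ.prod (Measure.pi fun _ => μ)) := by
      have hme : MeasurePreserving e.symm (μ.prod (Measure.pi fun _ => μ)) (Measure.pi fun _ => μ) :=
        hmp.symm e
      rw [evariance_eq_lintegral_ofReal, evariance_eq_lintegral_ofReal, hG,
        hme.integral_comp' g,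
        ← hme.lintegral_comp ((hgc.measurable.sub_const _).pow_const 2).ennreal_ofReal]
    have hae : ∀ᵐ z ∂(μ.prod (Measure.pi fun _ : Fin n => μ)), ∀ j,
        ‖fderiv ℝ (fun t => g (Function.update (e.symm z) j t)) (e.symm z j)‖ₑ ^ 2
          ≤ D j (e.symm z) :=
      (hmp.symm e).quasiMeasurePreserving.ae hgD
    have hint : ∀ j, ∫⁻ x, D j x ∂(Measure.pi fun _ => μ)
        = ∫⁻ z, D j (e.symm z) ∂(μ.prod (Measure.pi fun _ : Fin n => μ)) := fun j =>
      ((hmp.symm e).lintegral_comp (hD j)).symm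
    have hDm : ∀ j, Measurable fun z => D j (e.symm z) := fun j => (hD j).comp e.symm.measurable
    rw [h1, Fin.sum_univ_succ, mul_add]
    refine (evariance_prod_le hGm (fun z => hB _)).trans (add_le_add ?_ ?_)
    · rw [hint 0, lintegral_prod_symm _ (hDm 0).aemeasurable,
        ← lintegral_const_mul K (hDm 0).lintegral_prod_left']
      refine lintegral_mono_ae ?_
      have hsw : ∀ᵐ z ∂((Measure.pi fun _ : Fin n => μ).prod μ), ∀ j,
          ‖fderiv ℝ (fun t => g (Function.update (e.symm z.swap) j t)) (e.symm z.swap j)‖ₑ ^ 2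
            ≤ D j (e.symm z.swap) :=
        (Measure.measurePreserving_swap (μ := Measure.pi fun _ : Fin n => μ)
          (ν := μ)).quasiMeasurePreserving.ae hae
      filter_upwards [Measure.ae_ae_of_ae_prod hsw] with y hy
      have hl : LocallyLipschitz fun x0 => g (Fin.cons x0 y) :=
        hg.comp (hLip' y).locallyLipschitz
      simp only [hG, hcons]
      refine (hμ _ hl).trans ?_
      refine mul_le_mul' le_rfl (lintegral_mono_ae ?_)
      filter_upwards [hy] with x0 h0
      have h00 := h0 0
      simp only [Prod.swap_prod_mk, hcons, Fin.update_cons_zero, Fin.cons_zero] at h00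
      exact h00
    · rw [Finset.mul_sum]
      simp_rw [hint, lintegral_prod _ (hDm _).aemeasurable]
      have hms : ∀ j, Measurable fun x => ∫⁻ y, D j (e.symm (x, y)) ∂(Measure.pi fun _ : Fin n => μ) :=
        fun j => (hDm j).lintegral_prod_right'
      simp_rw [← lintegral_const_mul K (hms _)]
      rw [← lintegral_finsetSum _ fun j _ => (hms _).const_mul K]
      refine lintegral_mono_ae ?_
      filter_upwards [Measure.ae_ae_of_ae_prod hae] with x0 hx0
      rw [← Finset.mul_sum]
      simp only [hG, hcons]
      refine ih (fun y => g (Fin.cons x0 y)) (hg.comp (hLip x0).locallyLipschitz)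
        (fun y => hB _) (fun j y => D j.succ (Fin.cons x0 y)) (fun j => ?_) ?_
      · exact (hD _).comp (hLip x0).continuous.measurable
      · filter_upwards [hx0] with y hy j
        have hj := hy j.succ
        simp only [hcons, Fin.cons_succ, ← Fin.cons_update] at hj
        exact hj

end ProductPoincare

/-! ### Gradient and moment forms of the Poincaré inequality -/

section Rademacher

variable {E : Type*} [NormedAddCommGroup E] [NormedSpace ℝ E] [FiniteDimensional ℝ E]
  [MeasurableSpace E] [BorelSpace E]

/-- Rademacher's theorem for locally Lipschitz functions. -/
theorem _root_.LocallyLipschitz.ae_differentiableAt {g : E → ℝ} (hg : LocallyLipschitz g)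
    (μ : Measure E) [μ.IsAddHaarMeasure] : ∀ᵐ x ∂μ, DifferentiableAt ℝ g x := by
  choose K t ht hK using hg
  obtain ⟨s, hs, hsu⟩ := TopologicalSpace.countable_cover_nhds
    (fun x => interior_mem_nhds.2 (ht x))
  have : ∀ᵐ x ∂μ, ∀ y ∈ s, x ∈ t y → DifferentiableWithinAt ℝ g (t y) x := by
    rw [ae_ball_iff hs]
    exact fun y _ => (hK y).ae_differentiableWithinAt_of_mem
  filter_upwards [this] with x hx
  obtain ⟨y, hy, hxy⟩ := mem_iUnion₂.1 (hsu ▸ mem_univ x : x ∈ ⋃ y ∈ s, interior (t y))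
  exact (hx y hy (interior_subset hxy)).differentiableAt (mem_interior_iff_mem_nhds.1 hxy)

end Rademacher

section EuclideanNorm

variable {E : Type*} [NormedAddCommGroup E] {n : ℕ}

/-- The Euclidean norm on `E ^ n` (the type `Fin n → E` itself carries the supremum norm). -/
def l2 (h : Fin n → E) : ℝ := √(∑ j, ‖h j‖ ^ 2)

theorem l2_nonneg (h : Fin n → E) : 0 ≤ l2 h := Real.sqrt_nonneg _

theorem sq_l2 (h : Fin n → E) : l2 h ^ 2 = ∑ j, ‖h j‖ ^ 2 :=
  Real.sq_sqrt (Finset.sum_nonneg fun _ _ => sq_nonneg _)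

end EuclideanNorm

section Gradient

variable {E : Type*} [NormedAddCommGroup E] [InnerProductSpace ℝ E] [FiniteDimensional ℝ E] {n : ℕ}

/-- The squared norms of the partial derivatives add up to at most the square of the norm dual to
`l2`, tested on the sample whose entries represent the partial derivatives. -/
theorem sum_enorm_partial_sq_le (ℓ : (Fin n → E) →L[ℝ] ℝ) {G : ℝ}
    (hℓ : ∀ h, |ℓ h| ≤ G * l2 h) :
    ∑ j, ‖ℓ.comp (ContinuousLinearMap.single ℝ (fun _ : Fin n => E) j)‖ₑ ^ 2 ≤ ‖G‖ₑ ^ 2 := by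
  set v : Fin n → E := fun j => (InnerProductSpace.toDual ℝ E).symm
    (ℓ.comp (ContinuousLinearMap.single ℝ (fun _ : Fin n => E) j)) with hv
  have hnorm : ∀ j, ‖ℓ.comp (ContinuousLinearMap.single ℝ (fun _ : Fin n => E) j)‖ = ‖v j‖ :=
    fun j => by simp [hv]
  have h1 : ℓ v = ∑ j, ‖v j‖ ^ 2 := by
    have : v = ∑ j, Pi.single j (v j) := (Finset.univ_sum_single v).symm
    conv_lhs => rw [this]
    rw [map_sum]
    refine Finset.sum_congr rfl fun j _ => ?_
    have := InnerProductSpace.toDual_symm_apply (𝕜 := ℝ) (x := v j)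
      (y := ℓ.comp (ContinuousLinearMap.single ℝ (fun _ : Fin n => E) j))
    rw [← real_inner_self_eq_norm_sq]
    change _ = ⟪(InnerProductSpace.toDual ℝ E).symm
      (ℓ.comp (ContinuousLinearMap.single ℝ (fun _ : Fin n => E) j)), v j⟫
    rw [this]
    simp
  have h2 := hℓ v
  rw [h1, ← sq_l2, abs_of_nonneg (sq_nonneg _)] at h2
  have h3 : ∑ j, ‖v j‖ ^ 2 ≤ G ^ 2 := by
    rw [← sq_l2]
    have := l2_nonneg v
    rcases this.eq_or_lt with h | h
    · rw [← h]; simp; positivity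
    · have : l2 v ≤ G := by
        by_contra hc
        push Not at hc
        nlinarith
      exact pow_le_pow_left₀ h.le this 2
  have h4 : ∀ a : ℝ, ‖a‖ₑ ^ 2 = ENNReal.ofReal (a ^ 2) := fun a => by
    rw [← sq_abs, ENNReal.ofReal_pow (abs_nonneg a), ← Real.norm_eq_abs, ofReal_norm]
  calc _ = ∑ j, ENNReal.ofReal (‖v j‖ ^ 2) := by
        refine Finset.sum_congr rfl fun j _ => ?_
        rw [← hnorm, ENNReal.ofReal_pow (norm_nonneg _), ofReal_norm]
    _ = ENNReal.ofReal (∑ j, ‖v j‖ ^ 2) :=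
        (ENNReal.ofReal_sum_of_nonneg fun _ _ => sq_nonneg _).symm
    _ ≤ ENNReal.ofReal (G ^ 2) := ENNReal.ofReal_le_ofReal h3
    _ = _ := (h4 G).symm

end Gradient

section ProductPoincare

variable {E : Type*} [NormedAddCommGroup E] [InnerProductSpace ℝ E] [FiniteDimensional ℝ E]
  [MeasurableSpace E] [BorelSpace E] {n : ℕ}

/-- The Poincaré inequality on the product space, with the full gradient. -/
theorem Poincare.evariance_pi_le_of_slope {μ : Measure E} [IsProbabilityMeasure μ] {K : ℝ≥0∞}
    (hμ : Poincare μ K) (hac : (Measure.pi fun _ : Fin n => μ) ≪ Measure.pi fun _ => Measure.addHaar)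
    {g : (Fin n → E) → ℝ} (hg : LocallyLipschitz g) {B : ℝ} (hB : ∀ x, |g x| ≤ B)
    {G : (Fin n → E) → ℝ}
    (hG : ∀ᵐ x ∂(Measure.pi fun _ : Fin n => μ), ∀ h, |fderiv ℝ g x h| ≤ G x * l2 h) :
    evariance g (Measure.pi fun _ : Fin n => μ)
      ≤ K * ∫⁻ x, ‖G x‖ₑ ^ 2 ∂(Measure.pi fun _ : Fin n => μ) := by
  set D : Fin n → (Fin n → E) → ℝ≥0∞ := fun j x =>
    ‖(fderiv ℝ g x).comp (ContinuousLinearMap.single ℝ (fun _ : Fin n => E) j)‖ₑ ^ 2 with hDdef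
  have hD : ∀ j, Measurable (D j) := fun j => by
    have : Continuous fun ℓ : (Fin n → E) →L[ℝ] ℝ =>
        ‖ℓ.comp (ContinuousLinearMap.single ℝ (fun _ : Fin n => E) j)‖ₑ ^ 2 := by fun_prop
    exact this.measurable.comp (measurable_fderiv ℝ g)
  refine (hμ.evariance_pi_le n g hg hB D hD ?_).trans ?_
  · filter_upwards [hac.ae_le (hg.ae_differentiableAt (Measure.pi fun _ => Measure.addHaar))]
      with x hx j
    have h1 : HasFDerivAt g (fderiv ℝ g x) (Function.update x j (x j)) := by
      simpa using hx.hasFDerivAt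
    have := h1.comp (x j) (hasFDerivAt_update (𝕜 := ℝ) x (x j))
    have h2 := this.fderiv
    simp only [Function.comp_def] at h2
    rw [h2, hDdef]
    refine le_of_eq ?_
    congr 3
    ext t i
    by_cases hi : i = j
    · subst hi; simp
    · simp [hi]
  · rw [← lintegral_finsetSum _ fun j _ => hD j]
    refine mul_le_mul' le_rfl (lintegral_mono_ae ?_)
    filter_upwards [hG] with x hx
    exact sum_enorm_partial_sq_le _ hx

end ProductPoincare

section SignedPower

theorem hasDerivAt_mul_abs_rpow {q : ℝ} (hq : 0 < q) (s : ℝ) :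
    HasDerivAt (fun s : ℝ => s * |s| ^ q) ((q + 1) * |s| ^ q) s := by
  rcases lt_trichotomy s 0 with hs | rfl | hs
  · have h1 : HasDerivAt (fun s : ℝ => s * (-s) ^ q) (1 * (-s) ^ q + s * (-1 * q * (-s) ^ (q - 1))) s :=
      (hasDerivAt_id s).mul ((hasDerivAt_id s).neg.rpow_const (Or.inl (by simp; linarith)))
    have h2 : (fun s : ℝ => s * |s| ^ q) =ᶠ[nhds s] fun s : ℝ => s * (-s) ^ q := by
      filter_upwards [Iio_mem_nhds hs] with t ht
      rw [abs_of_neg ht]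
    refine (h1.congr_of_eventuallyEq h2).congr_deriv ?_
    have hs0 : s ≠ 0 := hs.ne
    rw [abs_of_neg hs, Real.rpow_sub_one (by linarith)]
    field_simp
    ring
  · rw [abs_zero, Real.zero_rpow hq.ne', mul_zero, hasDerivAt_iff_tendsto_slope]
    have h1 : Filter.Tendsto (fun t : ℝ => |t| ^ q) (nhds 0) (nhds 0) := by
      have : Continuous fun t : ℝ => |t| ^ q := continuous_abs.rpow_const fun _ => Or.inr hq.le
      simpa [Real.zero_rpow hq.ne'] using this.tendsto 0
    refine (h1.mono_left nhdsWithin_le_nhds).congr' ?_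
    filter_upwards [self_mem_nhdsWithin] with t ht
    have : t ≠ 0 := ht
    rw [slope_def_field]
    field_simp
    simp
  · have h1 : HasDerivAt (fun s : ℝ => s * s ^ q) (1 * s ^ q + s * (1 * q * s ^ (q - 1))) s :=
      (hasDerivAt_id s).mul ((hasDerivAt_id s).rpow_const (Or.inl hs.ne'))
    have h2 : (fun s : ℝ => s * |s| ^ q) =ᶠ[nhds s] fun s : ℝ => s * s ^ q := by
      filter_upwards [Ioi_mem_nhds hs] with t ht
      rw [abs_of_pos ht]
    refine (h1.congr_of_eventuallyEq h2).congr_deriv ?_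
    rw [abs_of_pos hs, Real.rpow_sub_one hs.ne']
    field_simp
    ring

theorem contDiff_mul_abs_rpow {q : ℝ} (hq : 0 < q) : ContDiff ℝ 1 fun s : ℝ => s * |s| ^ q := by
  rw [contDiff_one_iff_deriv]
  refine ⟨fun s => (hasDerivAt_mul_abs_rpow hq s).differentiableAt, ?_⟩
  have : deriv (fun s : ℝ => s * |s| ^ q) = fun s => (q + 1) * |s| ^ q :=
    funext fun s => (hasDerivAt_mul_abs_rpow hq s).deriv
  rw [this]
  exact continuous_const.mul (continuous_abs.rpow_const fun _ => Or.inr hq.le)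

end SignedPower

section Moments

variable {E : Type*} [NormedAddCommGroup E] [InnerProductSpace ℝ E] [FiniteDimensional ℝ E]
  [MeasurableSpace E] [BorelSpace E] {n : ℕ}

/-- A bounded random variable has a centre at which its signed power has mean zero. -/
theorem exists_integral_signed_rpow_eq_zero {Ω : Type*} [MeasurableSpace Ω] {P : Measure Ω}
    [IsProbabilityMeasure P] {g : Ω → ℝ} (hg : Measurable g) {B : ℝ} (hB : ∀ x, |g x| ≤ B)
    {q : ℝ} (hq : 0 < q) : ∃ a, |a| ≤ B ∧ ∫ x, (g x - a) * |g x - a| ^ q ∂P = 0 := by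
  have hB0 : 0 ≤ B := by
    obtain ⟨x⟩ := nonempty_of_isProbabilityMeasure P
    exact (abs_nonneg _).trans (hB x)
  have hψ : Continuous fun s : ℝ => s * |s| ^ q := (contDiff_mul_abs_rpow hq).continuous
  have hcont : ContinuousOn (fun a => ∫ x, (g x - a) * |g x - a| ^ q ∂P) (Icc (-B) B) := by
    refine continuousOn_of_dominated (bound := fun _ => (2 * B) * (2 * B) ^ q) (fun a _ => ?_)
      (fun a ha => ?_) (integrable_const _) ?_
    · exact (hψ.measurable.comp (hg.sub_const a)).aestronglyMeasurable
    · refine Filter.Eventually.of_forall fun x => ?_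
      have h1 : |g x - a| ≤ 2 * B := by
        have := hB x
        rw [abs_le] at this ⊢
        constructor <;> linarith [ha.1, ha.2]
      rw [norm_mul, Real.norm_eq_abs, Real.norm_eq_abs, abs_of_nonneg (Real.rpow_nonneg (abs_nonneg _) q)]
      gcongr
    · exact Filter.Eventually.of_forall fun x =>
        (hψ.comp (continuous_const.sub continuous_id)).continuousOn
  have h0 : (0 : ℝ) ∈ Icc (∫ x, (g x - B) * |g x - B| ^ q ∂P)
      (∫ x, (g x - -B) * |g x - -B| ^ q ∂P) := by
    constructor
    · refine integral_nonpos fun x => mul_nonpos_of_nonpos_of_nonneg ?_ (Real.rpow_nonneg (abs_nonneg _) q)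
      linarith [(abs_le.1 (hB x)).2]
    · refine integral_nonneg fun x => mul_nonneg ?_ (Real.rpow_nonneg (abs_nonneg _) q)
      linarith [(abs_le.1 (hB x)).1]
  obtain ⟨a, ha, h⟩ := intermediate_value_Icc' (by linarith) hcont h0
  exact ⟨a, abs_le.2 ha, h⟩

/-- Absorption of a power of the left-hand side, as in the proof that a Poincaré inequality bounds
moments: finiteness of `T` is what permits the division. -/
theorem rpow_le_of_le_mul_rpow {T A : ℝ≥0∞} (hT : T ≠ ∞) {s : ℝ} (hs : 0 < s) (hs1 : s < 1)
    (h : T ≤ A * T ^ (1 - s)) : T ^ s ≤ A := by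
  rcases eq_or_ne T 0 with rfl | h0
  · simp [hs]
  · have h1 : T ^ (1 - s) ≠ 0 := by simp [h0, hT]
    have h2 : T ^ (1 - s) ≠ ∞ := ENNReal.rpow_ne_top_of_nonneg (by linarith) hT
    have h3 : T = T ^ s * T ^ (1 - s) := by
      rw [← ENNReal.rpow_add _ _ h0 hT]; simp
    exact (ENNReal.mul_le_mul_iff_left h1 h2).1 (h3.symm.le.trans h)

/-- Moment form of the Poincaré inequality: the `L_p` norm of a centred function is at most
`p √K` times the `L_p` norm of its gradient. The function is centred at the point where the mean of
its signed power `p / 2` vanishes, so that the variance of that power is its second moment. -/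
theorem Poincare.eLpNorm_sub_integral_le {μ : Measure E} [IsProbabilityMeasure μ] {K : ℝ≥0∞}
    (hμ : Poincare μ K) (hac : (Measure.pi fun _ : Fin n => μ) ≪ Measure.pi fun _ => Measure.addHaar)
    {g : (Fin n → E) → ℝ} (hg : LocallyLipschitz g) {B : ℝ} (hB : ∀ x, |g x| ≤ B)
    {G : (Fin n → E) → ℝ} (hGm : Measurable G)
    (hG : ∀ᵐ x ∂(Measure.pi fun _ : Fin n => μ), ∀ h, |fderiv ℝ g x h| ≤ G x * l2 h)
    {p : ℝ} (hp : 2 < p) :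
    eLpNorm (fun x => g x - ∫ y, g y ∂(Measure.pi fun _ => μ)) (ENNReal.ofReal p)
        (Measure.pi fun _ => μ)
      ≤ ENNReal.ofReal p * K ^ (1 / 2 : ℝ)
        * eLpNorm G (ENNReal.ofReal p) (Measure.pi fun _ => μ) := by
  set P := Measure.pi fun _ : Fin n => μ with hP
  have hgm : Measurable g := hg.continuous.measurable
  obtain ⟨a, ha, ha0⟩ := exists_integral_signed_rpow_eq_zero (P := P) hgm hB
    (show 0 < p / 2 - 1 by linarith)
  have hp0 : ENNReal.ofReal p ≠ 0 := by simp; linarith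
  have hp1 : (1 : ℝ≥0∞) ≤ ENNReal.ofReal p := by
    rw [← ENNReal.ofReal_one]; exact ENNReal.ofReal_le_ofReal (by linarith)
  have hgaB : ∀ x, |g x - a| ≤ 2 * B := fun x => by
    have := hB x
    rw [abs_le] at this ha ⊢
    constructor <;> linarith
  have hgaL : ∀ q, MemLp (fun x => g x - a) q P := fun q =>
    memLp_of_abs_le (hgm.sub_const a) hgaB q
  -- the bound for the function centred at `a`
  have main : eLpNorm (fun x => g x - a) (ENNReal.ofReal p) P
      ≤ ENNReal.ofReal (p / 2) * K ^ (1 / 2 : ℝ) * eLpNorm G (ENNReal.ofReal p) P := by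
    set u : (Fin n → E) → ℝ≥0∞ := fun x => ‖g x - a‖ₑ with hu
    set v : (Fin n → E) → ℝ≥0∞ := fun x => ‖G x‖ₑ with hv
    have hum : Measurable u := (hgm.sub_const a).enorm
    have hvm : Measurable v := hGm.enorm
    set h : (Fin n → E) → ℝ := fun x => (g x - a) * |g x - a| ^ (p / 2 - 1) with hh
    have hq0 : 0 < p / 2 - 1 := by linarith
    have hga : LocallyLipschitz fun x => g x - a :=
      (LipschitzWith.id.sub (LipschitzWith.const a)).locallyLipschitz.comp hg
    have hhl : LocallyLipschitz h := (contDiff_mul_abs_rpow hq0).locallyLipschitz.comp hga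
    have hhB : ∀ x, |h x| ≤ (2 * B) * (2 * B) ^ (p / 2 - 1) := fun x => by
      rw [hh, abs_mul, abs_of_nonneg (Real.rpow_nonneg (abs_nonneg _) _)]
      have := hgaB x
      gcongr
      exact (abs_nonneg _).trans this
    have hvar := hμ.evariance_pi_le_of_slope hac hhl hhB
      (G := fun x => (p / 2 * |g x - a| ^ (p / 2 - 1)) * G x) (by
        filter_upwards [hG, hac.ae_le (hg.ae_differentiableAt (Measure.pi fun _ => Measure.addHaar))]
          with x hx hdx y
        have hd : HasFDerivAt h _ x := HasDerivAt.comp_hasFDerivAt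
          (h₂ := fun s : ℝ => s * |s| ^ (p / 2 - 1)) x
          (hasDerivAt_mul_abs_rpow hq0 (g x - a)) (hdx.hasFDerivAt.sub_const a)
        rw [hd.fderiv]
        simp only [smul_apply, smul_eq_mul, abs_mul]
        rw [mul_assoc, mul_assoc, sub_add_cancel, abs_of_pos (show 0 < p / 2 by linarith),
          abs_of_nonneg (Real.rpow_nonneg (abs_nonneg _) _), mul_assoc]
        have := hx y
        gcongr)
    have hpow : ∀ x, ‖|g x - a| ^ (p / 2 - 1)‖ₑ = u x ^ (p / 2 - 1) := fun x => by
      rw [Real.enorm_rpow_of_nonneg (abs_nonneg _) hq0.le, Real.enorm_abs]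
    have hvh : evariance h P = ∫⁻ x, u x ^ p ∂P := by
      rw [evariance, ha0]
      refine lintegral_congr fun x => ?_
      rw [sub_zero, hh, enorm_mul, hpow, ← ENNReal.rpow_natCast,
        ENNReal.mul_rpow_of_nonneg _ _ (by norm_num), ← ENNReal.rpow_mul,
        ← ENNReal.rpow_add_of_nonneg _ _ (by norm_num) (by push_cast; linarith)]
      congr 1
      push_cast
      ring
    set T := ∫⁻ x, u x ^ p ∂P with hT
    set A := ∫⁻ x, v x ^ p ∂P with hA
    have hTtop : T ≠ ∞ := by
      have := (hgaL (ENNReal.ofReal p)).eLpNorm_lt_top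
      rw [eLpNorm_lt_top_iff_lintegral_rpow_enorm_lt_top hp0 ENNReal.ofReal_ne_top,
        ENNReal.toReal_ofReal (by linarith)] at this
      exact this.ne
    have hholder : ∫⁻ x, u x ^ (p - 2) * v x ^ (2 : ℝ) ∂P ≤ T ^ (1 - 2 / p) * A ^ (2 / p) := by
      have hc : (p / (p - 2)).HolderConjugate (p / 2) := by
        rw [Real.holderConjugate_iff]
        constructor
        · rw [lt_div_iff₀ (by linarith)]; linarith
        · field_simp; ring
      have := ENNReal.lintegral_mul_le_Lp_mul_Lq P hc (f := fun x => u x ^ (p - 2))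
        (g := fun x => v x ^ (2 : ℝ)) (hum.pow_const _).aemeasurable (hvm.pow_const _).aemeasurable
      simp only [Pi.mul_apply, ← ENNReal.rpow_mul] at this
      refine this.trans (le_of_eq ?_)
      have e1 : (p - 2) * (p / (p - 2)) = p := by
        have : p - 2 ≠ 0 := by linarith
        field_simp
      have e2 : 2 * (p / 2) = p := by ring
      have e3 : 1 / (p / (p - 2)) = 1 - 2 / p := by
        have : p - 2 ≠ 0 := by linarith
        have : p ≠ 0 := by linarith
        field_simp
      have e4 : 1 / (p / 2) = 2 / p := by rw [one_div_div]
      rw [e1, e2, e3, e4]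
    have hTle : T ≤ (K * ENNReal.ofReal (p / 2) ^ 2 * A ^ (2 / p)) * T ^ (1 - 2 / p) := by
      rw [← hvh]
      refine hvar.trans ?_
      have : ∀ x, ‖(p / 2 * |g x - a| ^ (p / 2 - 1)) * G x‖ₑ ^ 2
          = ENNReal.ofReal (p / 2) ^ 2 * (u x ^ (p - 2) * v x ^ (2 : ℝ)) := fun x => by
        rw [enorm_mul, enorm_mul, hpow, mul_pow, mul_pow, mul_assoc,
          Real.enorm_of_nonneg (show 0 ≤ p / 2 by linarith), ← ENNReal.rpow_natCast (u x ^ _),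
          ← ENNReal.rpow_mul, ← ENNReal.rpow_natCast ‖G x‖ₑ]
        congr 3
        push_cast
        ring
      simp_rw [this]
      have hmm : Measurable fun x => u x ^ (p - 2) * v x ^ (2 : ℝ) :=
        (hum.pow_const _).mul (hvm.pow_const _)
      rw [lintegral_const_mul _ hmm, hvh, mul_assoc, mul_assoc, mul_comm (A ^ _)]
      exact mul_le_mul' le_rfl (mul_le_mul' le_rfl hholder)
    have h3 := rpow_le_of_le_mul_rpow hTtop (by positivity)
      (by rw [div_lt_one (by linarith)]; exact hp) hTle
    rw [eLpNorm_eq_lintegral_rpow_enorm_toReal hp0 ENNReal.ofReal_ne_top,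
      eLpNorm_eq_lintegral_rpow_enorm_toReal hp0 ENNReal.ofReal_ne_top,
      ENNReal.toReal_ofReal (by linarith)]
    have h4 := ENNReal.rpow_le_rpow h3 (show (0 : ℝ) ≤ 1 / 2 by norm_num)
    rw [← ENNReal.rpow_mul, ENNReal.mul_rpow_of_nonneg _ _ (by norm_num),
      ENNReal.mul_rpow_of_nonneg _ _ (by norm_num), ← ENNReal.rpow_mul, ← ENNReal.rpow_natCast,
      ← ENNReal.rpow_mul] at h4
    have e5 : 2 / p * (1 / 2) = 1 / p := by field_simp
    rw [e5] at h4
    norm_num at h4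
    calc T ^ (1 / p) ≤ _ := by simpa using h4
      _ = _ := by rw [mul_comm (ENNReal.ofReal (p / 2))]; simp [hA, hv]
  -- re-centring at the mean costs a factor two
  have hshift : |a - ∫ y, g y ∂P| = |∫ y, (g y - a) ∂P| := by
    rw [integral_sub ((memLp_of_abs_le hgm hB 1).integrable le_rfl) (integrable_const _)]
    simp [abs_sub_comm]
  have hmean : ENNReal.ofReal |a - ∫ y, g y ∂P| ≤ eLpNorm (fun x => g x - a) (ENNReal.ofReal p) P := by
    rw [hshift, ← Real.norm_eq_abs, ofReal_norm]
    refine (enorm_integral_le_lintegral_enorm _).trans ?_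
    rw [← eLpNorm_one_eq_lintegral_enorm]
    exact eLpNorm_le_eLpNorm_of_exponent_le hp1 (hgaL 0).aestronglyMeasurable
  have hsplit : (fun x => g x - ∫ y, g y ∂P) = (fun x => g x - a) + fun _ => (a - ∫ y, g y ∂P) := by
    ext x; simp
  calc eLpNorm (fun x => g x - ∫ y, g y ∂P) (ENNReal.ofReal p) P
      ≤ eLpNorm (fun x => g x - a) (ENNReal.ofReal p) P
        + eLpNorm (fun _ => (a - ∫ y, g y ∂P)) (ENNReal.ofReal p) P := by
        rw [hsplit]
        exact eLpNorm_add_le (hgaL 0).aestronglyMeasurable aestronglyMeasurable_const hp1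
    _ ≤ eLpNorm (fun x => g x - a) (ENNReal.ofReal p) P
        + eLpNorm (fun x => g x - a) (ENNReal.ofReal p) P := by
        gcongr
        rw [eLpNorm_const _ hp0 (IsProbabilityMeasure.ne_zero P)]
        simpa [← ofReal_norm] using hmean
    _ ≤ 2 * (ENNReal.ofReal (p / 2) * K ^ (1 / 2 : ℝ) * eLpNorm G (ENNReal.ofReal p) P) := by
        rw [two_mul]; gcongr
    _ = _ := by
        rw [← mul_assoc, ← mul_assoc]
        congr 2
        rw [show (2 : ℝ≥0∞) = ENNReal.ofReal 2 by simp, ← ENNReal.ofReal_mul (by norm_num)]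
        congr 1
        ring

end Moments

/-! ### The score, the Fisher information and the Poincaré constant -/

/-- The standing assumptions on the potential of a log-concave location family: `e^{-V}` is a
probability density, `V` is strictly convex and `C²`, its Hessian is bounded by `M` and
`L`-Lipschitz, and the Fisher information is at least `m`. -/
structure IsRegularPotential {d : ℕ} (V : EuclideanSpace ℝ (Fin d) → ℝ) (M L m : ℝ) : Prop where
  M_pos : 0 < M
  L_pos : 0 < L
  m_pos : 0 < m
  prob : IsProbabilityMeasure (law V 0)
  convex : StrictConvexOn ℝ univ V
  smooth : ContDiff ℝ 2 V
  hess_le : ∀ x, ‖hessian V x‖ ≤ M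
  hess_lip : ∀ x y, ‖hessian V x - hessian V y‖ ≤ L * ‖x - y‖
  fisher_ge : ∀ u, m * ‖u‖ ^ 2 ≤ ⟪fisher V u, u⟫

namespace IsRegularPotential

variable {d : ℕ} {V : EuclideanSpace ℝ (Fin d) → ℝ} {M L m : ℝ}

theorem contDiff_gradient (hV : IsRegularPotential V M L m) : ContDiff ℝ 1 (gradient V) := by
  have h1 : ContDiff ℝ 1 (fderiv ℝ V) := hV.smooth.fderiv_right (by norm_num)
  exact (InnerProductSpace.toDual ℝ (EuclideanSpace ℝ (Fin d))).symm.toContinuousLinearEquiv.contDiff.comp h1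

theorem hasFDerivAt_gradient (hV : IsRegularPotential V M L m) (x : EuclideanSpace ℝ (Fin d)) :
    HasFDerivAt (gradient V) (hessian V x) x :=
  (hV.contDiff_gradient.differentiable (by norm_num) x).hasFDerivAt

theorem continuous_gradient (hV : IsRegularPotential V M L m) : Continuous (gradient V) :=
  hV.contDiff_gradient.continuous

theorem continuous_hessian (hV : IsRegularPotential V M L m) : Continuous (hessian V) :=
  hV.contDiff_gradient.continuous_fderiv (by norm_num)

theorem differentiable (hV : IsRegularPotential V M L m) : Differentiable ℝ V :=
  hV.smooth.differentiable (by norm_num)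

theorem fderiv_apply_eq_inner (x u : EuclideanSpace ℝ (Fin d)) :
    fderiv ℝ V x u = ⟪gradient V x, u⟫ := by
  simp [gradient]

theorem norm_gradient_sub_le (hV : IsRegularPotential V M L m) (x y : EuclideanSpace ℝ (Fin d)) :
    ‖gradient V y - gradient V x‖ ≤ M * ‖y - x‖ :=
  convex_univ.norm_image_sub_le_of_norm_hasFDerivWithin_le
    (fun z _ => (hV.hasFDerivAt_gradient z).hasFDerivWithinAt) (fun z _ => hV.hess_le z)
    (mem_univ x) (mem_univ y)

theorem abs_sub_sub_inner_gradient_le (hV : IsRegularPotential V M L m)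
    (x u : EuclideanSpace ℝ (Fin d)) :
    |V (x + u) - V x - ⟪gradient V x, u⟫| ≤ M * ‖u‖ ^ 2 := by
  have h := (convex_closedBall x ‖u‖).norm_image_sub_le_of_norm_fderiv_le' (𝕜 := ℝ) (f := V)
    (C := M * ‖u‖) (x := x) (y := x + u) (φ := fderiv ℝ V x)
    (fun z _ => hV.differentiable z) (fun z hz => ?_) (by simp) (by simp)
  · rw [add_sub_cancel_left, fderiv_apply_eq_inner, Real.norm_eq_abs] at h
    linarith
  · have h1 : ‖fderiv ℝ V z - fderiv ℝ V x‖ = ‖gradient V z - gradient V x‖ := by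
      simp only [gradient, ← map_sub, LinearIsometryEquiv.norm_map]
    rw [h1]
    refine (hV.norm_gradient_sub_le x z).trans ?_
    have := hV.M_pos
    gcongr
    simpa [dist_eq_norm] using hz

theorem measurable_density (hV : IsRegularPotential V M L m) (θ : EuclideanSpace ℝ (Fin d)) :
    Measurable fun x => ENNReal.ofReal (Real.exp (-V (x - θ))) := by
  have := hV.smooth.continuous
  have h : Continuous fun x => Real.exp (-V (x - θ)) := by fun_prop
  exact h.measurable.ennreal_ofReal

theorem integral_law (hV : IsRegularPotential V M L m) {F : Type*} [NormedAddCommGroup F]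
    [NormedSpace ℝ F] (g : EuclideanSpace ℝ (Fin d) → F) :
    ∫ x, g x ∂(law V 0) = ∫ x, Real.exp (-V x) • g x := by
  rw [law, integral_withDensity_eq_integral_toReal_smul (hV.measurable_density 0)
    (Filter.Eventually.of_forall fun x => ENNReal.ofReal_lt_top)]
  simp [ENNReal.toReal_ofReal, Real.exp_nonneg]

theorem integrable_law (hV : IsRegularPotential V M L m) {F : Type*} [NormedAddCommGroup F]
    [NormedSpace ℝ F] (g : EuclideanSpace ℝ (Fin d) → F) :
    Integrable g (law V 0) ↔ Integrable fun x => Real.exp (-V x) • g x := by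
  rw [law, integrable_withDensity_iff_integrable_smul' (hV.measurable_density 0)
    (Filter.Eventually.of_forall fun x => ENNReal.ofReal_lt_top)]
  simp [ENNReal.toReal_ofReal, Real.exp_nonneg]

theorem lintegral_exp_neg (hV : IsRegularPotential V M L m) :
    ∫⁻ x, ENNReal.ofReal (Real.exp (-V x)) = 1 := by
  have := hV.prob.measure_univ
  rw [law, withDensity_apply _ MeasurableSet.univ] at this
  simpa using this

theorem lintegral_exp_inner_le (hV : IsRegularPotential V M L m) (u : EuclideanSpace ℝ (Fin d)) :
    ∫⁻ x, ENNReal.ofReal (Real.exp ⟪gradient V x, u⟫) ∂(law V 0)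
      ≤ ENNReal.ofReal (Real.exp (M * ‖u‖ ^ 2)) := by
  have hm : Measurable fun x => ENNReal.ofReal (Real.exp ⟪gradient V x, u⟫) := by
    have := hV.continuous_gradient
    have h : Continuous fun x => Real.exp ⟪gradient V x, u⟫ := by fun_prop
    exact h.measurable.ennreal_ofReal
  rw [law, lintegral_withDensity_eq_lintegral_mul _ (hV.measurable_density 0) hm]
  calc _ ≤ ∫⁻ x, ENNReal.ofReal (Real.exp (M * ‖u‖ ^ 2))
        * ENNReal.ofReal (Real.exp (-V (x - u))) := by
        refine lintegral_mono fun x => ?_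
        simp only [Pi.mul_apply, sub_zero]
        rw [← ENNReal.ofReal_mul (Real.exp_nonneg _), ← ENNReal.ofReal_mul (Real.exp_nonneg _),
          ← Real.exp_add, ← Real.exp_add]
        refine ENNReal.ofReal_le_ofReal (Real.exp_le_exp.2 ?_)
        have := (abs_le.1 (hV.abs_sub_sub_inner_gradient_le x (-u))).2
        rw [inner_neg_right, norm_neg, ← sub_eq_add_neg] at this
        linarith
    _ = _ := by
        rw [lintegral_const_mul _ (hV.measurable_density u),
          lintegral_sub_right_eq_self (fun x => ENNReal.ofReal (Real.exp (-V x))),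
          hV.lintegral_exp_neg, mul_one]

/-- The score is sub-Gaussian: shifting the density by `u` and bounding `V` by its second order
Taylor expansion controls the exponential moments of `⟪V', u⟫`. -/
theorem hasSubgaussianMGF_score (hV : IsRegularPotential V M L m)
    (u : EuclideanSpace ℝ (Fin d)) :
    HasSubgaussianMGF (fun x => ⟪gradient V x, u⟫) (Real.toNNReal (2 * M * ‖u‖ ^ 2))
      (law V 0) := by
  have hc : ∀ t : ℝ, Continuous fun x => Real.exp (t * ⟪gradient V x, u⟫) := fun t => by
    have := hV.continuous_gradient
    fun_prop
  have hle : ∀ t : ℝ, ∫⁻ x, ENNReal.ofReal (Real.exp (t * ⟪gradient V x, u⟫)) ∂(law V 0)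
      ≤ ENNReal.ofReal (Real.exp (M * (t ^ 2 * ‖u‖ ^ 2))) := fun t => by
    have := hV.lintegral_exp_inner_le (t • u)
    simpa [inner_smul_right, norm_smul, mul_pow] using this
  have hi : ∀ t : ℝ, Integrable (fun x => Real.exp (t * ⟪gradient V x, u⟫)) (law V 0) := fun t => by
    refine ⟨(hc t).aestronglyMeasurable, ?_⟩
    rw [hasFiniteIntegral_iff_ofReal (Filter.Eventually.of_forall fun x => Real.exp_nonneg _)]
    exact (hle t).trans_lt ENNReal.ofReal_lt_top
  refine ⟨hi, fun t => ?_⟩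
  have h := hle t
  rw [← ofReal_integral_eq_lintegral_ofReal (hi t)
    (Filter.Eventually.of_forall fun x => Real.exp_nonneg _),
    ENNReal.ofReal_le_ofReal_iff (Real.exp_nonneg _)] at h
  refine h.trans (Real.exp_le_exp.2 (le_of_eq ?_))
  have := hV.M_pos
  rw [Real.coe_toNNReal _ (by positivity)]
  ring

end IsRegularPotential

/-- Sub-Gaussian variables (in the sense of `HasSubgaussianMGF`) are centred. -/
theorem _root_.ProbabilityTheory.HasSubgaussianMGF.integral_eq_zero {Ω : Type*}
    [MeasurableSpace Ω] {P : Measure Ω} [IsProbabilityMeasure P] {X : Ω → ℝ} {c : NNReal}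
    (h : HasSubgaussianMGF X c P) : ∫ ω, X ω ∂P = 0 := by
  have h0 : (0 : ℝ) ∈ interior (integrableExpSet X P) := by simp [h.integrableExpSet_eq_univ]
  have hd1 : HasDerivAt (mgf X P) (∫ ω, X ω ∂P) 0 := by
    have := hasDerivAt_mgf h0
    simpa using this
  have hd2 : HasDerivAt (fun t : ℝ => Real.exp (c * t ^ 2 / 2)) 0 0 := by
    have := ((((hasDerivAt_id (0 : ℝ)).pow 2).const_mul (c : ℝ)).div_const 2).exp
    simpa using this
  have hmax : IsLocalMax (fun t => mgf X P t - Real.exp (c * t ^ 2 / 2)) 0 :=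
    Filter.Eventually.of_forall fun t => by
      have := h.mgf_le t
      simp
      linarith
  have := hmax.hasDerivAt_eq_zero (hd1.sub hd2)
  linarith

namespace IsRegularPotential

variable {d : ℕ} {V : EuclideanSpace ℝ (Fin d) → ℝ} {M L m : ℝ}

theorem integral_score (hV : IsRegularPotential V M L m) (u : EuclideanSpace ℝ (Fin d)) :
    ∫ x, ⟪gradient V x, u⟫ ∂(law V 0) = 0 := by
  have := hV.prob
  exact (hV.hasSubgaussianMGF_score u).integral_eq_zero

theorem memLp_score (hV : IsRegularPotential V M L m) (u : EuclideanSpace ℝ (Fin d)) :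
    MemLp (fun x => ⟪gradient V x, u⟫) 2 (law V 0) := by
  simpa using (hV.hasSubgaussianMGF_score u).memLp 2

theorem integrable_score_mul (hV : IsRegularPotential V M L m)
    (u v : EuclideanSpace ℝ (Fin d)) :
    Integrable (fun x => ⟪gradient V x, u⟫ * ⟪gradient V x, v⟫) (law V 0) :=
  (hV.memLp_score u).integrable_mul (hV.memLp_score v)

theorem inner_fisher (hV : IsRegularPotential V M L m) (u v : EuclideanSpace ℝ (Fin d)) :
    ⟪fisher V u, v⟫ = ∫ x, ⟪gradient V x, u⟫ * ⟪gradient V x, v⟫ ∂(law V 0) := by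
  have hc := hV.continuous_gradient
  have hi : Integrable (fun x => InnerProductSpace.rankOne ℝ (gradient V x) (gradient V x))
      (law V 0) := by
    have hsum : Integrable (fun x => ∑ i, ⟪gradient V x, EuclideanSpace.basisFun (Fin d) ℝ i⟫
        * ⟪gradient V x, EuclideanSpace.basisFun (Fin d) ℝ i⟫) (law V 0) :=
      integrable_finsetSum _ fun i _ => hV.integrable_score_mul _ _
    refine hsum.mono' ?_ (Filter.Eventually.of_forall fun x => le_of_eq ?_)
    · have : Continuous fun x => InnerProductSpace.rankOne ℝ (gradient V x) (gradient V x) :=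
        ((InnerProductSpace.rankOne ℝ).continuous.comp hc).clm_apply hc
      exact this.aestronglyMeasurable
    · rw [InnerProductSpace.norm_rankOne, ← sq,
        ← (EuclideanSpace.basisFun (Fin d) ℝ).sum_sq_norm_inner_left]
      simp [sq]
  rw [fisher, ContinuousLinearMap.integral_apply hi, real_inner_comm, ← integral_inner]
  · refine integral_congr_ae (Filter.Eventually.of_forall fun x => ?_)
    simp [InnerProductSpace.rankOne_apply, inner_smul_right]
  · exact hi.apply_continuousLinearMap u

theorem inner_fisher_comm (hV : IsRegularPotential V M L m) (u v : EuclideanSpace ℝ (Fin d)) :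
    ⟪fisher V u, v⟫ = ⟪u, fisher V v⟫ := by
  rw [real_inner_comm _ u, hV.inner_fisher, hV.inner_fisher]
  simp_rw [mul_comm]

theorem hasFDerivAt_inner_gradient (hV : IsRegularPotential V M L m)
    (x v : EuclideanSpace ℝ (Fin d)) :
    HasFDerivAt (fun x => ⟪gradient V x, v⟫) ((innerSL ℝ v).comp (hessian V x)) x := by
  have := (innerSL ℝ v).hasFDerivAt.comp x (hV.hasFDerivAt_gradient x)
  refine this.congr_of_eventuallyEq (Filter.Eventually.of_forall fun y => ?_)
  simp

theorem abs_inner_hessian_le (hV : IsRegularPotential V M L m)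
    (x u v : EuclideanSpace ℝ (Fin d)) : |⟪hessian V x u, v⟫| ≤ M * ‖u‖ * ‖v‖ :=
  (abs_real_inner_le_norm _ _).trans (by
    gcongr
    exact (hessian V x).le_of_opNorm_le (hV.hess_le x) u)

theorem continuous_inner_hessian (hV : IsRegularPotential V M L m)
    (u v : EuclideanSpace ℝ (Fin d)) : Continuous fun x => ⟪hessian V x u, v⟫ := by
  have := hV.continuous_hessian
  fun_prop

theorem integrable_inner_hessian (hV : IsRegularPotential V M L m)
    (u v : EuclideanSpace ℝ (Fin d)) : Integrable (fun x => ⟪hessian V x u, v⟫) (law V 0) := by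
  have := hV.prob
  exact Integrable.of_bound (hV.continuous_inner_hessian u v).aestronglyMeasurable _
    (Filter.Eventually.of_forall fun x => hV.abs_inner_hessian_le x u v)

/-- The Fisher information is the mean Hessian (integration by parts). -/
theorem integral_inner_hessian (hV : IsRegularPotential V M L m)
    (u v : EuclideanSpace ℝ (Fin d)) :
    ∫ x, ⟪hessian V x u, v⟫ ∂(law V 0) = ⟪fisher V u, v⟫ := by
  have := hV.prob
  have hfd : ∀ x, fderiv ℝ (fun x => ⟪gradient V x, v⟫) x u = ⟪hessian V x u, v⟫ := fun x => by
    rw [(hV.hasFDerivAt_inner_gradient x v).fderiv]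
    simp only [ContinuousLinearMap.comp_apply, innerSL_apply_apply]
    exact real_inner_comm _ _
  have hge : ∀ x, HasFDerivAt (fun x => Real.exp (-V x))
      (Real.exp (-V x) • -fderiv ℝ V x) x := fun x => (hV.differentiable x).hasFDerivAt.neg.exp
  have hgd : ∀ x, fderiv ℝ (fun x => Real.exp (-V x)) x u = - (Real.exp (-V x) * ⟪gradient V x, u⟫) :=
    fun x => by
      rw [(hge x).fderiv]
      simp
  have h := integral_mul_fderiv_eq_neg_fderiv_mul_of_integrable (μ := volume)
    (f := fun x => ⟪gradient V x, v⟫) (g := fun x => Real.exp (-V x)) (v := u) ?_ ?_ ?_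
    (fun x _ => (hV.hasFDerivAt_inner_gradient x v).differentiableAt)
    (fun x _ => (hge x).differentiableAt)
  · simp_rw [hfd, hgd] at h
    rw [hV.inner_fisher, hV.integral_law, hV.integral_law]
    simp only [smul_eq_mul]
    calc _ = ∫ x, ⟪hessian V x u, v⟫ * Real.exp (-V x) := by simp_rw [mul_comm]
      _ = - ∫ x, ⟪gradient V x, v⟫ * -(Real.exp (-V x) * ⟪gradient V x, u⟫) := by
        rw [h, neg_neg]
      _ = _ := by
        rw [← integral_neg]
        refine integral_congr_ae (Filter.Eventually.of_forall fun x => ?_)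
        simp only
        ring
  · simp_rw [hfd]
    have := (hV.integrable_law _).1 (hV.integrable_inner_hessian u v)
    simpa [mul_comm] using this
  · simp_rw [hgd]
    have := ((hV.integrable_law _).1 (hV.integrable_score_mul u v)).neg
    refine this.congr (Filter.Eventually.of_forall fun x => ?_)
    simp only [Pi.neg_apply, smul_eq_mul]
    ring
  · have := (hV.integrable_law _).1 ((hV.memLp_score v).integrable one_le_two)
    simpa [mul_comm] using this

theorem norm_fisher_ge (hV : IsRegularPotential V M L m) (u : EuclideanSpace ℝ (Fin d)) :
    m * ‖u‖ ≤ ‖fisher V u‖ := by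
  have h := (hV.fisher_ge u).trans (real_inner_le_norm _ _)
  rcases (norm_nonneg u).eq_or_lt with h0 | h0
  · rw [← h0]; simp
  · rw [sq, ← mul_assoc] at h
    exact le_of_mul_le_mul_right h h0

theorem fisher_inverse (hV : IsRegularPotential V M L m) (w : EuclideanSpace ℝ (Fin d)) :
    fisher V ((fisher V).inverse w) = w := by
  have hinj : Function.Injective (fisher V : EuclideanSpace ℝ (Fin d) →ₗ[ℝ] EuclideanSpace ℝ (Fin d)) := by
    rw [← LinearMap.ker_eq_bot, LinearMap.ker_eq_bot']
    intro u hu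
    have h := hV.norm_fisher_ge u
    have h0 : fisher V u = 0 := hu
    rw [h0, norm_zero] at h
    have := hV.m_pos
    have h1 : ‖u‖ ≤ 0 := by
      by_contra hc
      push Not at hc
      nlinarith [mul_pos this hc]
    exact norm_le_zero_iff.1 h1
  let e := (LinearEquiv.ofInjectiveEndo _ hinj).toContinuousLinearEquiv
  have he : fisher V = (e : EuclideanSpace ℝ (Fin d) →L[ℝ] EuclideanSpace ℝ (Fin d)) := by
    ext1 u
    rfl
  rw [he, ContinuousLinearMap.inverse_equiv]
  exact e.apply_symm_apply w

theorem norm_fisher_inverse_le (hV : IsRegularPotential V M L m) (w : EuclideanSpace ℝ (Fin d)) :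
    ‖(fisher V).inverse w‖ ≤ ‖w‖ / m := by
  have h := hV.norm_fisher_ge ((fisher V).inverse w)
  rw [hV.fisher_inverse] at h
  rw [le_div_iff₀ hV.m_pos]
  linarith

theorem exists_unit (hd : 1 ≤ d) : ∃ u : EuclideanSpace ℝ (Fin d), ‖u‖ = 1 :=
  ⟨EuclideanSpace.basisFun (Fin d) ℝ ⟨0, hd⟩, (EuclideanSpace.basisFun (Fin d) ℝ).norm_eq_one _⟩

theorem m_le_M (hV : IsRegularPotential V M L m) (hd : 1 ≤ d) : m ≤ M := by
  have := hV.prob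
  obtain ⟨u, hu⟩ := exists_unit hd
  have h := hV.fisher_ge u
  rw [← hV.integral_inner_hessian, hu] at h
  have h2 : ∫ x, ⟪hessian V x u, u⟫ ∂(law V 0) ≤ ∫ _, M ∂(law V 0) := by
    refine integral_mono (hV.integrable_inner_hessian u u) (integrable_const _) fun x => ?_
    have := (abs_le.1 (hV.abs_inner_hessian_le x u u)).2
    simpa [hu] using this
  simp at h h2
  linarith

/-- The Poincaré constant is bounded below: test the inequality on a component of the score. -/
theorem le_poincare (hV : IsRegularPotential V M L m) (hd : 1 ≤ d) {K : ℝ≥0∞}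
    (hK : Poincare (law V 0) K) : ENNReal.ofReal m ≤ K * ENNReal.ofReal (M ^ 2) := by
  have := hV.prob
  obtain ⟨u, hu⟩ := exists_unit hd
  have hcd : ContDiff ℝ 1 fun x => ⟪gradient V x, u⟫ := hV.contDiff_gradient.inner ℝ contDiff_const
  have h := hK _ hcd.locallyLipschitz
  rw [← ofReal_variance (hV.memLp_score u), variance_eq_sub (hV.memLp_score u),
    hV.integral_score] at h
  have h1 := hV.fisher_ge u
  rw [hV.inner_fisher, hu] at h1
  refine le_trans (ENNReal.ofReal_le_ofReal ?_) (h.trans (mul_le_mul' le_rfl ?_))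
  · simp only [Pi.pow_apply, sq] at h1 ⊢
    simpa using h1
  · calc _ ≤ ∫⁻ _, ENNReal.ofReal (M ^ 2) ∂(law V 0) := by
          refine lintegral_mono fun x => ?_
          rw [(hV.hasFDerivAt_inner_gradient x u).fderiv, ← ofReal_norm,
            ← ENNReal.ofReal_pow (norm_nonneg _)]
          refine ENNReal.ofReal_le_ofReal (pow_le_pow_left₀ (norm_nonneg _) ?_ 2)
          refine (ContinuousLinearMap.opNorm_comp_le _ _).trans ?_
          simpa [hu] using hV.hess_le x
      _ = _ := by simp

theorem le_poincareConst (hV : IsRegularPotential V M L m) (hd : 1 ≤ d) :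
    ENNReal.ofReal (m / M ^ 2) ≤ poincareConst (law V 0) := by
  refine le_sInf fun K hK => ?_
  have h := hV.le_poincare hd hK
  have hM := hV.M_pos
  rw [ENNReal.ofReal_div_of_pos (by positivity)]
  exact ENNReal.div_le_of_le_mul h

/-- The infimum defining the Poincaré constant is attained. -/
theorem poincare_poincareConst (hV : IsRegularPotential V M L m) (hd : 1 ≤ d)
    (h : poincareConst (law V 0) ≠ ∞) : Poincare (law V 0) (poincareConst (law V 0)) := by
  intro g hg
  set I := ∫⁻ x, ‖fderiv ℝ g x‖ₑ ^ 2 ∂(law V 0) with hI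
  rcases eq_or_ne I ∞ with hI1 | hI1
  · have h0 : poincareConst (law V 0) ≠ 0 := by
      have h1 := hV.le_poincareConst hd
      have hM := hV.M_pos
      have hm := hV.m_pos
      intro h2
      rw [h2, nonpos_iff_eq_zero, ENNReal.ofReal_eq_zero] at h1
      exact absurd h1 (not_le.2 (by positivity))
    rw [hI1, ENNReal.mul_top h0]
    exact le_top
  · rcases eq_or_ne I 0 with hI0 | hI0
    · obtain ⟨K, hK, -⟩ := sInf_lt_iff.1 (lt_top_iff_ne_top.2 h)
      have := hK g hg
      rw [← hI, hI0, mul_zero] at this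
      rw [hI0, mul_zero]
      exact this
    · rw [← ENNReal.div_le_iff hI0 hI1]
      refine le_sInf fun K hK => ?_
      rw [ENNReal.div_le_iff hI0 hI1]
      exact hK g hg

end IsRegularPotential

/-! ### Existence, uniqueness and continuity of the maximum likelihood estimator -/

section Coercivity

variable {E : Type*} [NormedAddCommGroup E] [NormedSpace ℝ E]
  [MeasurableSpace E] [BorelSpace E]

/-- A convex set of finite volume with an interior point is bounded: a segment of length `2 r N`
issuing from the centre of a ball of radius `r` forces `N` disjoint balls of radius `r / 2`
into the set. -/
theorem _root_.Convex.isBounded_of_measure_ne_top {μ : Measure E} [μ.IsAddHaarMeasure]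
    {S : Set E} (hS : Convex ℝ S) {r : ℝ} (hr : 0 < r)
    (hball : Metric.ball (0 : E) r ⊆ S) (hfin : μ S ≠ ∞) : Bornology.IsBounded S := by
  set v := μ (Metric.ball (0 : E) (r / 2)) with hv
  have hv0 : v ≠ 0 := (Metric.measure_ball_pos μ 0 (by positivity)).ne'
  obtain ⟨N, hN⟩ := ENNReal.exists_nat_mul_gt hv0 hfin
  refine isBounded_iff_forall_norm_le.2 ⟨2 * r * N, fun z hz => ?_⟩
  by_contra hcon
  push Not at hcon
  have hz0 : 0 < ‖z‖ := lt_of_le_of_lt (by positivity) hcon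
  set c : ℕ → E := fun i => (i * r / ‖z‖) • z with hc
  have hcdist : ∀ i j : ℕ, i ≠ j → r ≤ dist (c i) (c j) := fun i j hij => by
    rw [dist_eq_norm, hc, ← sub_smul, norm_smul, ← sub_div, ← sub_mul, norm_div, norm_mul, norm_norm,
      div_mul_cancel₀ _ hz0.ne', Real.norm_of_nonneg hr.le, Real.norm_eq_abs]
    have h1 : (1 : ℝ) ≤ |(i : ℝ) - j| := by
      have : (1 : ℤ) ≤ |(i : ℤ) - j| := Int.one_le_abs (sub_ne_zero.2 (by exact_mod_cast hij))
      exact_mod_cast this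
    nlinarith
  have hsub : ∀ i ∈ Finset.range N, Metric.ball (c i) (r / 2) ⊆ S := fun i hi y hy => by
    have hiN : (i : ℝ) < N := by exact_mod_cast Finset.mem_range.1 hi
    set t := i * r / ‖z‖ with ht
    have ht0 : 0 ≤ t := by positivity
    have ht1 : t ≤ 1 / 2 := by
      rw [ht, div_le_iff₀ hz0]
      nlinarith
    have hw : (1 - t)⁻¹ • (y - c i) ∈ S := by
      refine hball ?_
      rw [mem_ball_zero_iff, norm_smul, norm_inv, Real.norm_of_nonneg (by linarith),
        inv_mul_lt_iff₀ (by linarith), ← dist_eq_norm]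
      have : dist y (c i) < r / 2 := hy
      nlinarith
    have := hS hz hw ht0 (by linarith : 0 ≤ 1 - t) (by ring)
    rwa [smul_inv_smul₀ (by linarith), add_sub_cancel] at this
  have hdisj : (↑(Finset.range N) : Set ℕ).PairwiseDisjoint fun i => Metric.ball (c i) (r / 2) :=
    fun i _ j _ hij => Metric.ball_disjoint_ball (by linarith [hcdist i j hij])
  have hle : N * v ≤ μ S := by
    calc (N : ℝ≥0∞) * v = ∑ i ∈ Finset.range N, μ (Metric.ball (c i) (r / 2)) := by
          simp [Measure.addHaar_ball_center μ, hv]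
      _ = μ (⋃ i ∈ Finset.range N, Metric.ball (c i) (r / 2)) :=
          (measure_biUnion_finset hdisj fun _ _ => measurableSet_ball).symm
      _ ≤ μ S := measure_mono (iUnion₂_subset hsub)
  exact absurd hN (not_lt.2 hle)

end Coercivity

namespace IsRegularPotential

variable {d n : ℕ} {V : EuclideanSpace ℝ (Fin d) → ℝ} {M L m : ℝ}

theorem isBounded_le (hV : IsRegularPotential V M L m) (a : ℝ) :
    Bornology.IsBounded {x | V x ≤ a} := by
  have hc := hV.smooth.continuous
  set b := max a (V 0 + 1) with hb
  refine Bornology.IsBounded.subset (t := {x | V x ≤ b}) ?_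
    fun x (hx : V x ≤ a) => hx.trans (le_max_left _ _)
  have hnhds : {x | V x ≤ b} ∈ nhds (0 : EuclideanSpace ℝ (Fin d)) :=
    (hc.tendsto 0).eventually_le_const (lt_of_lt_of_le (by linarith) (le_max_right _ _))
  obtain ⟨r, hr, hball⟩ := Metric.mem_nhds_iff.1 hnhds
  refine Convex.isBounded_of_measure_ne_top (μ := volume) (r := r) ?_ hr hball ?_
  · have := hV.convex.convexOn.convex_le b
    simpa using this
  · have h1 := meas_ge_le_lintegral_div (μ := (volume : Measure (EuclideanSpace ℝ (Fin d))))
      (f := fun x => ENNReal.ofReal (Real.exp (-V x)))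
      (by simpa using (hV.measurable_density 0).aemeasurable)
      (ε := ENNReal.ofReal (Real.exp (-b)))
      (by simpa using Real.exp_pos _) ENNReal.ofReal_ne_top
    rw [hV.lintegral_exp_neg] at h1
    refine ((measure_mono fun x (hx : V x ≤ b) => ?_).trans_lt (h1.trans_lt ?_)).ne
    · exact ENNReal.ofReal_le_ofReal (Real.exp_le_exp.2 (by linarith))
    · refine ENNReal.div_lt_top ENNReal.one_ne_top ?_
      simpa using Real.exp_pos _

theorem continuous_empRisk (hV : IsRegularPotential V M L m) :
    Continuous fun p : (Fin n → EuclideanSpace ℝ (Fin d)) × EuclideanSpace ℝ (Fin d) =>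
      empRisk V p.1 p.2 := by
  have hc := hV.smooth.continuous
  unfold empRisk
  fun_prop

theorem strictConvexOn_empRisk (hV : IsRegularPotential V M L m) (hn : 1 ≤ n)
    (x : Fin n → EuclideanSpace ℝ (Fin d)) : StrictConvexOn ℝ univ (empRisk V x) := by
  refine ⟨convex_univ, fun s _ t _ hst a b ha hb hab => ?_⟩
  have hn0 : (0 : ℝ) < (n : ℝ)⁻¹ := by positivity
  simp only [empRisk, smul_eq_mul]
  have h : ∀ j, V (x j - (a • s + b • t)) < a * V (x j - s) + b * V (x j - t) := fun j => by
    have h1 := hV.convex.2 (mem_univ (x j - s)) (mem_univ (x j - t))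
      (by simpa using hst) ha hb hab
    have h2 : a • (x j - s) + b • (x j - t) = x j - (a • s + b • t) := by
      calc _ = (a + b) • x j - (a • s + b • t) := by module
        _ = _ := by rw [hab, one_smul]
    rwa [h2] at h1
  have hne : (Finset.univ : Finset (Fin n)).Nonempty := ⟨⟨0, hn⟩, Finset.mem_univ _⟩
  have hs := Finset.sum_lt_sum_of_nonempty hne fun j _ => h j
  rw [Finset.sum_add_distrib, ← Finset.mul_sum, ← Finset.mul_sum] at hs
  have := mul_lt_mul_of_pos_left hs hn0
  linarith

theorem exists_isMinOn_empRisk (hV : IsRegularPotential V M L m) (hn : 1 ≤ n)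
    (x : Fin n → EuclideanSpace ℝ (Fin d)) : ∃ t, IsMinOn (empRisk V x) univ t := by
  have hc : Continuous (empRisk V x) := hV.continuous_empRisk.comp (continuous_const.prodMk continuous_id)
  set a := empRisk V x 0 with ha
  have hb : Bornology.IsBounded {t | empRisk V x t ≤ a} := by
    refine Bornology.IsBounded.subset (t := ⋃ j, (fun t => x j - t) ⁻¹' {y | V y ≤ a}) ?_ ?_
    · refine Bornology.isBounded_iUnion.2 fun j => ?_
      obtain ⟨R, hR⟩ := isBounded_iff_forall_norm_le.1 (hV.isBounded_le a)
      refine isBounded_iff_forall_norm_le.2 ⟨R + ‖x j‖, fun t ht => ?_⟩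
      have h1 := hR _ ht
      have h2 := norm_sub_le (x j) (x j - t)
      rw [sub_sub_cancel] at h2
      linarith
    · intro t (ht : empRisk V x t ≤ a)
      by_contra hcon
      simp only [mem_iUnion, mem_preimage, mem_ofPred_eq, not_exists, not_le] at hcon
      have hne : (Finset.univ : Finset (Fin n)).Nonempty := ⟨⟨0, hn⟩, Finset.mem_univ _⟩
      have hs := Finset.sum_lt_sum_of_nonempty hne fun j _ => hcon j
      rw [Finset.sum_const, Finset.card_univ, Fintype.card_fin, nsmul_eq_mul] at hs
      have hn0 : (0 : ℝ) < n := by exact_mod_cast hn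
      unfold empRisk at ht
      rw [inv_mul_le_iff₀ hn0] at ht
      linarith
  obtain ⟨t, ht⟩ := hc.exists_forall_le_of_isBounded 0 hb
  exact ⟨t, fun y _ => ht y⟩

theorem isMinOn_mle (hV : IsRegularPotential V M L m) (hn : 1 ≤ n)
    (x : Fin n → EuclideanSpace ℝ (Fin d)) : IsMinOn (empRisk V x) univ (mle V x) :=
  Classical.epsilon_spec (hV.exists_isMinOn_empRisk hn x)

theorem eq_mle (hV : IsRegularPotential V M L m) (hn : 1 ≤ n)
    {x : Fin n → EuclideanSpace ℝ (Fin d)} {t : EuclideanSpace ℝ (Fin d)}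
    (ht : IsMinOn (empRisk V x) univ t) : t = mle V x :=
  (hV.strictConvexOn_empRisk hn x).eq_of_isMinOn ht (hV.isMinOn_mle hn x) (mem_univ _) (mem_univ _)

theorem mle_add_const (hV : IsRegularPotential V M L m) (hn : 1 ≤ n)
    (x : Fin n → EuclideanSpace ℝ (Fin d)) (θ : EuclideanSpace ℝ (Fin d)) :
    mle V (fun j => x j + θ) = mle V x + θ := by
  have h : ∀ s, empRisk V (fun j => x j + θ) s = empRisk V x (s - θ) := fun s => by
    simp only [empRisk]
    congr 2 with j
    congr 1
    abel
  refine (hV.eq_mle hn fun s _ => ?_).symm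
  simp only [mem_ofPred_eq, h, add_sub_cancel_right]
  exact hV.isMinOn_mle hn x (mem_univ _)

/-- If the empirical risk exceeds its value at `c` on the sphere of radius `ε` about `c`, then the
maximum likelihood estimator lies inside that sphere. -/
theorem norm_mle_sub_lt (hV : IsRegularPotential V M L m) (hn : 1 ≤ n)
    {x : Fin n → EuclideanSpace ℝ (Fin d)} {c : EuclideanSpace ℝ (Fin d)} {ε : ℝ} (hε : 0 < ε)
    (h : ∀ s ∈ Metric.sphere c ε, empRisk V x c < empRisk V x s) : ‖mle V x - c‖ < ε := by
  by_contra hcon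
  push Not at hcon
  set t := mle V x with ht
  have h0 : 0 < ‖t - c‖ := hε.trans_le hcon
  set s := c + (ε / ‖t - c‖) • (t - c) with hs
  have hs1 : s ∈ Metric.sphere c ε := by
    rw [mem_sphere_iff_norm, hs, add_sub_cancel_left, norm_smul, norm_div, norm_norm,
      div_mul_cancel₀ _ h0.ne', Real.norm_of_nonneg hε.le]
  have hs2 : s ∈ segment ℝ c t := by
    rw [segment_eq_image']
    exact ⟨ε / ‖t - c‖, ⟨by positivity, (div_le_one h0).2 hcon⟩, rfl⟩
  have h1 := (hV.strictConvexOn_empRisk hn x).convexOn.le_max_of_mem_segment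
    (mem_univ c) (mem_univ t) hs2
  have h2 : empRisk V x t ≤ empRisk V x c := hV.isMinOn_mle hn x (mem_univ c)
  rw [max_eq_left h2] at h1
  exact absurd (h s hs1) (not_lt.2 h1)

theorem continuous_mle (hV : IsRegularPotential V M L m) (hn : 1 ≤ n) :
    Continuous (mle V : (Fin n → EuclideanSpace ℝ (Fin d)) → _) := by
  refine Metric.continuous_iff'.2 fun x₀ ε hε => ?_
  set c := mle V x₀ with hc
  have key : ∀ᶠ x in nhds x₀, ∀ s ∈ Metric.sphere c ε, empRisk V x c < empRisk V x s := by
    refine (isCompact_sphere c ε).eventually_forall_of_forall_eventually fun s hs => ?_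
    have h1 : Continuous fun p : (Fin n → EuclideanSpace ℝ (Fin d)) × EuclideanSpace ℝ (Fin d) =>
        empRisk V p.1 c := hV.continuous_empRisk.comp (continuous_fst.prodMk continuous_const)
    refine (h1.tendsto (x₀, s)).eventually_lt (hV.continuous_empRisk.tendsto (x₀, s)) ?_
    refine lt_of_le_of_ne (hV.isMinOn_mle hn x₀ (mem_univ s)) fun heq => ?_
    have : s = c := hV.eq_mle hn fun y _ => by
      have := hV.isMinOn_mle hn x₀ (mem_univ y)
      simp only [mem_ofPred_eq] at this ⊢
      rw [← heq]; exact this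
    rw [this, mem_sphere_iff_norm, sub_self, norm_zero] at hs
    exact hε.ne hs
  filter_upwards [key] with x hx
  rw [dist_eq_norm]
  exact hV.norm_mle_sub_lt hn hε hx

end IsRegularPotential

/-! ### Nets and exponential moments of the empirical score and Hessian -/

section Net

/-- The unit ball of a `d`-dimensional space has a `1/2`-net with at most `5 ^ d` points, namely a
maximal `1/2`-separated set. -/
theorem exists_half_net (E : Type*) [NormedAddCommGroup E] [NormedSpace ℝ E]
    [FiniteDimensional ℝ E] : ∃ N : Finset E, N.card ≤ 5 ^ Module.finrank ℝ E ∧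
      (∀ y ∈ N, ‖y‖ ≤ 1) ∧ ∀ x : E, ‖x‖ ≤ 1 → ∃ y ∈ N, ‖x - y‖ ≤ 1 / 2 := by
  classical
  let Sep : Finset E → Prop := fun s =>
    (∀ y ∈ s, ‖y‖ ≤ 1) ∧ ∀ y ∈ s, ∀ z ∈ s, y ≠ z → 1 / 2 ≤ ‖y - z‖
  have hcard : ∀ s, Sep s → s.card ≤ 5 ^ Module.finrank ℝ E := fun s hs => by
    have h2 : Function.Injective fun y : E => (2 : ℝ) • y := smul_right_injective E two_ne_zero
    rw [← Finset.card_image_of_injective s h2]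
    refine Besicovitch.card_le_of_separated _ ?_ ?_
    · simp only [Finset.mem_image, forall_exists_index, and_imp, forall_apply_eq_imp_iff₂]
      intro y hy
      rw [norm_smul]
      have := hs.1 y hy
      norm_num
      linarith
    · simp only [Finset.mem_image, forall_exists_index, and_imp, forall_apply_eq_imp_iff₂]
      intro y hy z hz hne
      have := hs.2 y hy z hz fun h => hne (by rw [h])
      rw [← smul_sub, norm_smul]
      norm_num
      linarith
  obtain ⟨s, hs, hmax⟩ : ∃ s, Sep s ∧ ∀ s', Sep s' → s'.card ≤ s.card := by
    let k := Nat.findGreatest (fun k => ∃ s, Sep s ∧ s.card = k) (5 ^ Module.finrank ℝ E)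
    obtain ⟨s, hs, hk⟩ : ∃ s, Sep s ∧ s.card = k :=
      Nat.findGreatest_spec (P := fun k => ∃ s, Sep s ∧ s.card = k) (Nat.zero_le _)
        ⟨∅, by simp [Sep], rfl⟩
    exact ⟨s, hs, fun s' hs' => hk ▸ Nat.le_findGreatest (hcard s' hs') ⟨s', hs', rfl⟩⟩
  refine ⟨s, hcard s hs, hs.1, fun x hx => ?_⟩
  by_contra hcon
  push Not at hcon
  have hxs : x ∉ s := fun h => by
    have := hcon x h
    norm_num at this
  have hsep : Sep (insert x s) := by
    refine ⟨fun y hy => ?_, fun y hy z hz hne => ?_⟩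
    · rcases Finset.mem_insert.1 hy with rfl | hy
      · exact hx
      · exact hs.1 y hy
    · rcases Finset.mem_insert.1 hy with hy' | hy' <;> rcases Finset.mem_insert.1 hz with hz' | hz'
      · exact absurd (hy'.trans hz'.symm) hne
      · rw [hy']; exact (hcon z hz').le
      · rw [hz', norm_sub_rev]; exact (hcon y hy').le
      · exact hs.2 y hy' z hz' hne
  have := hmax _ hsep
  rw [Finset.card_insert_of_notMem hxs] at this
  omega

variable {E : Type*} [NormedAddCommGroup E] [InnerProductSpace ℝ E]

theorem exists_norm_le_two_mul_inner {N : Finset E}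
    (hN : ∀ x : E, ‖x‖ ≤ 1 → ∃ y ∈ N, ‖x - y‖ ≤ 1 / 2) (v : E) :
    ∃ y ∈ N, ‖v‖ ≤ 2 * ⟪v, y⟫ := by
  rcases eq_or_ne v 0 with rfl | hv
  · obtain ⟨y, hy, -⟩ := hN 0 (by simp)
    exact ⟨y, hy, by simp⟩
  · have hv0 : 0 < ‖v‖ := norm_pos_iff.2 hv
    obtain ⟨y, hy, hxy⟩ := hN (‖v‖⁻¹ • v) (by rw [norm_smul]; simp [hv0.ne'])
    refine ⟨y, hy, ?_⟩
    have h1 : ⟪v, ‖v‖⁻¹ • v⟫ = ‖v‖ := by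
      rw [inner_smul_right, real_inner_self_eq_norm_sq]
      field_simp
    have h2 := real_inner_le_norm v (‖v‖⁻¹ • v - y)
    rw [inner_sub_right, h1] at h2
    nlinarith

/-- A `1/2`-net loses a factor `2` in each of the two arguments of the bilinear form of `A`. -/
theorem exists_opNorm_le_four_mul_inner {N : Finset E}
    (hN : ∀ x : E, ‖x‖ ≤ 1 → ∃ y ∈ N, ‖x - y‖ ≤ 1 / 2) (A : E →L[ℝ] E) :
    ∃ u ∈ N, ∃ v ∈ N, ‖A‖ ≤ 4 * ⟪A u, v⟫ := by
  have hne : N.Nonempty := by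
    obtain ⟨y, hy, -⟩ := hN 0 (by simp)
    exact ⟨y, hy⟩
  obtain ⟨u, hu, hmax⟩ := N.exists_max_image (fun u => ‖A u‖) hne
  have h1 : ‖A‖ ≤ ‖A u‖ + ‖A‖ * (1 / 2) := by
    refine A.opNorm_le_of_unit_norm (by positivity) fun x hx => ?_
    obtain ⟨y, hy, hxy⟩ := hN x hx.le
    calc ‖A x‖ = ‖A y + A (x - y)‖ := by rw [← map_add, add_sub_cancel]
      _ ≤ ‖A y‖ + ‖A (x - y)‖ := norm_add_le _ _
      _ ≤ _ := by
        gcongr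
        · exact hmax y hy
        · exact (A.le_opNorm _).trans (by gcongr)
  obtain ⟨v, hv, h2⟩ := exists_norm_le_two_mul_inner hN (A u)
  exact ⟨u, hu, v, hv, by linarith⟩

end Net

section ExponentialMoments

variable {Ω : Type*} [MeasurableSpace Ω] {P : Measure Ω}

/-- The exponential moment bound `𝔼 e^{l T} ≤ A e^{s l²}` for all `l ≥ 0`. -/
def HasExpBound (T : Ω → ℝ) (A s : ℝ) (P : Measure Ω) : Prop :=
  ∀ l : ℝ, 0 ≤ l → ∫⁻ ω, ENNReal.ofReal (Real.exp (l * T ω)) ∂P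
    ≤ ENNReal.ofReal (A * Real.exp (s * l ^ 2))

/-- A variable dominated by the maximum of finitely many sub-Gaussian variables. -/
theorem hasExpBound_of_le_max {ι : Type*} {I : Finset ι} {X : ι → Ω → ℝ} {c : ι → NNReal} {c₀ : ℝ}
    (hX : ∀ i ∈ I, HasSubgaussianMGF (X i) (c i) P) (hc : ∀ i ∈ I, (c i : ℝ) ≤ c₀)
    {T : Ω → ℝ} {κ : ℝ} (hT : ∀ ω, ∃ i ∈ I, T ω ≤ κ * X i ω) {A : ℝ}
    (hA : (I.card : ℝ) ≤ A) : HasExpBound T A (c₀ * κ ^ 2 / 2) P := by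
  intro l hl
  have h1 : ∀ i ∈ I, ∫⁻ ω, ENNReal.ofReal (Real.exp ((l * κ) * X i ω)) ∂P
      ≤ ENNReal.ofReal (Real.exp (c₀ * κ ^ 2 / 2 * l ^ 2)) := fun i hi => by
    rw [← ofReal_integral_eq_lintegral_ofReal ((hX i hi).integrable_exp_mul _)
      (Filter.Eventually.of_forall fun ω => Real.exp_nonneg _)]
    refine ENNReal.ofReal_le_ofReal (((hX i hi).mgf_le (l * κ)).trans (Real.exp_le_exp.2 ?_))
    have := mul_le_mul_of_nonneg_right (hc i hi) (by positivity : 0 ≤ κ ^ 2 * l ^ 2 / 2)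
    linarith
  calc _ ≤ ∫⁻ ω, ∑ i ∈ I, ENNReal.ofReal (Real.exp ((l * κ) * X i ω)) ∂P := by
        refine lintegral_mono fun ω => ?_
        obtain ⟨i, hi, hTi⟩ := hT ω
        refine le_trans (ENNReal.ofReal_le_ofReal (Real.exp_le_exp.2 ?_))
          (Finset.single_le_sum (f := fun i => ENNReal.ofReal (Real.exp ((l * κ) * X i ω)))
            (fun _ _ => zero_le) hi)
        rw [mul_assoc]
        gcongr
    _ = ∑ i ∈ I, ∫⁻ ω, ENNReal.ofReal (Real.exp ((l * κ) * X i ω)) ∂P := by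
        refine lintegral_finsetSum' _ fun i hi => ?_
        exact ((hX i hi).aemeasurable.const_mul _).exp.ennreal_ofReal
    _ ≤ ∑ i ∈ I, ENNReal.ofReal (Real.exp (c₀ * κ ^ 2 / 2 * l ^ 2)) := Finset.sum_le_sum h1
    _ ≤ _ := by
        rw [Finset.sum_const, nsmul_eq_mul, ENNReal.ofReal_mul ((Nat.cast_nonneg _).trans hA)]
        gcongr
        rw [← ENNReal.ofReal_natCast]
        exact ENNReal.ofReal_le_ofReal hA

theorem HasExpBound.mono {T : Ω → ℝ} {A s A' s' : ℝ} (h : HasExpBound T A s P) (hA : A ≤ A')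
    (hA' : 0 ≤ A') (hs : s ≤ s') : HasExpBound T A' s' P := fun l hl =>
  (h l hl).trans (ENNReal.ofReal_le_ofReal (by gcongr))

theorem HasExpBound.measure_ge_le {T : Ω → ℝ} {A s : ℝ} (h : HasExpBound T A s P)
    (hT : Measurable T) (hs : 0 < s) {t : ℝ} (ht : 0 ≤ t) :
    P {ω | t ≤ T ω} ≤ ENNReal.ofReal (A * Real.exp (-(t ^ 2 / (4 * s)))) := by
  have hl : 0 ≤ t / (2 * s) := by positivity
  have hpos : 0 < Real.exp (t / (2 * s) * t) := Real.exp_pos _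
  have h1 := meas_ge_le_lintegral_div (μ := P)
    (f := fun ω => ENNReal.ofReal (Real.exp (t / (2 * s) * T ω)))
    (by fun_prop) (ε := ENNReal.ofReal (Real.exp (t / (2 * s) * t)))
    (by simpa using hpos) ENNReal.ofReal_ne_top
  refine (measure_mono fun ω (hω : t ≤ T ω) => ?_).trans (h1.trans ?_)
  · exact ENNReal.ofReal_le_ofReal (Real.exp_le_exp.2 (by gcongr))
  · refine (ENNReal.div_le_div_right (h _ hl) _).trans ?_
    rw [← ENNReal.ofReal_div_of_pos hpos]
    refine ENNReal.ofReal_le_ofReal (le_of_eq ?_)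
    rw [mul_div_assoc, ← Real.exp_sub]
    congr 2
    field_simp
    ring

/-- Moment bound from exponential moments. The exponent is first raised to `max p d`, where the
factor `25 ^ d` only costs a constant. -/
theorem HasExpBound.eLpNorm_le [IsProbabilityMeasure P] {T : Ω → ℝ} {d : ℕ} {s : ℝ}
    (h : HasExpBound T (25 ^ d) s P) (hT : Measurable T) (hT0 : ∀ ω, 0 ≤ T ω) (hs : 0 < s)
    (hd : 1 ≤ d) {p : ℝ} (hp : 1 ≤ p) :
    eLpNorm T (ENNReal.ofReal p) P ≤ ENNReal.ofReal (75 * √(s * (p * d))) := by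
  have hd1 : (1 : ℝ) ≤ d := by exact_mod_cast hd
  set q := p * d with hq
  have hpq : p ≤ q := by nlinarith
  have hdq : (d : ℝ) ≤ q := by nlinarith
  have hq0 : 0 < q := by linarith
  have hq1 : ENNReal.ofReal q ≠ 0 := by simpa using hq0
  set l := √(q / s) with hl
  have hl0 : 0 < l := by positivity
  have hl2 : s * l ^ 2 = q := by
    rw [hl, Real.sq_sqrt (by positivity)]; field_simp
  have hql : q / l = √(s * q) := by
    rw [div_eq_iff hl0.ne', hl, ← Real.sqrt_mul (by positivity)]
    rw [show s * q * (q / s) = q ^ 2 by field_simp, Real.sqrt_sq hq0.le]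
  calc eLpNorm T (ENNReal.ofReal p) P ≤ eLpNorm T (ENNReal.ofReal q) P :=
        eLpNorm_le_eLpNorm_of_exponent_le (ENNReal.ofReal_le_ofReal hpq) hT.aestronglyMeasurable
    _ ≤ eLpNorm (fun ω => (q / l) * Real.exp (l * T ω / q)) (ENNReal.ofReal q) P := by
        refine eLpNorm_mono_real fun ω => ?_
        rw [Real.norm_of_nonneg (hT0 ω)]
        have := Real.add_one_le_exp (l * T ω / q)
        calc T ω = (q / l) * (l * T ω / q) := by field_simp
          _ ≤ _ := by gcongr; linarith
    _ = ENNReal.ofReal (q / l) * (∫⁻ ω, ENNReal.ofReal (Real.exp (l * T ω)) ∂P) ^ (1 / q) := by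
        rw [show (fun ω => (q / l) * Real.exp (l * T ω / q))
          = (q / l) • fun ω => Real.exp (l * T ω / q) by ext; simp, eLpNorm_const_smul,
          eLpNorm_eq_lintegral_rpow_enorm_toReal hq1 ENNReal.ofReal_ne_top,
          ENNReal.toReal_ofReal hq0.le, Real.enorm_of_nonneg (by positivity)]
        congr 3
        ext ω
        rw [Real.enorm_of_nonneg (Real.exp_nonneg _), ENNReal.ofReal_rpow_of_pos (Real.exp_pos _),
          ← Real.exp_mul, div_mul_cancel₀ _ hq0.ne']
    _ ≤ ENNReal.ofReal (q / l) * (ENNReal.ofReal (25 ^ d * Real.exp (s * l ^ 2))) ^ (1 / q) := by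
        gcongr
        exact h l hl0.le
    _ ≤ ENNReal.ofReal (q / l) * ENNReal.ofReal 75 := by
        gcongr
        rw [hl2, ENNReal.ofReal_rpow_of_pos (by positivity)]
        refine ENNReal.ofReal_le_ofReal ?_
        rw [Real.mul_rpow (by positivity) (Real.exp_nonneg _), ← Real.exp_mul,
          ← Real.rpow_natCast, ← Real.rpow_mul (by norm_num), mul_one_div_cancel hq0.ne']
        have h1 : (25 : ℝ) ^ ((d : ℝ) * (1 / q)) ≤ 25 := by
          conv_rhs => rw [← Real.rpow_one 25]
          refine Real.rpow_le_rpow_of_exponent_le (by norm_num) ?_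
          rw [mul_one_div]
          exact (div_le_one hq0).2 hdq
        have h2 : Real.exp 1 ≤ 3 := Real.exp_one_lt_three.le
        calc _ ≤ (25 : ℝ) * 3 := by gcongr
          _ = 75 := by norm_num
    _ = _ := by
        rw [← ENNReal.ofReal_mul (by positivity), hql, mul_comm]

end ExponentialMoments

/-- The normalized score `n⁻¹ ∑ V'(x_j)` of a sample. -/
def empScore {d n : ℕ} (V : EuclideanSpace ℝ (Fin d) → ℝ)
    (x : Fin n → EuclideanSpace ℝ (Fin d)) : EuclideanSpace ℝ (Fin d) :=
  (n : ℝ)⁻¹ • ∑ j, gradient V (x j)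

/-- The deviation `n⁻¹ ∑ V''(x_j) - 𝓘` of the empirical Hessian from the Fisher information. -/
def hessianDev {d n : ℕ} (V : EuclideanSpace ℝ (Fin d) → ℝ)
    (x : Fin n → EuclideanSpace ℝ (Fin d)) :
    EuclideanSpace ℝ (Fin d) →L[ℝ] EuclideanSpace ℝ (Fin d) :=
  (n : ℝ)⁻¹ • ∑ j, hessian V (x j) - fisher V

namespace IsRegularPotential

variable {d n : ℕ} {V : EuclideanSpace ℝ (Fin d) → ℝ} {M L m : ℝ}

theorem isProbabilityMeasure_sampleLaw (hV : IsRegularPotential V M L m) :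
    IsProbabilityMeasure (sampleLaw V n 0) := by
  have := hV.prob
  unfold sampleLaw
  infer_instance

theorem continuous_empScore (hV : IsRegularPotential V M L m) :
    Continuous (empScore V : (Fin n → EuclideanSpace ℝ (Fin d)) → _) := by
  have := hV.continuous_gradient
  unfold empScore
  fun_prop

theorem continuous_hessianDev (hV : IsRegularPotential V M L m) :
    Continuous (hessianDev V : (Fin n → EuclideanSpace ℝ (Fin d)) → _) := by
  have := hV.continuous_hessian
  unfold hessianDev
  fun_prop

theorem hasSubgaussianMGF_sum (hV : IsRegularPotential V M L m)
    {Y : EuclideanSpace ℝ (Fin d) → ℝ} (hYm : Measurable Y) {c : NNReal}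
    (hY : HasSubgaussianMGF Y c (law V 0)) :
    HasSubgaussianMGF (fun x : Fin n → EuclideanSpace ℝ (Fin d) => ∑ j, Y (x j)) (n * c)
      (sampleLaw V n 0) := by
  have := hV.prob
  have hind : iIndepFun (fun j (x : Fin n → EuclideanSpace ℝ (Fin d)) => Y (x j))
      (sampleLaw V n 0) := iIndepFun_pi fun _ => hYm.aemeasurable
  have h := HasSubgaussianMGF.sum_of_iIndepFun hind (c := fun _ => c) (s := Finset.univ)
    fun j _ => by
      refine HasSubgaussianMGF.of_map (Y := fun x : Fin n → EuclideanSpace ℝ (Fin d) => x j) (X := Y)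
        (measurable_pi_apply j).aemeasurable ?_
      rw [sampleLaw, (measurePreserving_eval (fun _ => law V 0) j).map_eq]
      exact hY
  simpa using h

theorem hasSubgaussianMGF_inner_empScore (hV : IsRegularPotential V M L m)
    (u : EuclideanSpace ℝ (Fin d)) :
    HasSubgaussianMGF (fun x : Fin n → EuclideanSpace ℝ (Fin d) => ∑ j, ⟪gradient V (x j), u⟫)
      (n * Real.toNNReal (2 * M * ‖u‖ ^ 2)) (sampleLaw V n 0) := by
  have := hV.continuous_gradient
  have hc : Continuous fun x => ⟪gradient V x, u⟫ := by fun_prop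
  exact hV.hasSubgaussianMGF_sum hc.measurable (hV.hasSubgaussianMGF_score u)

theorem inner_empScore (x : Fin n → EuclideanSpace ℝ (Fin d)) (u : EuclideanSpace ℝ (Fin d)) :
    ⟪empScore V x, u⟫ = (n : ℝ)⁻¹ * ∑ j, ⟪gradient V (x j), u⟫ := by
  rw [empScore, real_inner_smul_left, sum_inner]

/-- A union bound over a `1/2`-net of the unit ball for the linear forms of the score. -/
theorem hasExpBound_empScore (hV : IsRegularPotential V M L m) (hn : 1 ≤ n) :
    HasExpBound (fun x : Fin n → EuclideanSpace ℝ (Fin d) => ‖empScore V x‖) (25 ^ d) (4 * M / n)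
      (sampleLaw V n 0) := by
  have hM := hV.M_pos
  have hn0 : (0 : ℝ) < n := by exact_mod_cast hn
  obtain ⟨N, hcard, hN1, hN⟩ := exists_half_net (EuclideanSpace ℝ (Fin d))
  have h := hasExpBound_of_le_max (I := N) (c₀ := 2 * M * n) (κ := 2 / n) (A := 25 ^ d)
    (T := fun x : Fin n → EuclideanSpace ℝ (Fin d) => ‖empScore V x‖)
    (fun u _ => hV.hasSubgaussianMGF_inner_empScore (n := n) u) ?_ ?_ ?_
  · refine h.mono le_rfl (by positivity) (le_of_eq ?_)
    field_simp
    ring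
  · intro u hu
    rw [NNReal.coe_mul, NNReal.coe_natCast, Real.coe_toNNReal _ (by positivity)]
    have : ‖u‖ ^ 2 ≤ 1 := pow_le_one₀ (norm_nonneg _) (hN1 u hu)
    have := mul_le_mul_of_nonneg_left this (by positivity : 0 ≤ 2 * M * n)
    linarith
  · intro x
    obtain ⟨y, hy, h⟩ := exists_norm_le_two_mul_inner hN (empScore V x)
    refine ⟨y, hy, h.trans (le_of_eq ?_)⟩
    rw [inner_empScore]
    ring
  · calc (N.card : ℝ) ≤ 5 ^ d := by
          have := hcard
          rw [finrank_euclideanSpace_fin] at this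
          exact_mod_cast this
      _ ≤ 25 ^ d := by gcongr; norm_num

/-- A union bound over pairs from a `1/2`-net; each bilinear form of the deviation is an average of
bounded centred variables, to which Hoeffding's lemma applies. -/
theorem hasExpBound_hessianDev (hV : IsRegularPotential V M L m) (hn : 1 ≤ n) :
    HasExpBound (fun x : Fin n → EuclideanSpace ℝ (Fin d) => ‖hessianDev V x‖) (25 ^ d)
      (8 * M ^ 2 / n) (sampleLaw V n 0) := by
  have hM := hV.M_pos
  have := hV.prob
  have hn0 : (0 : ℝ) < n := by exact_mod_cast hn
  obtain ⟨N, hcard, hN1, hN⟩ := exists_half_net (EuclideanSpace ℝ (Fin d))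
  have hsub : ∀ i ∈ N ×ˢ N, HasSubgaussianMGF
      (fun x : Fin n → EuclideanSpace ℝ (Fin d) =>
        ∑ j, (⟪hessian V (x j) i.1, i.2⟫ - ⟪fisher V i.1, i.2⟫))
      (n * (‖M - -M‖₊ / 2) ^ 2) (sampleLaw V n 0) := by
    intro i hi
    obtain ⟨h1, h2⟩ := Finset.mem_product.1 hi
    have hc := hV.continuous_inner_hessian i.1 i.2
    refine hV.hasSubgaussianMGF_sum (Y := fun x => ⟪hessian V x i.1, i.2⟫ - ⟪fisher V i.1, i.2⟫)
      (hc.sub continuous_const).measurable ?_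
    rw [← hV.integral_inner_hessian]
    refine hasSubgaussianMGF_of_mem_Icc hc.measurable.aemeasurable
      (Filter.Eventually.of_forall fun x => abs_le.1 ((hV.abs_inner_hessian_le x _ _).trans ?_))
    have := mul_le_one₀ (hN1 _ h1) (norm_nonneg _) (hN1 _ h2)
    rw [mul_assoc]
    nlinarith
  have h := hasExpBound_of_le_max (I := N ×ˢ N) (c₀ := M ^ 2 * n) (κ := 4 / n) (A := 25 ^ d)
    (T := fun x : Fin n → EuclideanSpace ℝ (Fin d) => ‖hessianDev V x‖) hsub ?_ ?_ ?_
  · refine h.mono le_rfl (by positivity) (le_of_eq ?_)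
    field_simp
    ring
  · intro i _
    simp only [sub_neg_eq_add, NNReal.coe_mul, NNReal.coe_natCast, NNReal.coe_pow, NNReal.coe_div,
      coe_nnnorm, NNReal.coe_ofNat]
    rw [Real.norm_of_nonneg (by positivity)]
    exact le_of_eq (by ring)
  · intro x
    obtain ⟨u, hu, v, hv, h⟩ := exists_opNorm_le_four_mul_inner hN (hessianDev V x)
    refine ⟨(u, v), Finset.mem_product.2 ⟨hu, hv⟩, h.trans (le_of_eq ?_)⟩
    simp only [hessianDev, sub_apply, smul_apply, sum_apply, inner_sub_left, real_inner_smul_left,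
      sum_inner, Finset.sum_sub_distrib, Finset.sum_const, Finset.card_univ, Fintype.card_fin,
      nsmul_eq_mul]
    field_simp
  · rw [Finset.card_product]
    rw [finrank_euclideanSpace_fin] at hcard
    have h5 : (N.card : ℝ) ≤ 5 ^ d := by exact_mod_cast hcard
    push_cast
    calc (N.card : ℝ) * N.card ≤ 5 ^ d * 5 ^ d := by gcongr
      _ = 25 ^ d := by rw [← mul_pow]; norm_num

end IsRegularPotential

/-! ### The likelihood equation on good samples -/

section EuclideanNorm

variable {E : Type*} [NormedAddCommGroup E] {n : ℕ}

theorem avg_norm_le (h : Fin n → E) : (n : ℝ)⁻¹ * ∑ j, ‖h j‖ ≤ l2 h / √n := by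
  rcases Nat.eq_zero_or_pos n with rfl | hn
  · simp
  have hn0 : (0 : ℝ) < n := by exact_mod_cast hn
  have h1 : (∑ j, ‖h j‖) ^ 2 ≤ n * ∑ j, ‖h j‖ ^ 2 := by
    simpa using sq_sum_le_card_mul_sum_sq (s := (Finset.univ : Finset (Fin n))) (f := fun j => ‖h j‖)
  have h2 : ∑ j, ‖h j‖ ≤ √n * l2 h := by
    rw [l2, ← Real.sqrt_mul hn0.le]
    exact Real.le_sqrt_of_sq_le h1
  rw [le_div_iff₀ (by positivity)]
  calc (n : ℝ)⁻¹ * (∑ j, ‖h j‖) * √n ≤ (n : ℝ)⁻¹ * (√n * l2 h) * √n := by gcongr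
    _ = (n : ℝ)⁻¹ * (√n * √n) * l2 h := by ring
    _ = l2 h := by rw [Real.mul_self_sqrt hn0.le, inv_mul_cancel₀ hn0.ne', one_mul]

theorem l2_div_sqrt_le (h : Fin n → E) : l2 h / √n ≤ ‖h‖ := by
  rcases Nat.eq_zero_or_pos n with rfl | hn
  · simp
  have hn0 : (0 : ℝ) < n := by exact_mod_cast hn
  rw [div_le_iff₀ (by positivity), l2]
  refine Real.sqrt_le_iff.2 ⟨by positivity, ?_⟩
  rw [mul_pow, Real.sq_sqrt hn0.le]
  calc ∑ j, ‖h j‖ ^ 2 ≤ ∑ _j : Fin n, ‖h‖ ^ 2 := by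
        gcongr with j
        exact norm_le_pi_norm h j
    _ = _ := by simp [mul_comm]

theorem l2_smul [NormedSpace ℝ E] {a : ℝ} (ha : 0 ≤ a) (h : Fin n → E) : l2 (a • h) = a * l2 h := by
  unfold l2
  simp only [Pi.smul_apply, norm_smul, mul_pow, ← Finset.mul_sum]
  rw [Real.sqrt_mul (sq_nonneg _), Real.norm_of_nonneg ha, Real.sqrt_sq ha]

/-- A local slope bound controls the derivative wherever it exists. -/
theorem abs_fderiv_le_of_slope [NormedSpace ℝ E] {g : (Fin n → E) → ℝ} {x : Fin n → E}
    (hg : DifferentiableAt ℝ g x) {ω : ℝ → ℝ} (hω : ContinuousAt ω 0)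
    (h : ∀ᶠ y in nhds x, |g y - g x| ≤ ω (l2 (y - x)) * l2 (y - x)) (v : Fin n → E) :
    |fderiv ℝ g x v| ≤ ω 0 * l2 v := by
  have h1 : Filter.Tendsto (fun t : ℝ => t⁻¹ • (g (x + t • v) - g x)) (nhdsWithin 0 (Ioi 0))
      (nhds (fderiv ℝ g x v)) :=
    (hg.hasFDerivAt.hasLineDerivAt v).tendsto_slope_zero_right
  have hx : Filter.Tendsto (fun t : ℝ => x + t • v) (nhdsWithin 0 (Ioi 0)) (nhds x) := by
    have : Continuous fun t : ℝ => x + t • v := by fun_prop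
    simpa using (this.tendsto 0).mono_left nhdsWithin_le_nhds
  have h2 : Filter.Tendsto (fun t : ℝ => ω (t * l2 v) * l2 v) (nhdsWithin 0 (Ioi 0))
      (nhds (ω 0 * l2 v)) := by
    have : Filter.Tendsto (fun t : ℝ => t * l2 v) (nhds 0) (nhds 0) := by
      have : Continuous fun t : ℝ => t * l2 v := by fun_prop
      simpa using this.tendsto 0
    exact ((hω.tendsto.comp this).mul_const _).mono_left nhdsWithin_le_nhds
  refine le_of_tendsto_of_tendsto h1.abs h2 ?_
  filter_upwards [hx.eventually h, self_mem_nhdsWithin] with t ht ht0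
  have ht0 : 0 < t := ht0
  rw [add_sub_cancel_left, l2_smul ht0.le] at ht
  rw [smul_eq_mul, abs_mul, abs_inv, abs_of_pos ht0, inv_mul_le_iff₀ ht0]
  linarith

end EuclideanNorm

namespace IsRegularPotential

variable {d n : ℕ} {V : EuclideanSpace ℝ (Fin d) → ℝ} {M L m : ℝ}

theorem norm_empScore_sub_le (hV : IsRegularPotential V M L m)
    (x y : Fin n → EuclideanSpace ℝ (Fin d)) :
    ‖empScore V y - empScore V x‖ ≤ M * (l2 (y - x) / √n) := by
  have hM := hV.M_pos
  rw [empScore, empScore, ← smul_sub, ← Finset.sum_sub_distrib, norm_smul,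
    Real.norm_of_nonneg (by positivity)]
  calc (n : ℝ)⁻¹ * ‖∑ j, (gradient V (y j) - gradient V (x j))‖
      ≤ (n : ℝ)⁻¹ * ∑ j, M * ‖(y - x) j‖ := by
        gcongr
        exact norm_sum_le_of_le _ fun j _ => hV.norm_gradient_sub_le _ _
    _ = M * ((n : ℝ)⁻¹ * ∑ j, ‖(y - x) j‖) := by rw [← Finset.mul_sum]; ring
    _ ≤ _ := by gcongr; exact avg_norm_le _

theorem norm_hessianDev_sub_le (hV : IsRegularPotential V M L m)
    (x y : Fin n → EuclideanSpace ℝ (Fin d)) :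
    ‖hessianDev V y - hessianDev V x‖ ≤ L * ((n : ℝ)⁻¹ * ∑ j, ‖y j - x j‖) := by
  have hL := hV.L_pos
  have e : hessianDev V y - hessianDev V x
      = (n : ℝ)⁻¹ • ∑ j, (hessian V (y j) - hessian V (x j)) := by
    rw [hessianDev, hessianDev, sub_sub_sub_cancel_right, Finset.sum_sub_distrib]
    exact (smul_sub (n : ℝ)⁻¹ _ _).symm
  rw [e, norm_smul, Real.norm_of_nonneg (by positivity)]
  calc (n : ℝ)⁻¹ * ‖∑ j, (hessian V (y j) - hessian V (x j))‖
      ≤ (n : ℝ)⁻¹ * ∑ j, L * ‖y j - x j‖ := by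
        gcongr
        exact norm_sum_le_of_le _ fun j _ => hV.hess_lip _ _
    _ = _ := by rw [← Finset.mul_sum]; ring

theorem norm_hessianDev_shift_le (hV : IsRegularPotential V M L m) (hn : 1 ≤ n)
    (x : Fin n → EuclideanSpace ℝ (Fin d)) (s : EuclideanSpace ℝ (Fin d)) :
    ‖hessianDev V (fun j => x j - s)‖ ≤ ‖hessianDev V x‖ + L * ‖s‖ := by
  have hn0 : (0 : ℝ) < n := by exact_mod_cast hn
  have h := hV.norm_hessianDev_sub_le x (fun j => x j - s)
  simp only [sub_sub_cancel_left, norm_neg, Finset.sum_const, Finset.card_univ, Fintype.card_fin,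
    nsmul_eq_mul, inv_mul_cancel_left₀ hn0.ne'] at h
  linarith [norm_le_norm_add_norm_sub' (hessianDev V fun j => x j - s) (hessianDev V x)]

theorem hasFDerivAt_empScore_shift (hV : IsRegularPotential V M L m)
    (x : Fin n → EuclideanSpace ℝ (Fin d)) (s : EuclideanSpace ℝ (Fin d)) :
    HasFDerivAt (fun s => empScore V fun j => x j - s)
      (-(hessianDev V (fun j => x j - s) + fisher V)) s := by
  have h : ∀ j, HasFDerivAt (fun s => gradient V (x j - s)) (-hessian V (x j - s)) s := fun j => by
    have := (hV.hasFDerivAt_gradient (x j - s)).comp s ((hasFDerivAt_id s).const_sub (x j))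
    refine this.congr_fderiv ?_
    ext1 v
    simp
  have := (HasFDerivAt.fun_sum (u := Finset.univ) fun j _ => h j).const_smul (n : ℝ)⁻¹
  refine this.congr_fderiv ?_
  rw [hessianDev, sub_add_cancel, Finset.sum_neg_distrib, smul_neg]

theorem hasFDerivAt_empRisk (hV : IsRegularPotential V M L m)
    (x : Fin n → EuclideanSpace ℝ (Fin d)) (s : EuclideanSpace ℝ (Fin d)) :
    HasFDerivAt (empRisk V x) (-innerSL ℝ (empScore V fun j => x j - s)) s := by
  have h : ∀ j, HasFDerivAt (fun s => V (x j - s)) (-innerSL ℝ (gradient V (x j - s))) s := fun j => by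
    have := (hV.differentiable (x j - s)).hasFDerivAt.comp s ((hasFDerivAt_id s).const_sub (x j))
    refine this.congr_fderiv ?_
    ext1 v
    simp
  have := (HasFDerivAt.fun_sum (u := Finset.univ) fun j _ => h j).const_mul (n : ℝ)⁻¹
  refine this.congr_fderiv ?_
  rw [empScore, Finset.sum_neg_distrib, smul_neg, map_smul, map_sum]

/-- The likelihood equation. -/
theorem empScore_mle (hV : IsRegularPotential V M L m) (hn : 1 ≤ n)
    (x : Fin n → EuclideanSpace ℝ (Fin d)) : empScore V (fun j => x j - mle V x) = 0 := by
  have hmin : IsLocalMin (empRisk V x) (mle V x) := (hV.isMinOn_mle hn x).isLocalMin Filter.univ_mem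
  have h := hmin.hasFDerivAt_eq_zero (hV.hasFDerivAt_empRisk x (mle V x))
  have h1 := congrArg (fun ℓ => ℓ (empScore V fun j => x j - mle V x)) h
  simpa using h1

/-- Strong monotonicity of the score near the origin when the empirical Hessian is close to the
Fisher information. -/
theorem le_inner_empScore_sub (hV : IsRegularPotential V M L m) (hn : 1 ≤ n)
    {x : Fin n → EuclideanSpace ℝ (Fin d)} (hx : ‖hessianDev V x‖ ≤ m / 4)
    {s t : EuclideanSpace ℝ (Fin d)} (hs : ‖s‖ ≤ m / (4 * L)) (ht : ‖t‖ ≤ m / (4 * L)) :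
    m / 2 * ‖t - s‖ ^ 2
      ≤ ⟪empScore V (fun j => x j - s) - empScore V (fun j => x j - t), t - s⟫ := by
  have hL := hV.L_pos
  have h := (convex_closedBall (0 : EuclideanSpace ℝ (Fin d))
    (m / (4 * L))).norm_image_sub_le_of_norm_hasFDerivWithin_le' (𝕜 := ℝ)
    (f := fun s => empScore V fun j => x j - s) (C := m / 2) (φ := -fisher V) (x := s) (y := t)
    (fun z _ => (hV.hasFDerivAt_empScore_shift x z).hasFDerivWithinAt) (fun z hz => ?_)
    (by simpa using hs) (by simpa using ht)
  · set v := t - s with hv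
    set D := empScore V (fun j => x j - t) - empScore V (fun j => x j - s) with hD
    have h1 := real_inner_le_norm (D - (-fisher V) v) v
    have h2 := hV.fisher_ge v
    rw [neg_apply, sub_neg_eq_add] at h h1
    rw [inner_add_left] at h1
    have h3 : ⟪empScore V (fun j => x j - s) - empScore V (fun j => x j - t), v⟫ = -⟪D, v⟫ := by
      rw [hD, ← inner_neg_left, neg_sub]
    rw [h3]
    have h4 : ‖D + fisher V v‖ * ‖v‖ ≤ m / 2 * ‖v‖ * ‖v‖ := by gcongr
    nlinarith
  · have hz' : ‖z‖ ≤ m / (4 * L) := by simpa using hz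
    have e : -(hessianDev V (fun j => x j - z) + fisher V) - -fisher V
        = -hessianDev V (fun j => x j - z) := by abel
    rw [e, norm_neg]
    have h1 := hV.norm_hessianDev_shift_le hn x z
    have h2 : L * ‖z‖ ≤ m / 4 := by
      calc L * ‖z‖ ≤ L * (m / (4 * L)) := by gcongr
        _ = m / 4 := by field_simp
    linarith

/-- The samples for which the empirical Hessian is close to the Fisher information and the score
is small; the maximum likelihood estimator is well behaved on them. -/
def IsGood (V : EuclideanSpace ℝ (Fin d) → ℝ) (L m : ℝ)
    (x : Fin n → EuclideanSpace ℝ (Fin d)) : Prop :=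
  ‖hessianDev V x‖ ≤ m / 4 ∧ ‖empScore V x‖ < m ^ 2 / (16 * L)

theorem norm_mle_lt (hV : IsRegularPotential V M L m) (hn : 1 ≤ n)
    {x : Fin n → EuclideanSpace ℝ (Fin d)} (hx : IsGood V L m x) : ‖mle V x‖ < m / (4 * L) := by
  have hL := hV.L_pos
  have hm := hV.m_pos
  set δ := m / (4 * L) with hδ
  have hδ0 : 0 < δ := by positivity
  rw [← sub_zero (mle V x)]
  refine hV.norm_mle_sub_lt hn hδ0 fun s hs => ?_
  have hs1 : ‖s‖ = δ := by simpa using hs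
  -- derivative of the risk along the segment from `0` to `s`
  have hd : ∀ τ : ℝ, HasDerivAt (fun τ : ℝ => empRisk V x (τ • s))
      (-⟪empScore V (fun j => x j - τ • s), s⟫) τ := fun τ => by
    have h1 : HasDerivAt (fun τ : ℝ => τ • s) s τ := by simpa using (hasDerivAt_id τ).smul_const s
    have := (hV.hasFDerivAt_empRisk x (τ • s)).comp_hasDerivAt τ h1
    refine this.congr_deriv ?_
    simp
  have hq : ∀ τ : ℝ, HasDerivAt (fun τ : ℝ => m / 4 * δ ^ 2 * τ ^ 2 - ‖empScore V x‖ * δ * τ)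
      (m / 2 * δ ^ 2 * τ - ‖empScore V x‖ * δ) τ := fun τ => by
    have := (((hasDerivAt_id τ).pow 2).const_mul (m / 4 * δ ^ 2)).sub
      ((hasDerivAt_id τ).const_mul (‖empScore V x‖ * δ))
    refine this.congr_deriv ?_
    simp
    ring
  have hmono := monotoneOn_of_deriv_nonneg (convex_Icc (0 : ℝ) 1)
    (f := fun τ => empRisk V x (τ • s) - (m / 4 * δ ^ 2 * τ ^ 2 - ‖empScore V x‖ * δ * τ))
    (fun τ _ => ((hd τ).sub (hq τ)).continuousAt.continuousWithinAt)
    (fun τ _ => ((hd τ).sub (hq τ)).differentiableAt.differentiableWithinAt) (fun τ hτ => by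
      rw [interior_Icc] at hτ
      have h0 : (fun j => x j - (0 : EuclideanSpace ℝ (Fin d))) = x := by simp
      have hτs : ‖τ • s‖ ≤ δ := by
        rw [norm_smul, hs1, Real.norm_of_nonneg hτ.1.le]
        nlinarith [hτ.2]
      have h1 := hV.le_inner_empScore_sub hn hx.1 (s := 0) (t := τ • s) (by simpa using hδ0.le) hτs
      rw [h0, sub_zero, norm_smul, hs1, Real.norm_of_nonneg hτ.1.le, inner_smul_right,
        inner_sub_left, mul_pow] at h1
      have h2 := real_inner_le_norm (empScore V x) s
      rw [hs1] at h2
      have h3 : m / 2 * (τ * δ ^ 2)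
          ≤ ⟪empScore V x, s⟫ - ⟪empScore V (fun j => x j - τ • s), s⟫ := by
        have : τ * (m / 2 * (τ * δ ^ 2))
            ≤ τ * (⟪empScore V x, s⟫ - ⟪empScore V (fun j => x j - τ • s), s⟫) := by
          linarith
        exact le_of_mul_le_mul_left this hτ.1
      rw [((hd τ).fun_sub (hq τ)).deriv]
      linarith)
  have h01 := hmono (left_mem_Icc.2 zero_le_one) (right_mem_Icc.2 zero_le_one) zero_le_one
  simp only [zero_smul, one_smul] at h01
  have h4 : ‖empScore V x‖ * δ < m / 4 * δ ^ 2 := by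
    have : m / 4 * δ = m ^ 2 / (16 * L) := by rw [hδ]; field_simp; norm_num
    rw [sq, ← mul_assoc, this]
    exact mul_lt_mul_of_pos_right hx.2 hδ0
  linarith

/-- Strong convexity of the empirical risk between `0` and `θ̂`, where the empirical score
vanishes. -/
theorem norm_mle_le (hV : IsRegularPotential V M L m) (hn : 1 ≤ n)
    {x : Fin n → EuclideanSpace ℝ (Fin d)} (hx : IsGood V L m x) :
    ‖mle V x‖ ≤ 2 / m * ‖empScore V x‖ := by
  have hL := hV.L_pos
  have hm := hV.m_pos
  have h := hV.le_inner_empScore_sub hn hx.1 (s := 0) (t := mle V x) (by simp; positivity)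
    (hV.norm_mle_lt hn hx).le
  rw [hV.empScore_mle hn, sub_zero, sub_zero] at h
  simp only [sub_zero] at h
  have h2 := h.trans (real_inner_le_norm _ _)
  rcases (norm_nonneg (mle V x)).eq_or_lt with h0 | h0
  · rw [← h0]; positivity
  · rw [sq, ← mul_assoc] at h2
    have h3 := le_of_mul_le_mul_right h2 h0
    rw [div_mul_eq_mul_div, le_div_iff₀ hm]
    linarith

/-- Strong convexity for the sample `y` between the two estimators: its empirical score at the
estimator of `x` is a difference of scores of `y` and `x`, hence small. -/
theorem norm_mle_sub_le (hV : IsRegularPotential V M L m) (hn : 1 ≤ n)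
    {x y : Fin n → EuclideanSpace ℝ (Fin d)} (hx : IsGood V L m x) (hy : IsGood V L m y) :
    ‖mle V y - mle V x‖ ≤ 2 * M / m * (l2 (y - x) / √n) := by
  have hm := hV.m_pos
  have hM := hV.M_pos
  have h := hV.le_inner_empScore_sub hn hy.1 (hV.norm_mle_lt hn hx).le (hV.norm_mle_lt hn hy).le
  have hS := hV.norm_empScore_sub_le (fun j => x j - mle V x) (fun j => y j - mle V x)
  rw [hV.empScore_mle hn, sub_zero] at h hS
  have e : ((fun j => y j - mle V x) - fun j => x j - mle V x) = y - x := by ext1 j; simp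
  rw [e] at hS
  have h2 := h.trans (real_inner_le_norm _ _)
  rcases (norm_nonneg (mle V y - mle V x)).eq_or_lt with h0 | h0
  · rw [← h0]; have := l2_nonneg (y - x); positivity
  · rw [sq, ← mul_assoc] at h2
    have h3 := (le_of_mul_le_mul_right h2 h0).trans hS
    rw [div_mul_eq_mul_div, le_div_iff₀ hm]
    linarith

/-- Linearization of the likelihood equation: to first order, the increments of `𝓘 θ̂` and of the
score agree up to the closeness of the sample to the ideal situation. -/
theorem norm_fisher_mle_sub_sub_le (hV : IsRegularPotential V M L m) (hn : 1 ≤ n)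
    (x y : Fin n → EuclideanSpace ℝ (Fin d)) :
    ‖fisher V (mle V y - mle V x) - (empScore V y - empScore V x)‖
      ≤ L * (‖mle V x‖ + ‖mle V y - mle V x‖) * (l2 (y - x) / √n)
        + (‖hessianDev V x‖ + L * (l2 (y - x) / √n) + L * (‖mle V x‖ + ‖mle V y - mle V x‖))
          * ‖mle V y - mle V x‖ := by
  have hL := hV.L_pos
  set a := l2 (y - x) / √n with ha
  set Δ := mle V y - mle V x with hΔ
  have ha0 : 0 ≤ a := by have := l2_nonneg (y - x); positivity
  let z : ℝ → Fin n → EuclideanSpace ℝ (Fin d) := fun τ => x + τ • (y - x)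
  let s : ℝ → EuclideanSpace ℝ (Fin d) := fun τ => mle V x + τ • Δ
  let zs : ℝ → Fin n → EuclideanSpace ℝ (Fin d) := fun τ j => z τ j - s τ
  let ψ : ℝ → EuclideanSpace ℝ (Fin d) := fun τ =>
    empScore V (zs τ) - empScore V (z τ) + fisher V (s τ)
  let ψ' : ℝ → EuclideanSpace ℝ (Fin d) := fun τ =>
    (n : ℝ)⁻¹ • ∑ j, hessian V (zs τ j) ((y - x) j - Δ)
      - (n : ℝ)⁻¹ • ∑ j, hessian V (z τ j) ((y - x) j) + fisher V Δ
  have hz : ∀ τ j, HasDerivAt (fun τ => z τ j) ((y - x) j) τ := fun τ j => by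
    simpa [z] using ((hasDerivAt_id τ).smul_const ((y - x) j)).const_add (x j)
  have hs : ∀ τ, HasDerivAt s Δ τ := fun τ => by
    simpa [s] using ((hasDerivAt_id τ).smul_const Δ).const_add (mle V x)
  have hψ : ∀ τ, HasDerivAt ψ (ψ' τ) τ := fun τ => by
    have h1 : ∀ j, HasDerivAt (fun τ => gradient V (zs τ j)) (hessian V (zs τ j) ((y - x) j - Δ)) τ :=
      fun j => (hV.hasFDerivAt_gradient _).comp_hasDerivAt τ ((hz τ j).sub (hs τ))
    have h2 : ∀ j, HasDerivAt (fun τ => gradient V (z τ j)) (hessian V (z τ j) ((y - x) j)) τ :=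
      fun j => (hV.hasFDerivAt_gradient _).comp_hasDerivAt τ (hz τ j)
    have h3 : HasDerivAt (fun τ => fisher V (s τ)) (fisher V Δ) τ :=
      (fisher V).hasFDerivAt.comp_hasDerivAt τ (hs τ)
    exact (((HasDerivAt.fun_sum (u := Finset.univ) fun j _ => h1 j).const_smul (n : ℝ)⁻¹).sub
      ((HasDerivAt.fun_sum (u := Finset.univ) fun j _ => h2 j).const_smul (n : ℝ)⁻¹)).add h3
  have hbound : ∀ τ ∈ Ico (0 : ℝ) 1, ‖ψ' τ‖ ≤ L * (‖mle V x‖ + ‖Δ‖) * a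
      + (‖hessianDev V x‖ + L * a + L * (‖mle V x‖ + ‖Δ‖)) * ‖Δ‖ := fun τ hτ => by
    have hsn : ‖s τ‖ ≤ ‖mle V x‖ + ‖Δ‖ := by
      refine (norm_add_le _ _).trans ?_
      gcongr
      rw [norm_smul, Real.norm_of_nonneg hτ.1]
      exact mul_le_of_le_one_left (norm_nonneg _) hτ.2.le
    have e : ψ' τ = (n : ℝ)⁻¹ • ∑ j, (hessian V (zs τ j) - hessian V (z τ j)) ((y - x) j)
        - hessianDev V (zs τ) Δ := by
      simp only [ψ', hessianDev, map_sub, sub_apply, smul_apply, sum_apply, Finset.sum_sub_distrib,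
        smul_sub]
      abel
    have b1 : ‖(n : ℝ)⁻¹ • ∑ j, (hessian V (zs τ j) - hessian V (z τ j)) ((y - x) j)‖
        ≤ L * (‖mle V x‖ + ‖Δ‖) * a := by
      rw [norm_smul, Real.norm_of_nonneg (by positivity)]
      calc _ ≤ (n : ℝ)⁻¹ * ∑ j, L * (‖mle V x‖ + ‖Δ‖) * ‖(y - x) j‖ := by
            gcongr
            refine norm_sum_le_of_le _ fun j _ => ContinuousLinearMap.le_of_opNorm_le _ ?_ _
            refine (hV.hess_lip _ _).trans ?_
            gcongr
            simpa [zs] using hsn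
        _ = L * (‖mle V x‖ + ‖Δ‖) * ((n : ℝ)⁻¹ * ∑ j, ‖(y - x) j‖) := by
            rw [← Finset.mul_sum]; ring
        _ ≤ _ := by gcongr; exact avg_norm_le _
    have b2 : ‖hessianDev V (zs τ)‖ ≤ ‖hessianDev V x‖ + L * a + L * (‖mle V x‖ + ‖Δ‖) := by
      have c1 := hV.norm_hessianDev_shift_le hn (z τ) (s τ)
      have c2 : ‖hessianDev V (z τ) - hessianDev V x‖ ≤ L * a := by
        refine (hV.norm_hessianDev_sub_le x (z τ)).trans ?_
        gcongr
        refine le_trans ?_ (avg_norm_le (y - x))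
        gcongr with j
        simp only [z, Pi.add_apply, Pi.smul_apply, add_sub_cancel_left, norm_smul,
          Real.norm_of_nonneg hτ.1]
        exact mul_le_of_le_one_left (norm_nonneg _) hτ.2.le
      have c3 := norm_le_norm_add_norm_sub' (hessianDev V (z τ)) (hessianDev V x)
      have c4 : L * ‖s τ‖ ≤ L * (‖mle V x‖ + ‖Δ‖) := by gcongr
      linarith
    rw [e]
    refine (norm_sub_le _ _).trans (add_le_add b1 ?_)
    exact ContinuousLinearMap.le_of_opNorm_le _ b2 _
  have hmv := norm_image_sub_le_of_norm_deriv_le_segment_01'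
    (fun τ _ => (hψ τ).hasDerivWithinAt) hbound
  have e1 : ψ 1 - ψ 0 = fisher V Δ - (empScore V y - empScore V x) := by
    have z1 : z 1 = y := by simp [z]
    have z0 : z 0 = x := by simp [z]
    have s1 : s 1 = mle V y := by simp [s, hΔ]
    have s0 : s 0 = mle V x := by simp [s]
    have zs1 : zs 1 = fun j => y j - mle V y := by ext1 j; simp [zs, z1, s1]
    have zs0 : zs 0 = fun j => x j - mle V x := by ext1 j; simp [zs, z0, s0]
    simp only [ψ, z1, z0, s1, s0, zs1, zs0, hV.empScore_mle hn, hΔ, map_sub]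
    abel
  rwa [e1] at hmv

end IsRegularPotential

/-! ### The truncated remainder and its gradient -/

/-- `f` is differentiable, `f` and `f'` are bounded by `N`, and `f'` is `ρ`-Hölder with
constant `N`. -/
structure HolderBound {d : ℕ} (f : EuclideanSpace ℝ (Fin d) → ℝ) (N ρ : ℝ) : Prop where
  differentiable : Differentiable ℝ f
  abs_le : ∀ x, |f x| ≤ N
  norm_fderiv_le : ∀ x, ‖fderiv ℝ f x‖ ≤ N
  norm_fderiv_sub_le : ∀ x y, ‖fderiv ℝ f x - fderiv ℝ f y‖ ≤ N * ‖x - y‖ ^ ρ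

namespace HolderBound

variable {d : ℕ} {f : EuclideanSpace ℝ (Fin d) → ℝ} {N ρ : ℝ}

theorem nonneg (hf : HolderBound f N ρ) : 0 ≤ N := (abs_nonneg _).trans (hf.abs_le 0)

theorem norm_gradient_le (hf : HolderBound f N ρ) (x : EuclideanSpace ℝ (Fin d)) :
    ‖gradient f x‖ ≤ N := by
  simpa [gradient] using hf.norm_fderiv_le x

theorem abs_sub_le (hf : HolderBound f N ρ) (s t : EuclideanSpace ℝ (Fin d)) :
    |f t - f s| ≤ N * ‖t - s‖ :=
  convex_univ.norm_image_sub_le_of_norm_fderiv_le (𝕜 := ℝ) (fun z _ => hf.differentiable z)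
    (fun z _ => hf.norm_fderiv_le z) (mem_univ s) (mem_univ t)

theorem abs_sub_sub_inner_le (hf : HolderBound f N ρ) (hρ : 0 < ρ)
    (s t : EuclideanSpace ℝ (Fin d)) :
    |f t - f s - ⟪gradient f 0, t - s⟫| ≤ N * (‖s‖ + ‖t - s‖) ^ ρ * ‖t - s‖ := by
  have hN := hf.nonneg
  have h := (convex_closedBall (0 : EuclideanSpace ℝ (Fin d))
    (‖s‖ + ‖t - s‖)).norm_image_sub_le_of_norm_fderiv_le' (𝕜 := ℝ) (f := f)
    (C := N * (‖s‖ + ‖t - s‖) ^ ρ) (x := s) (y := t) (φ := fderiv ℝ f 0)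
    (fun z _ => hf.differentiable z) (fun z hz => ?_) (by simp) ?_
  · simpa using h
  · refine (hf.norm_fderiv_sub_le z 0).trans ?_
    have : ‖z‖ ≤ ‖s‖ + ‖t - s‖ := by simpa using hz
    rw [sub_zero]
    gcongr
  · simpa using norm_le_norm_add_norm_sub' t s

end HolderBound

/-- The cutoff statistic, which is at most one on samples that are close to the ideal
situation. Samples where it is below three are good. -/
def cutoffStat {d n : ℕ} (V : EuclideanSpace ℝ (Fin d) → ℝ) (L m : ℝ)
    (x : Fin n → EuclideanSpace ℝ (Fin d)) : ℝ :=
  max (‖empScore V x‖ / (m ^ 2 / (48 * L))) (‖hessianDev V x‖ / (m / 12))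

/-- The cutoff function: one where the statistic is at most one, zero where it is at least two. -/
def cutoff {d n : ℕ} (V : EuclideanSpace ℝ (Fin d) → ℝ) (L m : ℝ)
    (x : Fin n → EuclideanSpace ℝ (Fin d)) : ℝ :=
  max 0 (min 1 (2 - cutoffStat V L m x))

/-- The remainder of the linearization of `f(θ̂)` at the parameter `0`. -/
def linRemainder {d n : ℕ} (V f : EuclideanSpace ℝ (Fin d) → ℝ)
    (x : Fin n → EuclideanSpace ℝ (Fin d)) : ℝ :=
  f (mle V x) - f 0 - ⟪empScore V x, (fisher V).inverse (gradient f 0)⟫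

/-- A Lipschitz constant (per `n^{-1/2}`) of the cutoff statistic. -/
def cutoffLip (M L m : ℝ) : ℝ := M / (m ^ 2 / (48 * L)) + L / (m / 12)

/-- A bound (per unit Hölder norm) of the remainder on good samples. -/
def remBound (L m : ℝ) : ℝ := 2 + m ^ 2 / (16 * L) / m

/-- The constant in the gradient bound for the truncated remainder. -/
def slopeConst (M L m : ℝ) : ℝ :=
  2 * M / m * (1 + 2 / m) + 1 / m * (L + 2 * M / m * L) * (2 / m) + 1 / m * (2 * M / m)
    + remBound L m * cutoffLip M L m * (1 / (m ^ 2 / (48 * L)) + 1 / (m / 12))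

namespace IsRegularPotential

variable {d n : ℕ} {V f : EuclideanSpace ℝ (Fin d) → ℝ} {M L m N ρ : ℝ}

theorem continuous_cutoffStat (hV : IsRegularPotential V M L m) :
    Continuous (cutoffStat V L m : (Fin n → EuclideanSpace ℝ (Fin d)) → ℝ) := by
  have h1 := hV.continuous_empScore (n := n)
  have h2 := hV.continuous_hessianDev (n := n)
  unfold cutoffStat
  fun_prop

theorem cutoff_nonneg (x : Fin n → EuclideanSpace ℝ (Fin d)) : 0 ≤ cutoff V L m x :=
  le_max_left _ _

theorem cutoff_le_one (x : Fin n → EuclideanSpace ℝ (Fin d)) : cutoff V L m x ≤ 1 :=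
  max_le zero_le_one (min_le_left _ _)

theorem cutoff_eq_one {x : Fin n → EuclideanSpace ℝ (Fin d)} (h : cutoffStat V L m x ≤ 1) :
    cutoff V L m x = 1 := by
  rw [cutoff, min_eq_left (by linarith), max_eq_right zero_le_one]

theorem cutoff_eq_zero {x : Fin n → EuclideanSpace ℝ (Fin d)} (h : 2 ≤ cutoffStat V L m x) :
    cutoff V L m x = 0 :=
  max_eq_left ((min_le_right _ _).trans (by linarith))

theorem abs_cutoff_sub_le (x y : Fin n → EuclideanSpace ℝ (Fin d)) :
    |cutoff V L m y - cutoff V L m x| ≤ |cutoffStat V L m y - cutoffStat V L m x| := by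
  unfold cutoff
  refine (abs_max_sub_max_le_max _ _ _ _).trans ?_
  rw [sub_self, abs_zero, max_eq_right (abs_nonneg _)]
  refine (abs_min_sub_min_le_max _ _ _ _).trans ?_
  rw [sub_self, abs_zero, max_eq_right (abs_nonneg _)]
  rw [sub_sub_sub_cancel_left, abs_sub_comm]

theorem cutoffLip_nonneg (hV : IsRegularPotential V M L m) : 0 ≤ cutoffLip M L m := by
  have := hV.M_pos; have := hV.L_pos; have := hV.m_pos
  unfold cutoffLip; positivity

theorem remBound_nonneg (hV : IsRegularPotential V M L m) : 0 ≤ remBound L m := by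
  have := hV.L_pos; have := hV.m_pos
  unfold remBound; positivity

theorem slopeConst_pos (hV : IsRegularPotential V M L m) : 0 < slopeConst M L m := by
  have := hV.M_pos; have := hV.L_pos; have := hV.m_pos
  have := hV.cutoffLip_nonneg; have := hV.remBound_nonneg
  unfold slopeConst; positivity

theorem abs_cutoffStat_sub_le (hV : IsRegularPotential V M L m)
    (x y : Fin n → EuclideanSpace ℝ (Fin d)) :
    |cutoffStat V L m y - cutoffStat V L m x| ≤ cutoffLip M L m * (l2 (y - x) / √n) := by
  have hM := hV.M_pos
  have hL := hV.L_pos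
  have hm := hV.m_pos
  have hr : 0 < m ^ 2 / (48 * L) := by positivity
  have hη : 0 < m / 12 := by positivity
  have ha : 0 ≤ l2 (y - x) / √n := by have := l2_nonneg (y - x); positivity
  unfold cutoffStat
  refine (abs_max_sub_max_le_max _ _ _ _).trans (max_le ?_ ?_)
  · rw [← sub_div, abs_div, abs_of_pos hr, div_le_iff₀ hr, cutoffLip]
    have h1 := (abs_norm_sub_norm_le _ _).trans (hV.norm_empScore_sub_le x y)
    refine h1.trans ?_
    rw [add_mul, add_mul, mul_right_comm, div_mul_cancel₀ _ hr.ne']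
    have : 0 ≤ L / (m / 12) * (l2 (y - x) / √n) * (m ^ 2 / (48 * L)) := by positivity
    linarith
  · rw [← sub_div, abs_div, abs_of_pos hη, div_le_iff₀ hη, cutoffLip]
    have h1 := (abs_norm_sub_norm_le _ _).trans (hV.norm_hessianDev_sub_le x y)
    have h2 : L * ((n : ℝ)⁻¹ * ∑ j, ‖y j - x j‖) ≤ L * (l2 (y - x) / √n) := by
      gcongr
      exact avg_norm_le (y - x)
    refine (h1.trans h2).trans ?_
    rw [add_mul, add_mul, mul_right_comm (L / (m / 12)), div_mul_cancel₀ _ hη.ne']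
    have : 0 ≤ M / (m ^ 2 / (48 * L)) * (l2 (y - x) / √n) * (m / 12) := by positivity
    linarith

theorem isGood_of_cutoffStat_lt (hV : IsRegularPotential V M L m)
    {x : Fin n → EuclideanSpace ℝ (Fin d)} (h : cutoffStat V L m x < 3) : IsGood V L m x := by
  have hL := hV.L_pos
  have hm := hV.m_pos
  obtain ⟨h1, h2⟩ := max_lt_iff.1 h
  rw [div_lt_iff₀ (by positivity)] at h1 h2
  refine ⟨by linarith, h1.trans_le (le_of_eq ?_)⟩
  field_simp
  norm_num

theorem cutoffStat_le_add (hV : IsRegularPotential V M L m)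
    (x : Fin n → EuclideanSpace ℝ (Fin d)) : cutoffStat V L m x
      ≤ ‖empScore V x‖ / (m ^ 2 / (48 * L)) + ‖hessianDev V x‖ / (m / 12) := by
  have hL := hV.L_pos
  have hm := hV.m_pos
  exact max_le_add_of_nonneg (by positivity) (by positivity)

theorem abs_linRemainder_le (hV : IsRegularPotential V M L m) (hf : HolderBound f N ρ)
    (x : Fin n → EuclideanSpace ℝ (Fin d)) :
    |linRemainder V f x| ≤ N * (2 + ‖empScore V x‖ / m) := by
  have hm := hV.m_pos
  have hN := hf.nonneg
  have h1 := hf.abs_le (mle V x)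
  have h2 := hf.abs_le 0
  have h3 : |⟪empScore V x, (fisher V).inverse (gradient f 0)⟫| ≤ ‖empScore V x‖ * (N / m) := by
    refine (abs_real_inner_le_norm _ _).trans ?_
    gcongr
    refine (hV.norm_fisher_inverse_le _).trans ?_
    gcongr
    exact hf.norm_gradient_le 0
  have h4 := abs_sub (f (mle V x) - f 0) ⟪empScore V x, (fisher V).inverse (gradient f 0)⟫
  have h5 := abs_sub (f (mle V x)) (f 0)
  rw [linRemainder]
  have : N * (2 + ‖empScore V x‖ / m) = N + N + ‖empScore V x‖ * (N / m) := by ring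
  linarith

theorem abs_linRemainder_le_of_isGood (hV : IsRegularPotential V M L m) (hf : HolderBound f N ρ)
    {x : Fin n → EuclideanSpace ℝ (Fin d)} (hx : IsGood V L m x) :
    |linRemainder V f x| ≤ N * remBound L m := by
  have hm := hV.m_pos
  have hN := hf.nonneg
  refine (hV.abs_linRemainder_le hf x).trans ?_
  rw [remBound]
  have := hx.2.le
  gcongr

/-- Increments of the remainder between good samples. -/
theorem abs_linRemainder_sub_le (hV : IsRegularPotential V M L m) (hf : HolderBound f N ρ)
    (hρ : 0 < ρ) (hn : 1 ≤ n) {x y : Fin n → EuclideanSpace ℝ (Fin d)} (hx : IsGood V L m x)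
    (hy : IsGood V L m y) {a : ℝ} (ha : l2 (y - x) / √n = a) :
    |linRemainder V f y - linRemainder V f x|
      ≤ N * (2 * M / m * (‖mle V x‖ + 2 * M / m * a) ^ ρ
        + 1 / m * (L * (‖mle V x‖ + 2 * M / m * a)
          + (‖hessianDev V x‖ + L * a + L * (‖mle V x‖ + 2 * M / m * a)) * (2 * M / m))) * a := by
  have hm := hV.m_pos
  have hM := hV.M_pos
  have hL := hV.L_pos
  have hN := hf.nonneg
  have ha0 : 0 ≤ a := by rw [← ha]; have := l2_nonneg (y - x); positivity
  have hΔ := hV.norm_mle_sub_le hn hx hy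
  have hlin := hV.norm_fisher_mle_sub_sub_le hn x y
  have hft := hf.abs_sub_sub_inner_le hρ (mle V x) (mle V y)
  rw [ha] at hΔ hlin
  set Δ := mle V y - mle V x with hΔdef
  set w := (fisher V).inverse (gradient f 0) with hw
  have hw1 : fisher V w = gradient f 0 := hV.fisher_inverse _
  have hw2 : ‖w‖ ≤ N / m := (hV.norm_fisher_inverse_le _).trans (by
    gcongr; exact hf.norm_gradient_le 0)
  have e : linRemainder V f y - linRemainder V f x
      = (f (mle V y) - f (mle V x) - ⟪gradient f 0, Δ⟫)
        + ⟪fisher V Δ - (empScore V y - empScore V x), w⟫ := by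
    rw [inner_sub_left (fisher V Δ), hV.inner_fisher_comm, hw1, inner_sub_left (empScore V y),
      linRemainder, linRemainder, real_inner_comm Δ]
    ring
  have hin : |⟪fisher V Δ - (empScore V y - empScore V x), w⟫|
      ≤ (L * (‖mle V x‖ + 2 * M / m * a) * a
        + (‖hessianDev V x‖ + L * a + L * (‖mle V x‖ + 2 * M / m * a)) * (2 * M / m * a))
        * (N / m) := by
    refine (abs_real_inner_le_norm _ _).trans (mul_le_mul (hlin.trans ?_) hw2 (norm_nonneg _)
      (by positivity))
    gcongr
  have hft' : |f (mle V y) - f (mle V x) - ⟪gradient f 0, Δ⟫|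
      ≤ N * (‖mle V x‖ + 2 * M / m * a) ^ ρ * (2 * M / m * a) := by
    refine hft.trans ?_
    gcongr
  rw [e]
  refine (abs_add_le _ _).trans ((add_le_add hft' hin).trans (le_of_eq ?_))
  ring

/-- A crude Lipschitz bound for the remainder between good samples. -/
theorem abs_linRemainder_sub_le_lip (hV : IsRegularPotential V M L m) (hf : HolderBound f N ρ)
    (hn : 1 ≤ n) {x y : Fin n → EuclideanSpace ℝ (Fin d)} (hx : IsGood V L m x)
    (hy : IsGood V L m y) :
    |linRemainder V f y - linRemainder V f x| ≤ (3 * N * M / m) * (l2 (y - x) / √n) := by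
  have hm := hV.m_pos
  have hN := hf.nonneg
  have h1 := (hf.abs_sub_le (mle V x) (mle V y)).trans
    (mul_le_mul_of_nonneg_left (hV.norm_mle_sub_le hn hx hy) hN)
  set w := (fisher V).inverse (gradient f 0) with hw
  have hw2 : ‖w‖ ≤ N / m := (hV.norm_fisher_inverse_le _).trans (by
    gcongr; exact hf.norm_gradient_le 0)
  have h2 : |⟪empScore V y - empScore V x, w⟫| ≤ M * (l2 (y - x) / √n) * (N / m) := by
    refine (abs_real_inner_le_norm _ _).trans (mul_le_mul (hV.norm_empScore_sub_le x y) hw2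
      (norm_nonneg _) ?_)
    have := l2_nonneg (y - x)
    have := hV.M_pos
    positivity
  have e : linRemainder V f y - linRemainder V f x
      = (f (mle V y) - f (mle V x)) - ⟪empScore V y - empScore V x, w⟫ := by
    rw [inner_sub_left, linRemainder, linRemainder]
    ring
  rw [e]
  refine (abs_sub _ _).trans ((add_le_add h1 h2).trans (le_of_eq ?_))
  ring

/-- The truncated remainder: a bounded locally Lipschitz function of the sample. -/
def truncRemainder (V f : EuclideanSpace ℝ (Fin d) → ℝ) (L m : ℝ)
    (x : Fin n → EuclideanSpace ℝ (Fin d)) : ℝ :=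
  cutoff V L m x * linRemainder V f x

theorem abs_truncRemainder_le (hV : IsRegularPotential V M L m) (hf : HolderBound f N ρ)
    (x : Fin n → EuclideanSpace ℝ (Fin d)) :
    |truncRemainder V f L m x| ≤ N * remBound L m := by
  have hN := hf.nonneg
  have hB := hV.remBound_nonneg
  rw [truncRemainder, abs_mul, abs_of_nonneg (cutoff_nonneg x)]
  rcases lt_or_ge (cutoffStat V L m x) 3 with h | h
  · calc _ ≤ 1 * (N * remBound L m) := by
          gcongr
          · exact cutoff_le_one x
          · exact hV.abs_linRemainder_le_of_isGood hf (hV.isGood_of_cutoffStat_lt h)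
      _ = _ := one_mul _
  · rw [cutoff_eq_zero (by linarith), zero_mul]
    positivity

theorem abs_truncRemainder_sub_le (x y : Fin n → EuclideanSpace ℝ (Fin d)) :
    |truncRemainder V f L m y - truncRemainder V f L m x|
      ≤ |linRemainder V f y - linRemainder V f x|
        + |linRemainder V f x| * |cutoff V L m y - cutoff V L m x| := by
  have e : truncRemainder V f L m y - truncRemainder V f L m x
      = cutoff V L m y * (linRemainder V f y - linRemainder V f x)
        + linRemainder V f x * (cutoff V L m y - cutoff V L m x) := by
    rw [truncRemainder, truncRemainder]; ring
  rw [e]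
  refine (abs_add_le _ _).trans ?_
  rw [abs_mul, abs_mul, abs_of_nonneg (cutoff_nonneg y)]
  gcongr
  exact mul_le_of_le_one_left (abs_nonneg _) (cutoff_le_one y)

theorem truncRemainder_eventually_zero (hV : IsRegularPotential V M L m)
    {x : Fin n → EuclideanSpace ℝ (Fin d)} (h : 2 < cutoffStat V L m x) :
    truncRemainder V f L m =ᶠ[nhds x] fun _ => 0 := by
  filter_upwards [(hV.continuous_cutoffStat.tendsto x).eventually_const_lt h] with y hy
  rw [truncRemainder, cutoff_eq_zero hy.le, zero_mul]

theorem locallyLipschitz_truncRemainder (hV : IsRegularPotential V M L m)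
    (hf : HolderBound f N ρ) (hn : 1 ≤ n) :
    LocallyLipschitz (truncRemainder V f L m : (Fin n → EuclideanSpace ℝ (Fin d)) → ℝ) := by
  have hN := hf.nonneg
  have hM := hV.M_pos
  have hm := hV.m_pos
  have hB := hV.remBound_nonneg
  have hC := hV.cutoffLip_nonneg
  intro x
  rcases lt_or_ge (cutoffStat V L m x) 3 with h | h
  · refine ⟨Real.toNNReal (3 * N * M / m + N * remBound L m * cutoffLip M L m),
      {y | cutoffStat V L m y < 3}, (hV.continuous_cutoffStat.tendsto x).eventually_lt_const h, ?_⟩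
    refine LipschitzOnWith.of_dist_le_mul fun y hy z hz => ?_
    have gy := hV.isGood_of_cutoffStat_lt hy
    have gz := hV.isGood_of_cutoffStat_lt hz
    rw [Real.coe_toNNReal _ (by positivity), Real.dist_eq, dist_eq_norm]
    have ha := l2_div_sqrt_le (y - z)
    have ha0 : 0 ≤ l2 (y - z) / √n := by have := l2_nonneg (y - z); positivity
    calc _ ≤ _ := abs_truncRemainder_sub_le z y
      _ ≤ (3 * N * M / m) * (l2 (y - z) / √n)
          + (N * remBound L m) * (cutoffLip M L m * (l2 (y - z) / √n)) := by
        gcongr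
        · exact hV.abs_linRemainder_sub_le_lip hf hn gz gy
        · exact hV.abs_linRemainder_le_of_isGood hf gz
        · exact (abs_cutoff_sub_le z y).trans (hV.abs_cutoffStat_sub_le z y)
      _ = (3 * N * M / m + N * remBound L m * cutoffLip M L m) * (l2 (y - z) / √n) := by ring
      _ ≤ _ := by gcongr
  · refine ⟨0, {y | truncRemainder V f L m y = 0},
      hV.truncRemainder_eventually_zero (by linarith), ?_⟩
    refine LipschitzOnWith.of_dist_le_mul fun y hy z hz => ?_
    have hy : truncRemainder V f L m y = 0 := hy
    have hz : truncRemainder V f L m z = 0 := hz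
    simp [hy, hz]

/-- The gradient of the truncated remainder is small where the score and the deviation of the
empirical Hessian are small. -/
theorem abs_fderiv_truncRemainder_le (hV : IsRegularPotential V M L m) (hf : HolderBound f N ρ)
    (hρ : 0 < ρ) (hρ1 : ρ ≤ 1) (hn : 1 ≤ n) {x : Fin n → EuclideanSpace ℝ (Fin d)}
    (hd : DifferentiableAt ℝ (truncRemainder V f L m) x) (v : Fin n → EuclideanSpace ℝ (Fin d)) :
    |fderiv ℝ (truncRemainder V f L m) x v|
      ≤ N * slopeConst M L m / √n * (‖empScore V x‖ ^ ρ + ‖empScore V x‖ + ‖hessianDev V x‖)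
        * l2 v := by
  have hN := hf.nonneg
  have hM := hV.M_pos
  have hm := hV.m_pos
  have hL := hV.L_pos
  have hB := hV.remBound_nonneg
  have hC := hV.cutoffLip_nonneg
  have hS := hV.slopeConst_pos
  have hl2 := l2_nonneg v
  have hn0 : (0 : ℝ) < n := by exact_mod_cast hn
  have hsn : 0 < √(n : ℝ) := Real.sqrt_pos.2 hn0
  rcases lt_or_ge 2 (cutoffStat V L m x) with h2 | h2
  · rw [(hV.truncRemainder_eventually_zero h2).fderiv_eq]
    simp only [fderiv_fun_const, Pi.zero_apply, zero_apply, abs_zero]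
    positivity
  have h3 : cutoffStat V L m x < 3 := by linarith
  have gx := hV.isGood_of_cutoffStat_lt h3
  set t := ‖mle V x‖ with ht
  set D := ‖hessianDev V x‖ with hD
  set S := ‖empScore V x‖ with hSdef
  set W := cutoffStat V L m x with hW
  have hW0 : 0 ≤ W := le_max_of_le_left (by positivity)
  let ω : ℝ → ℝ := fun l => (N * (2 * M / m * (t + 2 * M / m * (l / √n)) ^ ρ
        + 1 / m * (L * (t + 2 * M / m * (l / √n))
          + (D + L * (l / √n) + L * (t + 2 * M / m * (l / √n))) * (2 * M / m)))
        + (N * remBound L m) * (cutoffLip M L m * W)) / √n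
  have hω : ContinuousAt ω 0 := by
    have : Continuous ω := by
      have h1 : Continuous fun l : ℝ => (t + 2 * M / m * (l / √n)) ^ ρ :=
        Continuous.rpow_const (by fun_prop) fun _ => Or.inr hρ.le
      fun_prop
    exact this.continuousAt
  have hslope : ∀ᶠ y in nhds x, |truncRemainder V f L m y - truncRemainder V f L m x|
      ≤ ω (l2 (y - x)) * l2 (y - x) := by
    have hcut : ∀ᶠ y in nhds x, |cutoff V L m y - cutoff V L m x|
        ≤ cutoffLip M L m * W * (l2 (y - x) / √n) := by
      rcases lt_or_ge W 1 with h1 | h1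
      · filter_upwards [(hV.continuous_cutoffStat.tendsto x).eventually_lt_const h1] with y hy
        rw [cutoff_eq_one hy.le, cutoff_eq_one h1.le, sub_self, abs_zero]
        have := l2_nonneg (y - x)
        positivity
      · refine Filter.Eventually.of_forall fun y => ?_
        refine (abs_cutoff_sub_le x y).trans ((hV.abs_cutoffStat_sub_le x y).trans ?_)
        have := l2_nonneg (y - x)
        have : 0 ≤ cutoffLip M L m * (l2 (y - x) / √n) := by positivity
        nlinarith
    filter_upwards [hcut, (hV.continuous_cutoffStat.tendsto x).eventually_lt_const h3] with y hy hy3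
    have gy := hV.isGood_of_cutoffStat_lt hy3
    refine (abs_truncRemainder_sub_le x y).trans ?_
    have b1 := hV.abs_linRemainder_sub_le hf hρ hn gx gy rfl
    have b2 : |linRemainder V f x| * |cutoff V L m y - cutoff V L m x|
        ≤ (N * remBound L m) * (cutoffLip M L m * W * (l2 (y - x) / √n)) := by
      gcongr
      exact hV.abs_linRemainder_le_of_isGood hf gx
    refine (add_le_add b1 b2).trans (le_of_eq ?_)
    simp only [ω]
    ring
  refine (abs_fderiv_le_of_slope hd hω hslope v).trans ?_
  gcongr
  have hts : t ≤ 2 / m * S := hV.norm_mle_le hn gx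
  have htρ : t ^ ρ ≤ (1 + 2 / m) * S ^ ρ := by
    calc t ^ ρ ≤ (2 / m * S) ^ ρ := by gcongr
      _ = (2 / m) ^ ρ * S ^ ρ := Real.mul_rpow (by positivity) (norm_nonneg _)
      _ ≤ (1 + 2 / m) * S ^ ρ := by
        gcongr
        calc (2 / m) ^ ρ ≤ (1 + 2 / m) ^ ρ := by gcongr; linarith
          _ ≤ (1 + 2 / m) ^ (1 : ℝ) := by
            gcongr
            have : 0 ≤ 2 / m := by positivity
            linarith
          _ = _ := Real.rpow_one _
  have hWle := hV.cutoffStat_le_add x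
  have hSρ : 0 ≤ S ^ ρ := by positivity
  have hS0 : 0 ≤ S := norm_nonneg _
  have hD0 : 0 ≤ D := norm_nonneg _
  simp only [ω, zero_div, mul_zero, add_zero]
  rw [div_mul_eq_mul_div (N * slopeConst M L m)]
  refine div_le_div_of_nonneg_right ?_ hsn.le
  set A₁ := 2 * M / m * (1 + 2 / m) with hA₁
  set A₂ := 1 / m * (L + 2 * M / m * L) * (2 / m) with hA₂
  set A₃ := 1 / m * (2 * M / m) with hA₃
  set A₄ := remBound L m * cutoffLip M L m * (1 / (m ^ 2 / (48 * L)) + 1 / (m / 12)) with hA₄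
  have p1 : 0 ≤ A₁ := by positivity
  have p2 : 0 ≤ A₂ := by positivity
  have p3 : 0 ≤ A₃ := by positivity
  have p4 : 0 ≤ A₄ := by positivity
  have hsc : slopeConst M L m = A₁ + A₂ + A₃ + A₄ := rfl
  have e1 : 2 * M / m * t ^ ρ ≤ A₁ * S ^ ρ := by
    rw [hA₁, mul_assoc]; gcongr
  have e2 : 1 / m * (L * t + (D + L * t) * (2 * M / m)) ≤ A₂ * S + A₃ * D := by
    have : 1 / m * (L * t + (D + L * t) * (2 * M / m))
        = 1 / m * (L + 2 * M / m * L) * t + A₃ * D := by rw [hA₃]; ring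
    rw [this, hA₂, mul_assoc (1 / m * (L + 2 * M / m * L))]
    gcongr
  have e3 : remBound L m * (cutoffLip M L m * W) ≤ A₄ * (S + D) := by
    have : W ≤ (1 / (m ^ 2 / (48 * L)) + 1 / (m / 12)) * (S + D) := by
      have q1 : 0 ≤ 1 / (m ^ 2 / (48 * L)) * D := by positivity
      have q2 : 0 ≤ 1 / (m / 12) * S := by positivity
      calc W ≤ _ := hWle
        _ = 1 / (m ^ 2 / (48 * L)) * S + 1 / (m / 12) * D := by ring
        _ ≤ _ := by linarith
    calc _ = remBound L m * cutoffLip M L m * W := by ring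
      _ ≤ remBound L m * cutoffLip M L m * ((1 / (m ^ 2 / (48 * L)) + 1 / (m / 12)) * (S + D)) := by
        gcongr
      _ = _ := by rw [hA₄]; ring
  have e4 : 2 * M / m * t ^ ρ + 1 / m * (L * t + (D + L * t) * (2 * M / m))
      + remBound L m * (cutoffLip M L m * W) ≤ slopeConst M L m * (S ^ ρ + S + D) := by
    rw [hsc]
    have r1 := mul_nonneg p1 hS0
    have r2 := mul_nonneg p1 hD0
    have r3 := mul_nonneg p2 hSρ
    have r4 := mul_nonneg p2 hD0
    have r5 := mul_nonneg p3 hSρ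
    have r6 := mul_nonneg p3 hS0
    have r7 := mul_nonneg p4 hSρ
    linarith
  calc _ = N * (2 * M / m * t ^ ρ + 1 / m * (L * t + (D + L * t) * (2 * M / m))
      + remBound L m * (cutoffLip M L m * W)) := by ring
    _ ≤ N * (slopeConst M L m * (S ^ ρ + S + D)) := by gcongr
    _ = _ := by ring

end IsRegularPotential

/-! ### Rates and tail bounds -/

/-- The square root of the ratio of dimension to sample size that the theorem allows, up to an
absolute constant. -/
def ratioBound (M L m : ℝ) : ℝ := min (m / M) (m ^ 2 / (L * √M))

/-- The exponential rate at which the cutoff becomes inactive. -/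
def tailRate (M L m : ℝ) : ℝ := ratioBound M L m ^ 2 / 73728

/-- The constant of the gradient term of the concentration bound. -/
def mainConst (M L m : ℝ) : ℝ := slopeConst M L m * (1 + 300 * √M + 225 * M)

/-- The constant of the truncation term of the concentration bound. -/
def tailConst (M L m : ℝ) : ℝ := 4 / tailRate M L m * (2 + 300 * √M / m)

/-- The constant of the concentration bound. -/
def concConst (M L m : ℝ) : ℝ := 6 * (mainConst M L m + 2 * tailConst M L m * (M / √m))

theorem sqrt_le_rpow_half {ε ρ : ℝ} (hε : 0 < ε) (hε1 : ε ≤ 1) (hρ1 : ρ ≤ 1) :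
    √ε ≤ ε ^ (ρ / 2) := by
  rw [Real.sqrt_eq_rpow]
  exact Real.rpow_le_rpow_of_exponent_ge hε hε1 (by linarith)

theorem three_mul_sqrt_le {p : ℝ} (hp : 1 ≤ p) : 3 * p * √(3 * p) ≤ 6 * p ^ (3 / 2 : ℝ) := by
  have h1 : p ^ (3 / 2 : ℝ) = p * √p := by
    rw [Real.sqrt_eq_rpow, show (3 / 2 : ℝ) = 1 + 1 / 2 by norm_num,
      Real.rpow_add (by linarith), Real.rpow_one]
  have h2 : √3 ≤ 2 := by
    rw [Real.sqrt_le_iff]; norm_num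
  have h3 : 0 ≤ √p := Real.sqrt_nonneg p
  rw [h1, Real.sqrt_mul (by norm_num)]
  calc 3 * p * (√3 * √p) ≤ 3 * p * (2 * √p) := by gcongr
    _ = _ := by ring

namespace IsRegularPotential

variable {d n : ℕ} {V f : EuclideanSpace ℝ (Fin d) → ℝ} {M L m N ρ : ℝ}

theorem tailRate_pos (hV : IsRegularPotential V M L m) : 0 < tailRate M L m := by
  have := hV.M_pos; have := hV.L_pos; have := hV.m_pos
  have : 0 < ratioBound M L m := lt_min (by positivity) (by positivity)
  unfold tailRate; positivity

theorem tailConst_nonneg (hV : IsRegularPotential V M L m) : 0 ≤ tailConst M L m := by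
  have := hV.tailRate_pos; have := hV.m_pos
  unfold tailConst; positivity

theorem mainConst_pos (hV : IsRegularPotential V M L m) : 0 < mainConst M L m := by
  have := hV.slopeConst_pos; have := hV.M_pos
  unfold mainConst; positivity

theorem measurable_norm_empScore (hV : IsRegularPotential V M L m) :
    Measurable fun x : Fin n → EuclideanSpace ℝ (Fin d) => ‖empScore V x‖ :=
  hV.continuous_empScore.norm.measurable

theorem measurable_norm_hessianDev (hV : IsRegularPotential V M L m) :
    Measurable fun x : Fin n → EuclideanSpace ℝ (Fin d) => ‖hessianDev V x‖ :=
  hV.continuous_hessianDev.norm.measurable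

theorem eLpNorm_empScore_le (hV : IsRegularPotential V M L m) (hd : 1 ≤ d) (hn : 1 ≤ n) {q : ℝ}
    (hq : 1 ≤ q) :
    eLpNorm (fun x : Fin n → EuclideanSpace ℝ (Fin d) => ‖empScore V x‖) (ENNReal.ofReal q)
      (sampleLaw V n 0) ≤ ENNReal.ofReal (150 * √M * √q * √(d / n)) := by
  have := hV.isProbabilityMeasure_sampleLaw (n := n)
  have hM := hV.M_pos
  have hn0 : (0 : ℝ) < n := by exact_mod_cast hn
  refine ((hV.hasExpBound_empScore hn).eLpNorm_le hV.measurable_norm_empScore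
    (fun _ => norm_nonneg _) (by positivity) hd hq).trans (ENNReal.ofReal_le_ofReal (le_of_eq ?_))
  rw [show 4 * M / n * (q * d) = 2 ^ 2 * (M * (q * (d / n))) by ring,
    Real.sqrt_mul (by norm_num), Real.sqrt_mul hM.le, Real.sqrt_mul (by linarith),
    Real.sqrt_sq (by norm_num)]
  ring

theorem eLpNorm_hessianDev_le (hV : IsRegularPotential V M L m) (hd : 1 ≤ d) (hn : 1 ≤ n) {q : ℝ}
    (hq : 1 ≤ q) :
    eLpNorm (fun x : Fin n → EuclideanSpace ℝ (Fin d) => ‖hessianDev V x‖) (ENNReal.ofReal q)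
      (sampleLaw V n 0) ≤ ENNReal.ofReal (225 * M * √q * √(d / n)) := by
  have := hV.isProbabilityMeasure_sampleLaw (n := n)
  have hM := hV.M_pos
  have hn0 : (0 : ℝ) < n := by exact_mod_cast hn
  refine ((hV.hasExpBound_hessianDev hn).eLpNorm_le hV.measurable_norm_hessianDev
    (fun _ => norm_nonneg _) (by positivity) hd hq).trans (ENNReal.ofReal_le_ofReal ?_)
  have h : √(8 * M ^ 2 / n * (q * d)) ≤ √((3 * M) ^ 2 * (q * (d / n))) := by
    refine Real.sqrt_le_sqrt ?_
    rw [show 8 * M ^ 2 / n * (q * d) = 8 * M ^ 2 * (q * (d / n)) by ring]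
    gcongr
    nlinarith [sq_nonneg M]
  have e : √((3 * M) ^ 2 * (q * (d / n))) = 3 * M * (√q * √(d / n)) := by
    rw [Real.sqrt_mul (by positivity), Real.sqrt_mul (by linarith), Real.sqrt_sq (by positivity)]
  rw [e] at h
  linarith

/-- The moments of the gradient bound. -/
theorem eLpNorm_gradient_bound_le (hV : IsRegularPotential V M L m) (hd : 1 ≤ d) (hn : 1 ≤ n)
    (hdn : (d : ℝ) / n ≤ 1) (hρ : 0 < ρ) (hρ1 : ρ ≤ 1) {q : ℝ} (hq : 1 ≤ q) :
    eLpNorm (fun x : Fin n → EuclideanSpace ℝ (Fin d) =>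
      ‖empScore V x‖ ^ ρ + ‖empScore V x‖ + ‖hessianDev V x‖) (ENNReal.ofReal q) (sampleLaw V n 0)
      ≤ ENNReal.ofReal ((1 + 300 * √M + 225 * M) * √q * ((d : ℝ) / n) ^ (ρ / 2)) := by
  have := hV.isProbabilityMeasure_sampleLaw (n := n)
  have hM := hV.M_pos
  have hn0 : (0 : ℝ) < n := by exact_mod_cast hn
  have hd0 : (0 : ℝ) < d := by exact_mod_cast hd
  have hε : 0 < (d : ℝ) / n := by positivity
  set ε := (d : ℝ) / n with hεdef
  have hsε := sqrt_le_rpow_half hε hdn hρ1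
  have hq1 : (1 : ℝ≥0∞) ≤ ENNReal.ofReal q := by
    rw [← ENNReal.ofReal_one]; exact ENNReal.ofReal_le_ofReal hq
  have hsq : 1 ≤ √q := Real.one_le_sqrt.2 hq
  have mS := hV.measurable_norm_empScore (n := n)
  have mD := hV.measurable_norm_hessianDev (n := n)
  have b1 : eLpNorm (fun x : Fin n → EuclideanSpace ℝ (Fin d) => ‖empScore V x‖ ^ ρ)
      (ENNReal.ofReal q) (sampleLaw V n 0)
      ≤ ENNReal.ofReal ((1 + 150 * √M) * √q * ε ^ (ρ / 2)) := by
    have h1 := eLpNorm_norm_rpow (μ := sampleLaw V n 0) (p := ENNReal.ofReal q)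
      (fun x : Fin n → EuclideanSpace ℝ (Fin d) => ‖empScore V x‖) hρ
    simp only [norm_norm] at h1
    rw [h1]
    have h2 : eLpNorm (fun x : Fin n → EuclideanSpace ℝ (Fin d) => ‖empScore V x‖)
        (ENNReal.ofReal q * ENNReal.ofReal ρ) (sampleLaw V n 0)
        ≤ ENNReal.ofReal (150 * √M * √q * √ε) := by
      refine (eLpNorm_le_eLpNorm_of_exponent_le ?_ mS.aestronglyMeasurable).trans
        (hV.eLpNorm_empScore_le hd hn hq)
      exact mul_le_of_le_one_right zero_le (by
        rw [← ENNReal.ofReal_one]; exact ENNReal.ofReal_le_ofReal hρ1)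
    refine (ENNReal.rpow_le_rpow h2 hρ.le).trans ?_
    rw [ENNReal.ofReal_rpow_of_nonneg (by positivity) hρ.le]
    refine ENNReal.ofReal_le_ofReal ?_
    have h3 : √ε ^ ρ = ε ^ (ρ / 2) := by
      rw [Real.sqrt_eq_rpow, ← Real.rpow_mul hε.le]; ring_nf
    rw [Real.mul_rpow (by positivity) (Real.sqrt_nonneg _), h3]
    gcongr
    have h4 : 1 ≤ (1 + 150 * √M) * √q :=
      one_le_mul_of_one_le_of_one_le (by have := Real.sqrt_nonneg M; linarith) hsq
    calc (150 * √M * √q) ^ ρ ≤ ((1 + 150 * √M) * √q) ^ ρ := by gcongr; linarith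
      _ ≤ ((1 + 150 * √M) * √q) ^ (1 : ℝ) := Real.rpow_le_rpow_of_exponent_le h4 hρ1
      _ = _ := Real.rpow_one _
  have b2 := hV.eLpNorm_empScore_le hd hn hq
  have b3 := hV.eLpNorm_hessianDev_le hd hn hq
  calc _ ≤ eLpNorm (fun x : Fin n → EuclideanSpace ℝ (Fin d) => ‖empScore V x‖ ^ ρ)
        (ENNReal.ofReal q) (sampleLaw V n 0)
        + eLpNorm (fun x : Fin n → EuclideanSpace ℝ (Fin d) => ‖empScore V x‖)
        (ENNReal.ofReal q) (sampleLaw V n 0)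
        + eLpNorm (fun x : Fin n → EuclideanSpace ℝ (Fin d) => ‖hessianDev V x‖)
        (ENNReal.ofReal q) (sampleLaw V n 0) := by
        refine (eLpNorm_add_le ((mS.pow_const ρ).add mS).aestronglyMeasurable
          mD.aestronglyMeasurable hq1).trans ?_
        gcongr
        exact eLpNorm_add_le (mS.pow_const ρ).aestronglyMeasurable mS.aestronglyMeasurable hq1
    _ ≤ _ := add_le_add (add_le_add b1 b2) b3
    _ = ENNReal.ofReal ((1 + 150 * √M) * √q * ε ^ (ρ / 2) + 150 * √M * √q * √ε
        + 225 * M * √q * √ε) := by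
        rw [ENNReal.ofReal_add (by positivity) (by positivity),
          ENNReal.ofReal_add (by positivity) (by positivity)]
    _ ≤ _ := by
        refine ENNReal.ofReal_le_ofReal ?_
        have c1 : 150 * √M * √q * √ε ≤ 150 * √M * √q * ε ^ (ρ / 2) := by gcongr
        have c2 : 225 * M * √q * √ε ≤ 225 * M * √q * ε ^ (ρ / 2) := by gcongr
        linarith

/-- The cutoff is inactive outside an event of exponentially small probability. This is where the
bound on `d / n` enters: it absorbs the cardinality of the nets. -/
theorem measure_cutoffStat_ge_le (hV : IsRegularPotential V M L m) (hn : 1 ≤ n)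
    (hdn : 4 * (d : ℝ) ≤ tailRate M L m * n) :
    sampleLaw V n 0 {x | 1 ≤ cutoffStat V L m x}
      ≤ ENNReal.ofReal (2 * Real.exp (-(tailRate M L m * n))) := by
  have hM := hV.M_pos
  have hL := hV.L_pos
  have hm := hV.m_pos
  have hn0 : (0 : ℝ) < n := by exact_mod_cast hn
  have hr0 : 0 < ratioBound M L m := lt_min (by positivity) (by positivity)
  have h25 : (25 : ℝ) ^ d ≤ Real.exp (tailRate M L m * n) := by
    have h1 : (25 : ℝ) ≤ Real.exp 4 := by
      have := Real.exp_one_gt_d9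
      calc (25 : ℝ) ≤ 2.7 ^ 4 := by norm_num
        _ ≤ Real.exp 1 ^ 4 := by gcongr; linarith
        _ = Real.exp 4 := by rw [← Real.exp_nat_mul]; norm_num
    calc (25 : ℝ) ^ d ≤ Real.exp 4 ^ d := by gcongr
      _ = Real.exp (d * 4) := (Real.exp_nat_mul 4 d).symm
      _ ≤ _ := Real.exp_le_exp.2 (by linarith)
  have key : ∀ z : ℝ, 2 * (tailRate M L m * n) ≤ z →
      (25 : ℝ) ^ d * Real.exp (-z) ≤ Real.exp (-(tailRate M L m * n)) := fun z hz => by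
    calc _ ≤ Real.exp (tailRate M L m * n) * Real.exp (-(2 * (tailRate M L m * n))) := by
          gcongr
      _ = _ := by rw [← Real.exp_add]; ring_nf
  have h1 := (hV.hasExpBound_empScore hn).measure_ge_le hV.measurable_norm_empScore
    (by positivity) (t := m ^ 2 / (48 * L)) (by positivity)
  have h2 := (hV.hasExpBound_hessianDev hn).measure_ge_le hV.measurable_norm_hessianDev
    (by positivity) (t := m / 12) (by positivity)
  have e1 : 2 * (tailRate M L m * n) ≤ (m ^ 2 / (48 * L)) ^ 2 / (4 * (4 * M / n)) := by
    have : ratioBound M L m ^ 2 ≤ (m ^ 2 / (L * √M)) ^ 2 := by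
      gcongr
      exact min_le_right _ _
    rw [div_pow, mul_pow, Real.sq_sqrt hM.le] at this
    calc 2 * (tailRate M L m * n) = ratioBound M L m ^ 2 * (n / 36864) := by
          rw [tailRate]; ring
      _ ≤ (m ^ 2) ^ 2 / (L ^ 2 * M) * (n / 36864) := by gcongr
      _ = _ := by field_simp; norm_num
  have e2 : 2 * (tailRate M L m * n) ≤ (m / 12) ^ 2 / (4 * (8 * M ^ 2 / n)) := by
    have : ratioBound M L m ^ 2 ≤ (m / M) ^ 2 := by
      gcongr
      exact min_le_left _ _
    calc 2 * (tailRate M L m * n) = ratioBound M L m ^ 2 * (n / 36864) := by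
          rw [tailRate]; ring
      _ ≤ (m / M) ^ 2 * (n / 4608) := by gcongr; norm_num
      _ = _ := by field_simp; norm_num
  have hsub : {x : Fin n → EuclideanSpace ℝ (Fin d) | 1 ≤ cutoffStat V L m x}
      ⊆ {x | m ^ 2 / (48 * L) ≤ ‖empScore V x‖} ∪ {x | m / 12 ≤ ‖hessianDev V x‖} := by
    intro x hx
    have hx : 1 ≤ cutoffStat V L m x := hx
    rcases le_max_iff.1 hx with h | h
    · rw [one_le_div (by positivity)] at h
      exact Or.inl h
    · rw [one_le_div (by positivity)] at h
      exact Or.inr h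
  refine (measure_mono hsub).trans ((measure_union_le _ _).trans ((add_le_add h1 h2).trans ?_))
  rw [← ENNReal.ofReal_add (by positivity) (by positivity)]
  refine ENNReal.ofReal_le_ofReal ?_
  linarith [key _ e1, key _ e2]

theorem continuous_linRemainder (hV : IsRegularPotential V M L m) (hf : HolderBound f N ρ)
    (hn : 1 ≤ n) : Continuous (linRemainder V f : (Fin n → EuclideanSpace ℝ (Fin d)) → ℝ) := by
  have h1 := hV.continuous_mle hn
  have h2 := hf.differentiable.continuous
  have h3 := hV.continuous_empScore (n := n)
  unfold linRemainder
  fun_prop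

/-- The part of the remainder that is cut off is negligible in every `L_q`. -/
theorem eLpNorm_sub_truncRemainder_le (hV : IsRegularPotential V M L m) (hf : HolderBound f N ρ)
    (hd : 1 ≤ d) (hn : 1 ≤ n) (hdn1 : (d : ℝ) / n ≤ 1)
    (hdn : 4 * (d : ℝ) ≤ tailRate M L m * n) {q : ℝ} (hq : 1 ≤ q) :
    eLpNorm (fun x : Fin n → EuclideanSpace ℝ (Fin d) =>
      linRemainder V f x - truncRemainder V f L m x) (ENNReal.ofReal q) (sampleLaw V n 0)
      ≤ ENNReal.ofReal (N * tailConst M L m * (q * √q) / n) := by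
  have := hV.isProbabilityMeasure_sampleLaw (n := n)
  have hM := hV.M_pos
  have hm := hV.m_pos
  have hN := hf.nonneg
  have hκ := hV.tailRate_pos
  have hn0 : (0 : ℝ) < n := by exact_mod_cast hn
  have hq0 : 0 < q := by linarith
  set P := sampleLaw V n 0 with hP
  set A := {x : Fin n → EuclideanSpace ℝ (Fin d) | 1 ≤ cutoffStat V L m x} with hA
  have hAm : MeasurableSet A := measurableSet_le measurable_const hV.continuous_cutoffStat.measurable
  have mS := hV.measurable_norm_empScore (n := n)
  set Y : (Fin n → EuclideanSpace ℝ (Fin d)) → ℝ := fun x => N * (2 + ‖empScore V x‖ / m) with hY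
  have hYm : Measurable Y := by fun_prop
  set χ : (Fin n → EuclideanSpace ℝ (Fin d)) → ℝ := A.indicator fun _ => 1 with hχ
  have hχm : Measurable χ := measurable_const.indicator hAm
  have hq2 : (1 : ℝ≥0∞) ≤ ENNReal.ofReal (2 * q) := by
    rw [← ENNReal.ofReal_one]; exact ENNReal.ofReal_le_ofReal (by linarith)
  have step1 : eLpNorm (fun x => linRemainder V f x - truncRemainder V f L m x)
      (ENNReal.ofReal q) P ≤ eLpNorm (χ • Y) (ENNReal.ofReal q) P := by
    refine eLpNorm_mono_real fun x => ?_
    simp only [Pi.smul_apply', smul_eq_mul]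
    by_cases hx : x ∈ A
    · rw [hχ, indicator_of_mem hx, one_mul, truncRemainder, ← one_sub_mul, norm_mul,
        Real.norm_eq_abs, Real.norm_eq_abs]
      refine (mul_le_of_le_one_left (abs_nonneg _) ?_).trans (hV.abs_linRemainder_le hf x)
      rw [abs_le]
      constructor <;> linarith [cutoff_nonneg (V := V) (L := L) (m := m) x,
        cutoff_le_one (V := V) (L := L) (m := m) x]
    · have hx' : cutoffStat V L m x ≤ 1 := (not_le.1 hx).le
      rw [hχ, indicator_of_notMem hx, zero_mul, truncRemainder, cutoff_eq_one hx', one_mul,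
        sub_self, norm_zero]
  have hH : ENNReal.HolderTriple (ENNReal.ofReal (2 * q)) (ENNReal.ofReal (2 * q))
      (ENNReal.ofReal q) := by
    constructor
    rw [← ENNReal.ofReal_inv_of_pos (by linarith), ← ENNReal.ofReal_inv_of_pos hq0,
      ← ENNReal.ofReal_add (by positivity) (by positivity)]
    congr 1
    field_simp
    norm_num
  have step2 : eLpNorm (χ • Y) (ENNReal.ofReal q) P
      ≤ eLpNorm χ (ENNReal.ofReal (2 * q)) P * eLpNorm Y (ENNReal.ofReal (2 * q)) P :=
    eLpNorm_smul_le_mul_eLpNorm hYm.aestronglyMeasurable hχm.aestronglyMeasurable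
  have step3 : eLpNorm χ (ENNReal.ofReal (2 * q)) P
      ≤ ENNReal.ofReal (4 * q / (tailRate M L m * n)) := by
    rw [hχ, eLpNorm_indicator_const hAm (by simpa using hq0) ENNReal.ofReal_ne_top,
      ENNReal.toReal_ofReal (by linarith), enorm_one, one_mul]
    refine (ENNReal.rpow_le_rpow (hV.measure_cutoffStat_ge_le hn hdn) (by positivity)).trans ?_
    rw [ENNReal.ofReal_rpow_of_pos (by positivity)]
    refine ENNReal.ofReal_le_ofReal ?_
    rw [Real.mul_rpow (by norm_num) (Real.exp_nonneg _), ← Real.exp_mul]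
    set z := tailRate M L m * n with hz
    have hz0 : 0 < z := by positivity
    have h1 : (2 : ℝ) ^ (1 / (2 * q)) ≤ 2 := by
      conv_rhs => rw [← Real.rpow_one 2]
      refine Real.rpow_le_rpow_of_exponent_le (by norm_num) ?_
      rw [div_le_one (by positivity)]
      linarith
    have h2 : Real.exp (-z * (1 / (2 * q))) ≤ 2 * q / z := by
      have h3 := Real.add_one_le_exp (z / (2 * q))
      have h4 : -z * (1 / (2 * q)) = -(z / (2 * q)) := by ring
      rw [h4, Real.exp_neg, ← inv_div z]
      gcongr
      linarith
    calc _ ≤ 2 * (2 * q / z) := by gcongr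
      _ = _ := by ring
  have step4 : eLpNorm Y (ENNReal.ofReal (2 * q)) P
      ≤ ENNReal.ofReal (N * (√q * (2 + 300 * √M / m))) := by
    have e : Y = N • ((fun _ => (2 : ℝ)) + m⁻¹ • fun x : Fin n → EuclideanSpace ℝ (Fin d) =>
        ‖empScore V x‖) := by
      ext x
      simp only [hY, Pi.smul_apply, Pi.add_apply, smul_eq_mul]
      ring
    rw [e, eLpNorm_const_smul, Real.enorm_of_nonneg hN, ENNReal.ofReal_mul hN]
    gcongr
    refine (eLpNorm_add_le aestronglyMeasurable_const
      (mS.const_smul m⁻¹).aestronglyMeasurable hq2).trans ?_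
    rw [eLpNorm_const_smul, eLpNorm_const _ (by simpa using hq0) (IsProbabilityMeasure.ne_zero P)]
    simp only [measure_univ, ENNReal.one_rpow, mul_one]
    rw [Real.enorm_of_nonneg (by positivity : (0 : ℝ) ≤ 2),
      Real.enorm_of_nonneg (by positivity : 0 ≤ m⁻¹)]
    refine (add_le_add le_rfl (mul_le_mul' le_rfl
      (hV.eLpNorm_empScore_le hd hn (by linarith : 1 ≤ 2 * q)))).trans ?_
    rw [← ENNReal.ofReal_mul (by positivity), ← ENNReal.ofReal_add (by positivity) (by positivity)]
    refine ENNReal.ofReal_le_ofReal ?_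
    have hsq : 1 ≤ √q := Real.one_le_sqrt.2 hq
    have h2 : √2 ≤ 2 := by rw [Real.sqrt_le_iff]; norm_num
    have h3 : √((d : ℝ) / n) ≤ 1 := Real.sqrt_le_one.2 hdn1
    rw [Real.sqrt_mul (by norm_num)]
    calc 2 + m⁻¹ * (150 * √M * (√2 * √q) * √(d / n))
        ≤ 2 * √q + m⁻¹ * (150 * √M * (2 * √q) * 1) := by
          gcongr
          linarith
      _ = _ := by ring
  refine step1.trans (step2.trans ((mul_le_mul' step3 step4).trans ?_))
  rw [← ENNReal.ofReal_mul (by positivity)]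
  refine ENNReal.ofReal_le_ofReal (le_of_eq ?_)
  rw [tailConst]
  field_simp

end IsRegularPotential

/-! ### The concentration bound -/

theorem eLpNorm_sub_integral_le {Ω : Type*} [MeasurableSpace Ω] {P : Measure Ω}
    [IsProbabilityMeasure P] {U : Ω → ℝ} (hU : AEStronglyMeasurable U P) {q : ℝ≥0∞} (hq : 1 ≤ q) :
    eLpNorm (fun x => U x - ∫ y, U y ∂P) q P ≤ 2 * eLpNorm U q P := by
  have h0 : q ≠ 0 := (zero_lt_one.trans_le hq).ne'
  refine (eLpNorm_sub_le hU aestronglyMeasurable_const hq).trans ?_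
  rw [two_mul]
  gcongr
  rw [eLpNorm_const _ h0 (IsProbabilityMeasure.ne_zero P)]
  simp only [measure_univ, ENNReal.one_rpow, mul_one]
  refine (enorm_integral_le_lintegral_enorm _).trans ?_
  rw [← eLpNorm_one_eq_lintegral_enorm]
  exact eLpNorm_le_eLpNorm_of_exponent_le hq hU

theorem absolutelyContinuous_pi {α : Type*} [MeasurableSpace α] {μ ν : Measure α}
    [SigmaFinite μ] [SigmaFinite ν] (h : μ ≪ ν) (n : ℕ) :
    (Measure.pi fun _ : Fin n => μ) ≪ Measure.pi fun _ => ν := by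
  induction n with
  | zero => rw [Measure.pi_of_empty _ default, Measure.pi_of_empty _ default]
  | succ n ih =>
    rw [← ((measurePreserving_piFinSuccAbove (fun _ : Fin (n + 1) => μ) 0).symm _).map_eq,
      ← ((measurePreserving_piFinSuccAbove (fun _ : Fin (n + 1) => ν) 0).symm _).map_eq]
    exact (h.prod ih).map (MeasurableEquiv.measurable _)

namespace IsRegularPotential

variable {d n : ℕ} {V f : EuclideanSpace ℝ (Fin d) → ℝ} {M L m N ρ : ℝ}

theorem absolutelyContinuous_sampleLaw (hV : IsRegularPotential V M L m) :
    (Measure.pi fun _ : Fin n => law V 0) ≪ Measure.pi fun _ => Measure.addHaar := by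
  have := hV.prob
  exact absolutelyContinuous_pi ((withDensity_absolutelyContinuous _ _).trans
    (Measure.absolutelyContinuous_isAddHaarMeasure _ _)) n

theorem integrable_mle (hV : IsRegularPotential V M L m) (hf : HolderBound f N ρ) (hn : 1 ≤ n) :
    Integrable (fun x : Fin n → EuclideanSpace ℝ (Fin d) => f (mle V x)) (sampleLaw V n 0) := by
  have := hV.isProbabilityMeasure_sampleLaw (n := n)
  exact Integrable.of_bound (hf.differentiable.continuous.comp
    (hV.continuous_mle hn)).aestronglyMeasurable N (Filter.Eventually.of_forall fun x => hf.abs_le _)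

theorem integrable_inner_empScore (hV : IsRegularPotential V M L m)
    (w : EuclideanSpace ℝ (Fin d)) :
    Integrable (fun x : Fin n → EuclideanSpace ℝ (Fin d) => ⟪empScore V x, w⟫)
      (sampleLaw V n 0) := by
  simp_rw [inner_empScore]
  exact (hV.hasSubgaussianMGF_inner_empScore w).integrable.const_mul _

theorem integral_inner_empScore (hV : IsRegularPotential V M L m)
    (w : EuclideanSpace ℝ (Fin d)) :
    ∫ x : Fin n → EuclideanSpace ℝ (Fin d), ⟪empScore V x, w⟫ ∂(sampleLaw V n 0) = 0 := by
  have := hV.isProbabilityMeasure_sampleLaw (n := n)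
  simp_rw [inner_empScore]
  rw [integral_const_mul, (hV.hasSubgaussianMGF_inner_empScore w).integral_eq_zero, mul_zero]

/-- The concentration bound at the parameter `0`. -/
theorem eLpNorm_concentration_le (hV : IsRegularPotential V M L m) (hf : HolderBound f N ρ)
    (hρ : 0 < ρ) (hρ1 : ρ ≤ 1) (hd : 1 ≤ d) (hn : 1 ≤ n) (hdn1 : (d : ℝ) / n ≤ 1)
    (hdn : 4 * (d : ℝ) ≤ tailRate M L m * n) (hK : poincareConst (law V 0) ≠ ∞) {p : ℝ}
    (hp : 1 ≤ p) :
    eLpNorm (fun x : Fin n → EuclideanSpace ℝ (Fin d) =>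
        f (mle V x) - (∫ y, f (mle V y) ∂(sampleLaw V n 0))
          - ⟪empScore V x, (fisher V).inverse (gradient f 0)⟫) (ENNReal.ofReal p) (sampleLaw V n 0)
      ≤ ENNReal.ofReal (p ^ (3 / 2 : ℝ)) * (ENNReal.ofReal (concConst M L m)
        * poincareConst (law V 0) ^ (1 / 2 : ℝ) * ENNReal.ofReal N
        * ENNReal.ofReal (1 / √(n : ℝ) * ((d : ℝ) / n) ^ (ρ / 2))) := by
  have := hV.prob
  have := hV.isProbabilityMeasure_sampleLaw (n := n)
  have hM := hV.M_pos
  have hm := hV.m_pos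
  have hN := hf.nonneg
  have hS := hV.slopeConst_pos
  have hmc := hV.mainConst_pos
  have htc := hV.tailConst_nonneg
  have hn0 : (0 : ℝ) < n := by exact_mod_cast hn
  have hd0 : (0 : ℝ) < d := by exact_mod_cast hd
  have hsn : 0 < √(n : ℝ) := Real.sqrt_pos.2 hn0
  set P := sampleLaw V n 0 with hP
  set K := poincareConst (law V 0) with hKdef
  set w := (fisher V).inverse (gradient f 0) with hw
  set ε := (d : ℝ) / n with hε
  have hε0 : 0 < ε := by positivity
  set T : (Fin n → EuclideanSpace ℝ (Fin d)) → ℝ := truncRemainder V f L m with hT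
  set R : (Fin n → EuclideanSpace ℝ (Fin d)) → ℝ := linRemainder V f with hR
  -- the moment form of the Poincaré inequality needs an exponent above `2`
  set q := 3 * p with hq
  have hq1 : (1 : ℝ≥0∞) ≤ ENNReal.ofReal q := by
    rw [← ENNReal.ofReal_one]; exact ENNReal.ofReal_le_ofReal (by linarith)
  have hTl := hV.locallyLipschitz_truncRemainder hf hn
  have hTB := hV.abs_truncRemainder_le (n := n) hf
  have hTi : Integrable T P :=
    (memLp_of_abs_le hTl.continuous.measurable hTB 1).integrable le_rfl
  have hRc := hV.continuous_linRemainder hf hn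
  have hfi := hV.integrable_mle hf hn
  have hRi : Integrable R P :=
    (hfi.sub (integrable_const _)).sub (hV.integrable_inner_empScore w)
  have hRint : ∫ x, R x ∂P = (∫ x, f (mle V x) ∂P) - f 0 := by
    have h1 : Integrable (fun x => f (mle V x) - f 0) P := hfi.sub (integrable_const _)
    change ∫ x, (f (mle V x) - f 0 - ⟪empScore V x, w⟫) ∂P = _
    rw [integral_sub h1 (hV.integrable_inner_empScore w),
      hV.integral_inner_empScore, integral_sub hfi (integrable_const _)]
    simp [hP]
  have hdecomp : (fun x : Fin n → EuclideanSpace ℝ (Fin d) =>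
      f (mle V x) - (∫ y, f (mle V y) ∂P) - ⟪empScore V x, w⟫)
      = (fun x => T x - ∫ y, T y ∂P) + fun x => (R x - T x) - ∫ y, (R y - T y) ∂P := by
    ext x
    rw [Pi.add_apply, integral_sub hRi hTi, hRint]
    simp only [hR, linRemainder]
    ring
  -- the truncated remainder, by the moment form of the Poincaré inequality
  have hA : eLpNorm (fun x => T x - ∫ y, T y ∂P) (ENNReal.ofReal q) P
      ≤ K ^ (1 / 2 : ℝ) * ENNReal.ofReal (N * mainConst M L m * (q * √q) / √n * ε ^ (ρ / 2)) := by
    have hpoin := hV.poincare_poincareConst hd hK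
    set g : (Fin n → EuclideanSpace ℝ (Fin d)) → ℝ := fun x =>
      ‖empScore V x‖ ^ ρ + ‖empScore V x‖ + ‖hessianDev V x‖ with hg
    have hgm : Measurable g := by
      have mS := hV.measurable_norm_empScore (n := n)
      have mD := hV.measurable_norm_hessianDev (n := n)
      exact ((mS.pow_const ρ).add mS).add mD
    have h1 := hpoin.eLpNorm_sub_integral_le hV.absolutelyContinuous_sampleLaw hTl hTB
      (G := fun x => (N * slopeConst M L m / √n) * g x) (hgm.const_mul _) (p := q) (by
        filter_upwards [hV.absolutelyContinuous_sampleLaw.ae_le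
          (hTl.ae_differentiableAt (Measure.pi fun _ => Measure.addHaar))] with x hx v
        exact hV.abs_fderiv_truncRemainder_le hf hρ hρ1 hn hx v) (by linarith)
    refine h1.trans ?_
    have h2 := hV.eLpNorm_gradient_bound_le hd hn hdn1 hρ hρ1 (q := q) (by linarith)
    rw [show (fun x => (N * slopeConst M L m / √n) * g x) = (N * slopeConst M L m / √n) • g from rfl,
      eLpNorm_const_smul, Real.enorm_of_nonneg (by positivity)]
    refine (mul_le_mul' le_rfl (mul_le_mul' le_rfl h2)).trans (le_of_eq ?_)
    rw [mul_comm (ENNReal.ofReal q), mul_assoc, ← ENNReal.ofReal_mul (by positivity),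
      ← ENNReal.ofReal_mul (by positivity)]
    congr 2
    rw [mainConst]
    ring
  -- the part that is cut off; the Poincaré constant is bounded below
  have hB : eLpNorm (fun x => (R x - T x) - ∫ y, (R y - T y) ∂P) (ENNReal.ofReal q) P
      ≤ K ^ (1 / 2 : ℝ) * ENNReal.ofReal (N * (2 * tailConst M L m * (M / √m)) * (q * √q) / √n
        * ε ^ (ρ / 2)) := by
    have h1 := (eLpNorm_sub_integral_le (hRc.sub hTl.continuous).aestronglyMeasurable hq1).trans
      (mul_le_mul' le_rfl (hV.eLpNorm_sub_truncRemainder_le hf hd hn hdn1 hdn (q := q)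
        (by linarith)))
    refine h1.trans ?_
    have hKlow : ENNReal.ofReal (√m / M) ≤ K ^ (1 / 2 : ℝ) := by
      have h := ENNReal.rpow_le_rpow (hV.le_poincareConst hd) (show (0 : ℝ) ≤ 1 / 2 by norm_num)
      rw [ENNReal.ofReal_rpow_of_pos (by positivity), ← Real.sqrt_eq_rpow,
        Real.sqrt_div hm.le, Real.sqrt_sq hM.le] at h
      exact h
    refine le_trans ?_ (mul_le_mul' hKlow le_rfl)
    rw [show (2 : ℝ≥0∞) = ENNReal.ofReal 2 by simp, ← ENNReal.ofReal_mul (by norm_num),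
      ← ENNReal.ofReal_mul (by positivity)]
    refine ENNReal.ofReal_le_ofReal ?_
    have hrate : 1 / (n : ℝ) ≤ 1 / √n * ε ^ (ρ / 2) := by
      calc 1 / (n : ℝ) = 1 / √n * (1 / √n) := by
            rw [div_mul_div_comm, one_mul, Real.mul_self_sqrt hn0.le]
        _ = 1 / √n * √(1 / n) := by rw [Real.sqrt_div zero_le_one, Real.sqrt_one]
        _ ≤ 1 / √n * √ε := by
            gcongr
            rw [hε]
            gcongr
            exact_mod_cast hd
        _ ≤ _ := by
            gcongr
            exact sqrt_le_rpow_half hε0 hdn1 hρ1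
    have hsm : 0 < √m := Real.sqrt_pos.2 hm
    calc 2 * (N * tailConst M L m * (q * √q) / n)
        = 2 * (N * tailConst M L m * (q * √q)) * (1 / n) := by ring
      _ ≤ 2 * (N * tailConst M L m * (q * √q)) * (1 / √n * ε ^ (ρ / 2)) := by gcongr
      _ = _ := by field_simp
  have hmono : eLpNorm (fun x : Fin n → EuclideanSpace ℝ (Fin d) =>
      f (mle V x) - (∫ y, f (mle V y) ∂P) - ⟪empScore V x, w⟫) (ENNReal.ofReal p) P
      ≤ eLpNorm (fun x : Fin n → EuclideanSpace ℝ (Fin d) =>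
      f (mle V x) - (∫ y, f (mle V y) ∂P) - ⟪empScore V x, w⟫) (ENNReal.ofReal q) P :=
    eLpNorm_le_eLpNorm_of_exponent_le (ENNReal.ofReal_le_ofReal (by linarith))
      ((hfi.sub (integrable_const _)).sub (hV.integrable_inner_empScore w)).aestronglyMeasurable
  refine hmono.trans ?_
  rw [hdecomp]
  refine (eLpNorm_add_le (hTl.continuous.sub continuous_const).aestronglyMeasurable
    ((hRc.sub hTl.continuous).sub continuous_const).aestronglyMeasurable hq1).trans
    ((add_le_add hA hB).trans ?_)
  rw [← mul_add, ← ENNReal.ofReal_add (by positivity) (by positivity)]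
  have hcc : 0 ≤ concConst M L m := by unfold concConst; positivity
  calc _ ≤ K ^ (1 / 2 : ℝ) * ENNReal.ofReal (p ^ (3 / 2 : ℝ) * concConst M L m * N
        * (1 / √n * ε ^ (ρ / 2))) := by
        gcongr
        have h3 := three_mul_sqrt_le hp
        rw [← hq] at h3
        calc _ = (q * √q) * ((mainConst M L m + 2 * tailConst M L m * (M / √m)) * N
              * (1 / √n * ε ^ (ρ / 2))) := by ring
          _ ≤ (6 * p ^ (3 / 2 : ℝ)) * ((mainConst M L m + 2 * tailConst M L m * (M / √m)) * N
              * (1 / √n * ε ^ (ρ / 2))) := by gcongr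
          _ = _ := by rw [concConst]; ring
    _ = _ := by
        rw [ENNReal.ofReal_mul (by positivity), ENNReal.ofReal_mul (by positivity),
          ENNReal.ofReal_mul (by positivity)]
        ring

theorem map_add_law (hV : IsRegularPotential V M L m) (θ : EuclideanSpace ℝ (Fin d)) :
    (law V 0).map (fun x => x + θ) = law V θ := by
  ext s hs
  rw [Measure.map_apply (measurable_add_const θ) hs, law, law,
    withDensity_apply _ (measurable_add_const θ hs), withDensity_apply _ hs]
  have h := (measurePreserving_add_right (volume : Measure (EuclideanSpace ℝ (Fin d)))
    θ).setLIntegral_comp_preimage hs (hV.measurable_density θ)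
  rw [← h]
  simp

theorem map_add_sampleLaw (hV : IsRegularPotential V M L m) (θ : EuclideanSpace ℝ (Fin d)) :
    (sampleLaw V n 0).map (fun x j => x j + θ) = sampleLaw V n θ := by
  have := hV.prob
  have hp : IsProbabilityMeasure ((law V 0).map fun x => x + θ) :=
    Measure.isProbabilityMeasure_map (measurable_add_const θ).aemeasurable
  rw [sampleLaw, sampleLaw, ← hV.map_add_law θ]
  exact Measure.pi_map_pi fun _ => (measurable_add_const θ).aemeasurable

end IsRegularPotential

theorem MemHolderSpace.holderBound {d : ℕ} {f : EuclideanSpace ℝ (Fin d) → ℝ} {ρ : ℝ}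
    (hf : MemHolderSpace 1 ρ f) : HolderBound f (holderNorm 1 ρ f).toReal ρ := by
  have htop := hf.2.ne
  have hsup : ∀ (j : ℕ) (_ : j ≤ 1) (x : EuclideanSpace ℝ (Fin d)),
      ‖iteratedFDeriv ℝ j f x‖ ≤ (holderNorm 1 ρ f).toReal := fun j hj x => by
    have h : ‖iteratedFDeriv ℝ j f x‖ₑ ≤ holderNorm 1 ρ f :=
      le_sup_of_le_left (le_iSup_of_le j (le_iSup_of_le hj (le_iSup_of_le x le_rfl)))
    rw [← toReal_enorm]
    exact ENNReal.toReal_mono htop h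
  refine ⟨hf.1.differentiable (by norm_num), fun x => ?_, fun x => ?_, fun x y => ?_⟩
  · have := hsup 0 zero_le_one x
    rwa [norm_iteratedFDeriv_zero] at this
  · have := hsup 1 le_rfl x
    rwa [norm_iteratedFDeriv_one] at this
  · rcases eq_or_ne x y with rfl | hxy
    · rw [sub_self, norm_zero]
      have := Real.rpow_nonneg (norm_nonneg (x - x)) ρ
      positivity
    have hpos : 0 < ‖x - y‖ ^ ρ := Real.rpow_pos_of_pos (norm_pos_iff.2 (sub_ne_zero.2 hxy)) ρ
    have h : ‖iteratedFDeriv ℝ 1 f x - iteratedFDeriv ℝ 1 f y‖ₑ / ENNReal.ofReal (‖x - y‖ ^ ρ)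
        ≤ holderNorm 1 ρ f :=
      le_sup_of_le_right (le_iSup_of_le x (le_iSup_of_le y (le_iSup_of_le hxy le_rfl)))
    rw [ENNReal.div_le_iff (by simpa using hpos) ENNReal.ofReal_ne_top] at h
    have h1 := ENNReal.toReal_mono (ENNReal.mul_ne_top htop ENNReal.ofReal_ne_top) h
    rw [toReal_enorm, ENNReal.toReal_mul, ENNReal.toReal_ofReal hpos.le] at h1
    refine le_trans ?_ h1
    refine ContinuousLinearMap.opNorm_le_bound _ (norm_nonneg _) fun v => ?_
    have h2 := (iteratedFDeriv ℝ 1 f x - iteratedFDeriv ℝ 1 f y).le_opNorm fun _ => v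
    simpa [iteratedFDeriv_one_apply] using h2

theorem HolderBound.comp_add {d : ℕ} {f : EuclideanSpace ℝ (Fin d) → ℝ} {N ρ : ℝ}
    (hf : HolderBound f N ρ) (θ : EuclideanSpace ℝ (Fin d)) :
    HolderBound (fun z => f (z + θ)) N ρ := by
  refine ⟨hf.differentiable.comp (differentiable_id.add_const θ), fun x => hf.abs_le _,
    fun x => ?_, fun x y => ?_⟩
  · rw [fderiv_comp_add_right]; exact hf.norm_fderiv_le _
  · rw [fderiv_comp_add_right, fderiv_comp_add_right]
    simpa using hf.norm_fderiv_sub_le (x + θ) (y + θ)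

/-- Reduction to the parameter `0`: the estimator is equivariant under translations, so `θ` may be
moved into `f`. -/
theorem IsRegularPotential.eLpNorm_concentration_shift {d n : ℕ}
    {V f : EuclideanSpace ℝ (Fin d) → ℝ} {M L m N ρ : ℝ} (hV : IsRegularPotential V M L m)
    (hf : HolderBound f N ρ) (hn : 1 ≤ n) (θ : EuclideanSpace ℝ (Fin d)) (p : ℝ≥0∞) :
    eLpNorm (fun x : Fin n → EuclideanSpace ℝ (Fin d) =>
        f (mle V x) - (∫ y, f (mle V y) ∂(sampleLaw V n θ))
          - (n : ℝ)⁻¹ * ∑ j, ⟪gradient V (x j - θ), (fisher V).inverse (gradient f θ)⟫) p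
        (sampleLaw V n θ)
      = eLpNorm (fun x : Fin n → EuclideanSpace ℝ (Fin d) =>
        f (mle V x + θ) - (∫ y, f (mle V y + θ) ∂(sampleLaw V n 0))
          - ⟪empScore V x, (fisher V).inverse (gradient (fun z => f (z + θ)) 0)⟫) p
        (sampleLaw V n 0) := by
  have hfc := hf.differentiable.continuous
  have hmc := hV.continuous_mle hn
  have hgc := hV.continuous_gradient
  have hmap : Measurable fun (x : Fin n → EuclideanSpace ℝ (Fin d)) (j : Fin n) => x j + θ := by
    fun_prop
  have hint : ∫ y, f (mle V y) ∂(sampleLaw V n θ) = ∫ y, f (mle V y + θ) ∂(sampleLaw V n 0) := by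
    have hfm : Continuous fun y : Fin n → EuclideanSpace ℝ (Fin d) => f (mle V y) := hfc.comp hmc
    rw [← hV.map_add_sampleLaw θ, integral_map hmap.aemeasurable hfm.aestronglyMeasurable]
    simp_rw [hV.mle_add_const hn]
  have hgrad : gradient (fun z => f (z + θ)) 0 = gradient f θ := by
    simp [gradient, fderiv_comp_add_right]
  rw [hint, hgrad]
  conv_lhs => rw [← hV.map_add_sampleLaw θ]
  rw [eLpNorm_map_measure (Continuous.aestronglyMeasurable (by fun_prop)) hmap.aemeasurable]
  congr 1
  ext x
  simp only [Function.comp_apply, add_sub_cancel_right]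
  rw [hV.mle_add_const hn, IsRegularPotential.inner_empScore]

end LogConcaveLocation

end

theorem mainTheorem10 :
    ∃ c : ℝ, 0 < c ∧ ∀ M L m : ℝ, 0 < M → 0 < L → 0 < m →
      ∃ C : ℝ, 0 < C ∧
        ∀ (d n : ℕ) (V : EuclideanSpace ℝ (Fin d) → ℝ),
          1 ≤ d →
          -- `e^{-V}` is a probability density, with `V` as in the standing assumption
          IsProbabilityMeasure (LogConcaveLocation.law V 0) →
          StrictConvexOn ℝ univ V →
          ContDiff ℝ 2 V →
          (∀ x, ‖LogConcaveLocation.hessian V x‖ ≤ M) →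
          (∀ x y, ‖LogConcaveLocation.hessian V x - LogConcaveLocation.hessian V y‖
            ≤ L * ‖x - y‖) →
          (∀ u, m * ‖u‖ ^ 2 ≤ ⟪LogConcaveLocation.fisher V u, u⟫) →
          (d : ℝ) ≤ c * (min (m / M) (m ^ 2 / (L * √M))) ^ 2 * n →
          ∀ (ρ : ℝ) (f : EuclideanSpace ℝ (Fin d) → ℝ), 0 < ρ → ρ ≤ 1 →
            LogConcaveLocation.MemHolderSpace 1 ρ f →
            -- the estimator and the expectations are well defined
            (∀ x : Fin n → EuclideanSpace ℝ (Fin d),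
              ∃! t, IsMinOn (LogConcaveLocation.empRisk V x) univ t) ∧
            (∀ θ, Integrable (fun x => f (LogConcaveLocation.mle V x))
              (LogConcaveLocation.sampleLaw V n θ)) ∧
            -- the concentration bound
            (⨆ θ, LogConcaveLocation.psiNorm (2 / 3)
              (fun x : Fin n → EuclideanSpace ℝ (Fin d) =>
                f (LogConcaveLocation.mle V x)
                  - (∫ y, f (LogConcaveLocation.mle V y) ∂(LogConcaveLocation.sampleLaw V n θ))
                  - (n : ℝ)⁻¹ * ∑ j, ⟪gradient V (x j - θ),
                      (LogConcaveLocation.fisher V).inverse (gradient f θ)⟫)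
              (LogConcaveLocation.sampleLaw V n θ))
            ≤ ENNReal.ofReal C
                * LogConcaveLocation.poincareConst (LogConcaveLocation.law V 0) ^ (1 / 2 : ℝ)
                * LogConcaveLocation.holderNorm 1 ρ f
                * ENNReal.ofReal (1 / √(n : ℝ) * ((d : ℝ) / n) ^ (ρ / 2)) := by
  open LogConcaveLocation in
  -- `294912 = 4 * 73728`, so that `4 * d ≤ tailRate M L m * n`
  refine ⟨1 / 294912, by norm_num, fun M L m hM hL hm => ⟨max 1 (concConst M L m), by positivity,
    fun d n V hd hprob hconv hsm hle hlip hfish hdn ρ f hρ hρ1 hf => ?_⟩⟩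
  have hV : IsRegularPotential V M L m := ⟨hM, hL, hm, hprob, hconv, hsm, hle, hlip, hfish⟩
  have hd0 : (0 : ℝ) < d := by exact_mod_cast hd
  have hn : 1 ≤ n := by
    by_contra h
    have : n = 0 := by omega
    rw [this, Nat.cast_zero, mul_zero] at hdn
    linarith
  have hn0 : (0 : ℝ) < n := by exact_mod_cast hn
  have hfb := hf.holderBound
  have hdn4 : 4 * (d : ℝ) ≤ tailRate M L m * n := by
    rw [tailRate, ratioBound]
    linarith
  have hdn1 : (d : ℝ) / n ≤ 1 := by
    rw [div_le_one hn0]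
    have h1 : min (m / M) (m ^ 2 / (L * √M)) ^ 2 ≤ 1 := by
      refine pow_le_one₀ (le_min (by positivity) (by positivity)) ((min_le_left _ _).trans ?_)
      exact (div_le_one hM).2 (hV.m_le_M hd)
    have h2 := mul_le_mul_of_nonneg_right h1 hn0.le
    linarith
  refine ⟨fun x => ⟨mle V x, hV.isMinOn_mle hn x, fun t ht => hV.eq_mle hn ht⟩, fun θ => ?_, ?_⟩
  · have hθ : IsProbabilityMeasure (sampleLaw V n θ) := by
      have := hV.isProbabilityMeasure_sampleLaw (n := n)
      rw [← hV.map_add_sampleLaw θ]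
      exact Measure.isProbabilityMeasure_map (Measurable.aemeasurable (by fun_prop))
    exact Integrable.of_bound (hfb.differentiable.continuous.comp
      (hV.continuous_mle hn)).aestronglyMeasurable _
      (Filter.Eventually.of_forall fun x => hfb.abs_le _)
  · refine iSup_le fun θ => iSup₂_le fun p hp => ?_
    have hp0 : 0 < p := by linarith
    rw [hV.eLpNorm_concentration_shift hfb hn θ]
    have hfθ := hfb.comp_add θ
    rcases eq_or_ne (poincareConst (law V 0)) ∞ with hK | hK
    · rcases eq_or_ne (holderNorm 1 ρ f) 0 with h0 | h0
      · -- the Hölder norm vanishes only for the zero function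
        rw [h0, ENNReal.toReal_zero] at hfθ
        have hz : (fun z => f (z + θ)) = fun _ => 0 :=
          funext fun z => abs_nonpos_iff.1 (hfθ.abs_le z)
        have hz' : ∀ z, f (z + θ) = 0 := fun z => congrFun hz z
        have hg : gradient (fun _ : EuclideanSpace ℝ (Fin d) => (0 : ℝ)) 0 = 0 := by
          simp [gradient]
        simp [hz', hg]
      · have hr : 0 < 1 / √(n : ℝ) * ((d : ℝ) / n) ^ (ρ / 2) := by positivity
        have hC : ENNReal.ofReal (max 1 (concConst M L m)) ≠ 0 := by simp
        rw [hK, ENNReal.top_rpow_of_pos (by norm_num), ENNReal.mul_top hC, ENNReal.top_mul h0,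
          ENNReal.top_mul (ENNReal.ofReal_pos.2 hr).ne']
        exact le_top
    · have h := hV.eLpNorm_concentration_le hfθ hρ hρ1 hd hn hdn1 hdn4 hK hp
      refine (mul_le_mul' le_rfl h).trans ?_
      rw [← mul_assoc, ← ENNReal.ofReal_mul (by positivity), ← Real.rpow_add hp0,
        ENNReal.ofReal_toReal hf.2.ne]
      have e : (-1 / (2 / 3) + 3 / 2 : ℝ) = 0 := by norm_num
      rw [e, Real.rpow_zero, ENNReal.ofReal_one, one_mul]
      gcongr
      exact le_max_right _ _
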